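/- Let $n\ge 1$ and let $\mathbb{CP}^n$ carry the Fubini–Study metric, normalized as the metric whose pull-back to $\mathbb C^{n+1}\setminus\{0\}$ is, at $Z$, $$h_Z(V,W)=\operatorname{Re}\frac{\langle Z,Z\rangle\langle V,W\rangle-\langle V,Z\rangle\langle Z,W\rangle}{\langle Z,Z\rangle^2},$$ where $\langle\cdot,\cdot\rangle$ is the standard Hermitian inner product, conjugate-linear in the first argument. Let $\mu$ be the Riemannian volume measure, $\operatorname{vol}(\mathbb{CP}^n)=\mu(\mathbb{CP}^n)$, let $r$ be the geodesic distance, and let $\Delta$ be the Laplace–Beltrami operator, in local coordinates $\Delta f=-\frac{1}{\sqrt{|\det g|}}\sum_{i,j}\partial_{x_j}\bigl(g^{ij}\sqrt{|\det g|}\,\partial_{x_i}f\bigr)$. Then: (a) For all $\xi=[v]$ and $\eta=[w]$ in $\mathbb{CP}^n$, $$r(\xi,\eta)=\arccos\sqrt{\frac{|\langle v,w\rangle|^2}{|v|^2\,|w|^2}}.$$ (b) The function $$G(\xi,\eta)=-\frac{1}{2n\cdot\operatorname{vol}(\mathbb{CP}^n)}\left(\log\bigl(\sin r(\xi,\eta)\bigr)-\sum_{j=1}^{n-1}\frac{1}{2j\,\sin^{2j}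 r(\xi,\eta)}\right),\qquad \xi\ne\eta,$$ is a Green's function of $\Delta$, that is: 1. for every $\varphi\in C^2(\mathbb{CP}^n,\mathbb R)$ and every $p\in\mathbb{CP}^n$, the function $q\mapsto G(p,q)\,\Delta\varphi(q)$ is integrable and $$\varphi(p)=\frac{1}{\operatorname{vol}(\mathbb{CP}^n)}\int_{\mathbb{CP}^n}\varphi(q)\,d\mu(q)+\int_{\mathbb{CP}^n}G(p,q)\,\Delta\varphi(q)\,d\mu(q);$$ 2. $G$ is smooth on $(\mathbb{CP}^n\times\mathbb{CP}^n)\setminus\{(p,p):p\in\mathbb{CP}^n\}$; 3. $G(p,q)=G(q,p)$ for all $p\neq q$; 4. $G(p,\cdot)$ is integrable for every $p$, and $\int_{\mathbb{CP}^n}G(p,q)\,d\mu(q)$ does not depend on $p$. -/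

import Mathlib

open Set Topology MeasureTheory Bundle
open scoped Manifold ContDiff InnerProductSpace LinearAlgebra.Projectivization

noncomputable section

/-! ### Riemannian geometry: volume, Laplace–Beltrami operator, Green's functions

In this section `M` is a manifold without boundary, modelled on a finite-dimensional Euclidean
space `E`, whose tangent spaces carry inner products (a Riemannian metric). -/

namespace RiemannianGeometry

section General

variable {E : Type*} [NormedAddCommGroup E] [InnerProductSpace ℝ E] [FiniteDimensional ℝ E]
  {M : Type*} [TopologicalSpace M] [ChartedSpace E M]
  [RiemannianBundle (fun x : M => TangentSpace 𝓘(ℝ, E) x)]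

/-- The matrix `(g_ij)` of the Riemannian metric in the local coordinates given by the chart `c`
and the standard orthonormal basis `b` of the model space `E`, at the coordinate point `u`:
`g_ij(u) = ⟪∂_i, ∂_j⟫`, where `∂_i` is the image of `b i` under the derivative of `c⁻¹` at `u`. -/
def metricMatrix (c : OpenPartialHomeomorph M E) (u : E) :
    Matrix (Fin (Module.finrank ℝ E)) (Fin (Module.finrank ℝ E)) ℝ :=
  Matrix.of fun i j =>
    ⟪mfderiv 𝓘(ℝ, E) 𝓘(ℝ, E) c.symm u (stdOrthonormalBasis ℝ E i),
      mfderiv 𝓘(ℝ, E) 𝓘(ℝ, E) c.symm u (stdOrthonormalBasis ℝ E j)⟫_ℝ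

/-- The density `√|det (g_ij)|` of the Riemannian volume in the chart `c`. -/
def volumeDensity (c : OpenPartialHomeomorph M E) (u : E) : ℝ :=
  √|(metricMatrix c u).det|

/-- The Laplace–Beltrami operator, with the geometers' sign,
`Δ f = - (1 / √|det g|) ∑_{i,j} ∂_j (g^{ij} √|det g| ∂_i f)`,
computed at `x` in the local coordinates of the preferred chart at `x`. -/
def laplaceBeltrami (f : M → ℝ) (x : M) : ℝ :=
  - (1 / volumeDensity (chartAt E x) (chartAt E x x)) *
    ∑ i, ∑ j, fderiv ℝ
      (fun u => ((metricMatrix (chartAt E x) u)⁻¹ i j) * volumeDensity (chartAt E x) u *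
        fderiv ℝ (fun w => f ((chartAt E x).symm w)) u (stdOrthonormalBasis ℝ E i))
      (chartAt E x x) (stdOrthonormalBasis ℝ E j)

variable [MeasurableSpace E] [BorelSpace E] [MeasurableSpace M]

/-- The Riemannian volume of (the domain of) a single chart `c`, as a measure on `M`: the image
under `c⁻¹` of the measure `√|det g| dx_1 ⋯ dx_m` on the coordinate domain. -/
def chartVolume (c : OpenPartialHomeomorph M E) : Measure M :=
  ((volume.restrict c.target).withDensity
    (fun u => ENNReal.ofReal (volumeDensity c u))).map c.symm

variable (E M) in
/-- The Riemannian volume measure `μ` of `M`. The measures `chartVolume c` agree on overlaps of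
charts, and their supremum is the measure that restricts to each of them. -/
def riemannianVolume : Measure M :=
  ⨆ c ∈ atlas E M, chartVolume c

variable (E M) in
/-- The total volume `vol(M)`. -/
def totalVolume : ℝ :=
  (riemannianVolume E M).real univ

variable (E) in
/-- The geodesic distance: the infimum of the lengths of `C^1` paths. -/
def geodesicDist (x y : M) : ℝ :=
  (Manifold.riemannianEDist 𝓘(ℝ, E) x y).toReal

variable (E) in
/-- `G` is a Green's function of the Laplace–Beltrami operator on the compact manifold `M`.
Only the values of `G` off the diagonal matter. -/
structure IsGreenFunction (G : M → M → ℝ) : Prop where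
  /-- For every `C^2` function `φ` and every `p`, the function `q ↦ G(p,q) Δφ(q)` is integrable,
  and `φ(p) = vol(M)⁻¹ ∫ φ dμ + ∫ G(p,q) Δφ(q) dμ(q)`. -/
  representation : ∀ φ : M → ℝ, ContMDiff 𝓘(ℝ, E) 𝓘(ℝ, ℝ) 2 φ → ∀ p : M,
    IntegrableOn (fun q => G p q * laplaceBeltrami (E := E) φ q) {p}ᶜ (riemannianVolume E M) ∧
    φ p = 1 / totalVolume E M * ∫ q, φ q ∂(riemannianVolume E M) +
      ∫ q in {p}ᶜ, G p q * laplaceBeltrami (E := E) φ q ∂(riemannianVolume E M)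
  /-- `G` is smooth off the diagonal. -/
  smooth : ContMDiffOn (𝓘(ℝ, E).prod 𝓘(ℝ, E)) 𝓘(ℝ, ℝ) ∞ (fun x : M × M => G x.1 x.2)
    {x : M × M | x.1 ≠ x.2}
  /-- `G` is symmetric. -/
  symm : ∀ p q : M, p ≠ q → G p q = G q p
  /-- `G(p, ·)` is integrable for every `p`. -/
  integrable : ∀ p : M, IntegrableOn (fun q => G p q) {p}ᶜ (riemannianVolume E M)
  /-- The integral of `G(p, ·)` does not depend on `p`. -/
  integral_const : ∃ C : ℝ, ∀ p : M, ∫ q in {p}ᶜ, G p q ∂(riemannianVolume E M) = C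

end General

end RiemannianGeometry

/-! ### Complex projective space with the Fubini–Study metric -/

/-- Complex projective space: the complex lines in `ℂ^(n+1)` with its Hermitian inner product. -/
abbrev ComplexProjectiveSpace (n : ℕ) : Type :=
  ℙ ℂ (EuclideanSpace ℂ (Fin (n + 1)))

namespace ComplexProjectiveSpace

/-- The quotient topology from `ℂ^(n+1) ∖ {0}`. -/
instance (n : ℕ) : TopologicalSpace (ComplexProjectiveSpace n) :=
  inferInstanceAs (TopologicalSpace
    (Quotient (projectivizationSetoid ℂ (EuclideanSpace ℂ (Fin (n + 1))))))

/-- The Borel `σ`-algebra. -/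
instance (n : ℕ) : MeasurableSpace (ComplexProjectiveSpace n) := borel _

instance (n : ℕ) : BorelSpace (ComplexProjectiveSpace n) := ⟨rfl⟩

theorem isQuotientMap_mk' (n : ℕ) :
    IsQuotientMap (Projectivization.mk' ℂ (V := EuclideanSpace ℂ (Fin (n + 1)))) :=
  isQuotientMap_quotient_mk'

/-- The vector of `ℂ^(n+1)` whose `i`-th coordinate is `a` and whose other coordinates are,
in order, those of `z`. -/
def insertCoord {n : ℕ} (i : Fin (n + 1)) (a : ℂ) (z : EuclideanSpace ℂ (Fin n)) :
    EuclideanSpace ℂ (Fin (n + 1)) :=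
  WithLp.toLp 2 (Fin.insertNth (α := fun _ => ℂ) i a (fun k => z k))

@[simp] theorem insertCoord_same {n : ℕ} (i : Fin (n + 1)) (a : ℂ) (z : EuclideanSpace ℂ (Fin n)) :
    insertCoord i a z i = a := by
  simp [insertCoord]

@[simp] theorem insertCoord_succAbove {n : ℕ} (i : Fin (n + 1)) (a : ℂ)
    (z : EuclideanSpace ℂ (Fin n)) (k : Fin n) : insertCoord i a z (i.succAbove k) = z k := by
  simp [insertCoord]

theorem insertCoord_ne_zero {n : ℕ} (i : Fin (n + 1)) {a : ℂ} (ha : a ≠ 0)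
    (z : EuclideanSpace ℂ (Fin n)) : insertCoord i a z ≠ 0 := by
  intro h
  apply ha
  rw [← insertCoord_same i a z, h]
  rfl

theorem contDiff_insertCoord {n : ℕ} (i : Fin (n + 1)) (a : ℂ) :
    ContDiff ℝ ∞ (fun z : EuclideanSpace ℂ (Fin n) => insertCoord i a z) := by
  rw [contDiff_piLp]
  intro j
  rcases Fin.eq_self_or_eq_succAbove i j with rfl | ⟨k, rfl⟩
  · simpa using contDiff_const
  · simp only [insertCoord_succAbove]
    fun_prop

/-- The affine coordinates `(Z_k / Z_i)_{k ≠ i}` of a vector `Z`. -/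
def dehomogenize {n : ℕ} (i : Fin (n + 1)) (Z : EuclideanSpace ℂ (Fin (n + 1))) :
    EuclideanSpace ℂ (Fin n) :=
  WithLp.toLp 2 fun k => Z (i.succAbove k) / Z i

theorem dehomogenize_smul {n : ℕ} (i : Fin (n + 1)) (Z : EuclideanSpace ℂ (Fin (n + 1)))
    {a : ℂ} (ha : a ≠ 0) : dehomogenize i (a • Z) = dehomogenize i Z := by
  ext k
  simp [dehomogenize, mul_div_mul_left _ _ ha]

theorem dehomogenize_rep {n : ℕ} (i : Fin (n + 1)) (Z : EuclideanSpace ℂ (Fin (n + 1)))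
    (hZ : Z ≠ 0) : dehomogenize i (Projectivization.mk ℂ Z hZ).rep = dehomogenize i Z := by
  obtain ⟨a, ha⟩ := Projectivization.exists_smul_eq_mk_rep ℂ Z hZ
  rw [← ha]
  exact dehomogenize_smul i Z a.ne_zero

theorem rep_apply_ne_zero_iff {n : ℕ} (i : Fin (n + 1)) (Z : EuclideanSpace ℂ (Fin (n + 1)))
    (hZ : Z ≠ 0) : (Projectivization.mk ℂ Z hZ).rep i ≠ 0 ↔ Z i ≠ 0 := by
  obtain ⟨a, ha⟩ := Projectivization.exists_smul_eq_mk_rep ℂ Z hZ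
  rw [← ha]
  have : (a • Z) i = (a : ℂ) * Z i := rfl
  rw [this]
  simp

theorem contDiffOn_dehomogenize {n : ℕ} (i : Fin (n + 1)) :
    ContDiffOn ℝ ∞ (fun Z : EuclideanSpace ℂ (Fin (n + 1)) => dehomogenize i Z)
      {Z | Z i ≠ 0} := by
  rw [contDiffOn_piLp]
  intro k
  have h : ∀ j : Fin (n + 1), ContDiff ℝ ∞ (fun Z : EuclideanSpace ℂ (Fin (n + 1)) => Z j) := by
    intro j
    fun_prop
  simp only [dehomogenize, div_eq_mul_inv]
  exact (h _).contDiffOn.mul ((h i).contDiffOn.inv (fun Z hZ => hZ))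

theorem isOpen_setOf_rep_ne_zero {n : ℕ} (i : Fin (n + 1)) :
    IsOpen {x : ComplexProjectiveSpace n | x.rep i ≠ 0} := by
  rw [← (isQuotientMap_mk' n).isOpen_preimage]
  have : Projectivization.mk' ℂ ⁻¹' {x : ComplexProjectiveSpace n | x.rep i ≠ 0} =
      {Z : {Z : EuclideanSpace ℂ (Fin (n + 1)) // Z ≠ 0} | Z.1 i ≠ 0} := by
    ext ⟨Z, hZ⟩
    exact rep_apply_ne_zero_iff i Z hZ
  rw [this]
  exact isOpen_ne_fun (by fun_prop) continuous_const

/-- The affine chart `[Z] ↦ (Z_k / Z_i)_{k ≠ i}`, defined where `Z_i ≠ 0`, with inverse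
`z ↦ [z_1 : ⋯ : 1 : ⋯ : z_n]` (the entry `1` in position `i`). -/
def affineChart {n : ℕ} (i : Fin (n + 1)) :
    OpenPartialHomeomorph (ComplexProjectiveSpace n) (EuclideanSpace ℂ (Fin n)) where
  toFun x := dehomogenize i x.rep
  invFun z := Projectivization.mk ℂ (insertCoord i 1 z) (insertCoord_ne_zero i one_ne_zero z)
  source := {x | x.rep i ≠ 0}
  target := univ
  map_source' _ _ := mem_univ _
  map_target' z _ := by
    refine (rep_apply_ne_zero_iff i _ (insertCoord_ne_zero i one_ne_zero z)).2 ?_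
    simp
  left_inv' x hx := by
    have hx' : x.rep i ≠ 0 := hx
    conv_rhs => rw [← x.mk_rep]
    rw [Projectivization.mk_eq_mk_iff']
    refine ⟨(x.rep i)⁻¹, ?_⟩
    ext j
    rcases Fin.eq_self_or_eq_succAbove i j with rfl | ⟨k, rfl⟩
    · simp [hx']
    · simp [dehomogenize, div_eq_inv_mul]
  right_inv' z _ := by
    rw [dehomogenize_rep]
    ext k
    simp [dehomogenize]
  open_source := isOpen_setOf_rep_ne_zero i
  open_target := isOpen_univ
  continuousOn_toFun := by
    rw [(isQuotientMap_mk' n).continuousOn_isOpen_iff (isOpen_setOf_rep_ne_zero i)]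
    have h : ((fun x : ComplexProjectiveSpace n => dehomogenize i x.rep) ∘
        Projectivization.mk' ℂ) = fun Z => dehomogenize i Z.1 := by
      funext Z
      exact dehomogenize_rep i Z.1 Z.2
    rw [h]
    refine (contDiffOn_dehomogenize i).continuousOn.comp continuous_subtype_val.continuousOn ?_
    rintro ⟨Z, hZ⟩ h
    exact (rep_apply_ne_zero_iff i Z hZ).1 h
  continuousOn_invFun :=
    ((isQuotientMap_mk' n).continuous.comp
      ((contDiff_insertCoord i 1).continuous.subtype_mk _)).continuousOn

theorem exists_rep_ne_zero {n : ℕ} (x : ComplexProjectiveSpace n) : ∃ i, x.rep i ≠ 0 := by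
  by_contra! h
  exact x.rep_nonzero (by ext i; exact h i)

/-- An index `i` with `Z_i ≠ 0`, where `x = [Z]`. -/
def chartIndex {n : ℕ} (x : ComplexProjectiveSpace n) : Fin (n + 1) :=
  (exists_rep_ne_zero x).choose

theorem chartIndex_spec {n : ℕ} (x : ComplexProjectiveSpace n) : x.rep (chartIndex x) ≠ 0 :=
  (exists_rep_ne_zero x).choose_spec

/-- The standard atlas, consisting of the `n + 1` affine charts. -/
instance (n : ℕ) : ChartedSpace (EuclideanSpace ℂ (Fin n)) (ComplexProjectiveSpace n) where
  atlas := range affineChart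
  chartAt x := affineChart (chartIndex x)
  mem_chart_source x := chartIndex_spec x
  chart_mem_atlas _ := mem_range_self _

/-- Complex projective space is a smooth manifold (of real dimension `2n`). -/
instance (n : ℕ) : IsManifold 𝓘(ℝ, EuclideanSpace ℂ (Fin n)) ∞ (ComplexProjectiveSpace n) := by
  apply isManifold_of_contDiffOn
  rintro _ _ ⟨i, rfl⟩ ⟨j, rfl⟩
  have h : ∀ z : EuclideanSpace ℂ (Fin n),
      affineChart j ((affineChart i).symm z) = dehomogenize j (insertCoord i 1 z) :=
    fun z => dehomogenize_rep j _ _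
  refine ((contDiffOn_dehomogenize j).comp (contDiff_insertCoord i 1).contDiffOn ?_
    (s := (((affineChart i).symm.trans (affineChart j)).source))).congr_mono
      (fun z _ => h z) ?_
  · intro z hz
    exact (rep_apply_ne_zero_iff j _ _).1 hz.2
  · intro z hz
    exact hz.1

/-- The Fubini–Study form on `ℂ^(n+1)` at a nonzero vector `Z`:
`h_Z(V, W) = Re (⟨Z,Z⟩⟨V,W⟩ - ⟨V,Z⟩⟨Z,W⟩) / ⟨Z,Z⟩²`.
It is the pull-back to `ℂ^(n+1) ∖ {0}` of the Fubini–Study metric. -/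
def fubiniStudyForm {n : ℕ} (Z V W : EuclideanSpace ℂ (Fin (n + 1))) : ℝ :=
  (⟪Z, Z⟫_ℂ * ⟪V, W⟫_ℂ - ⟪V, Z⟫_ℂ * ⟪Z, W⟫_ℂ).re / ‖Z‖ ^ 4

theorem fubiniStudyForm_comm {n : ℕ} (Z V W : EuclideanSpace ℂ (Fin (n + 1))) :
    fubiniStudyForm Z V W = fubiniStudyForm Z W V := by
  unfold fubiniStudyForm
  congr 1
  rw [← Complex.conj_re]
  simp only [map_sub, map_mul, inner_conj_symm]
  ring_nf

theorem insertCoord_zero_add {n : ℕ} (i : Fin (n + 1)) (v w : EuclideanSpace ℂ (Fin n)) :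
    insertCoord i 0 (v + w) = insertCoord i 0 v + insertCoord i 0 w := by
  ext j
  rcases Fin.eq_self_or_eq_succAbove i j with rfl | ⟨k, rfl⟩ <;> simp

theorem insertCoord_zero_smul {n : ℕ} (i : Fin (n + 1)) (t : ℝ) (v : EuclideanSpace ℂ (Fin n)) :
    insertCoord i 0 (t • v) = t • insertCoord i 0 v := by
  ext j
  rcases Fin.eq_self_or_eq_succAbove i j with rfl | ⟨k, rfl⟩ <;> simp

/-- The Fubini–Study metric in the `i`-th affine chart at the coordinate point `z`: the pull-back
of the Fubini–Study form along the lift `z ↦ (z_1, …, 1, …, z_n)` of the inverse chart, whose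
derivative is `v ↦ (v_1, …, 0, …, v_n)`. -/
def chartForm {n : ℕ} (i : Fin (n + 1)) (z v w : EuclideanSpace ℂ (Fin n)) : ℝ :=
  fubiniStudyForm (insertCoord i 1 z) (insertCoord i 0 v) (insertCoord i 0 w)

theorem chartForm_pos {n : ℕ} (i : Fin (n + 1)) (z v : EuclideanSpace ℂ (Fin n)) (hv : v ≠ 0) :
    0 < chartForm i z v v := by
  set Z := insertCoord i 1 z with hZdef
  set V := insertCoord i 0 v with hVdef
  have hZ : Z ≠ 0 := insertCoord_ne_zero i one_ne_zero z
  have hV : V ≠ 0 := by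
    intro h
    apply hv
    ext k
    have := congrArg (fun X : EuclideanSpace ℂ (Fin (n + 1)) => X (i.succAbove k)) h
    simpa [hVdef] using this
  have hlt : ‖⟪Z, V⟫_ℂ‖ < ‖Z‖ * ‖V‖ := by
    refine lt_of_le_of_ne (norm_inner_le_norm _ _) fun h => ?_
    have h' : Z = 0 ∨ ∃ r : ℂ, V = r • Z := ((norm_inner_eq_norm_tfae ℂ Z V).out 0 2).1 h
    obtain ⟨r, h⟩ := h'.resolve_left hZ
    have h0 := congrArg (fun X : EuclideanSpace ℂ (Fin (n + 1)) => X i) h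
    have hr0 : r = 0 := by simpa [hVdef, hZdef] using h0.symm
    exact hV (by rw [h, hr0, zero_smul])
  have hZ0 : 0 < ‖Z‖ := norm_pos_iff.2 hZ
  unfold chartForm fubiniStudyForm
  rw [← hZdef, ← hVdef]
  refine div_pos ?_ (by positivity)
  have h1 : ⟪V, Z⟫_ℂ * ⟪Z, V⟫_ℂ = ((‖⟪Z, V⟫_ℂ‖ ^ 2 : ℝ) : ℂ) := by
    rw [← inner_conj_symm V Z, mul_comm, Complex.mul_conj, Complex.normSq_eq_norm_sq]
  rw [h1, inner_self_eq_norm_sq_to_K, inner_self_eq_norm_sq_to_K]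
  have h2 : (((‖Z‖ : ℂ) ^ 2 * (‖V‖ : ℂ) ^ 2 - ((‖⟪Z, V⟫_ℂ‖ ^ 2 : ℝ) : ℂ))).re =
      (‖Z‖ * ‖V‖) ^ 2 - ‖⟪Z, V⟫_ℂ‖ ^ 2 := by
    rw [← Complex.ofReal_re ((‖Z‖ * ‖V‖) ^ 2 - ‖⟪Z, V⟫_ℂ‖ ^ 2)]
    congr 1
    push_cast
    ring
  refine lt_of_lt_of_eq ?_ h2.symm
  have := norm_nonneg ⟪Z, V⟫_ℂ
  nlinarith

/-- `chartForm` as a continuous bilinear form. -/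
def chartBilin {n : ℕ} (i : Fin (n + 1)) (z : EuclideanSpace ℂ (Fin n)) :
    EuclideanSpace ℂ (Fin n) →L[ℝ] EuclideanSpace ℂ (Fin n) →L[ℝ] ℝ :=
  LinearMap.toContinuousBilinearMap <|
    LinearMap.mk₂ ℝ (chartForm i z)
      (fun v v' w => by
        simp only [chartForm, fubiniStudyForm, insertCoord_zero_add, inner_add_left, mul_add,
          add_mul, Complex.sub_re, Complex.add_re]
        ring)
      (fun t v w => by
        simp only [chartForm, fubiniStudyForm, insertCoord_zero_smul, inner_smul_left_eq_smul,
          Complex.real_smul, smul_eq_mul]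
        rw [← mul_div_assoc, ← Complex.re_ofReal_mul]
        ring_nf)
      (fun v w w' => by
        simp only [chartForm, fubiniStudyForm, insertCoord_zero_add, inner_add_right, mul_add,
          Complex.sub_re, Complex.add_re]
        ring)
      (fun t v w => by
        simp only [chartForm, fubiniStudyForm, insertCoord_zero_smul, inner_smul_right_eq_smul,
          Complex.real_smul, smul_eq_mul]
        rw [← mul_div_assoc, ← Complex.re_ofReal_mul]
        ring_nf)

theorem chartBilin_apply {n : ℕ} (i : Fin (n + 1)) (z v w : EuclideanSpace ℂ (Fin n)) :
    chartBilin i z v w = chartForm i z v w := rfl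

theorem isVonNBounded_chartBilin {n : ℕ} (i : Fin (n + 1)) (z : EuclideanSpace ℂ (Fin n)) :
    Bornology.IsVonNBounded ℝ {v : EuclideanSpace ℂ (Fin n) | chartBilin i z v v < 1} := by
  have hcont : Continuous fun v : EuclideanSpace ℂ (Fin n) => chartBilin i z v v := by fun_prop
  have key : ∃ c : ℝ, 0 < c ∧ ∀ v : EuclideanSpace ℂ (Fin n), ‖v‖ = 1 → c ≤ chartBilin i z v v := by
    rcases (Metric.sphere (0 : EuclideanSpace ℂ (Fin n)) 1).eq_empty_or_nonempty with h | h
    · refine ⟨1, one_pos, fun v hv => ?_⟩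
      have : v ∈ Metric.sphere (0 : EuclideanSpace ℂ (Fin n)) 1 := by simpa using hv
      rw [h] at this
      exact this.elim
    · obtain ⟨v₀, hv₀, hmin⟩ := (isCompact_sphere (0 : EuclideanSpace ℂ (Fin n)) 1).exists_isMinOn
        h hcont.continuousOn
      refine ⟨_, chartForm_pos i z v₀ ?_, fun v hv => hmin (by simpa using hv)⟩
      rintro rfl
      simp at hv₀
  obtain ⟨c, hc, h⟩ := key
  rw [NormedSpace.isVonNBounded_iff, isBounded_iff_forall_norm_le]
  refine ⟨√(1 / c), fun v hv => Real.le_sqrt_of_sq_le ?_⟩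
  have hv' : chartBilin i z v v < 1 := hv
  rcases eq_or_ne v 0 with rfl | hv0
  · simpa using hc.le
  have hn : 0 < ‖v‖ := norm_pos_iff.2 hv0
  have h1 := h ((‖v‖⁻¹ : ℝ) • v) (by rw [norm_smul, norm_inv, norm_norm, inv_mul_cancel₀ hn.ne'])
  simp only [map_smul, _root_.smul_apply, smul_eq_mul] at h1
  rw [le_div_iff₀ hc]
  have h2 : ‖v‖ ^ 2 * c ≤ ‖v‖ ^ 2 * (‖v‖⁻¹ * (‖v‖⁻¹ * chartBilin i z v v)) := by gcongr
  have h3 : ‖v‖ ^ 2 * (‖v‖⁻¹ * (‖v‖⁻¹ * chartBilin i z v v)) = chartBilin i z v v := by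
    field_simp
  linarith

/-- The Fubini–Study metric on complex projective space. The tangent space at `x` is the model
space `ℂ^n`, through the preferred chart at `x`. -/
def fubiniStudyMetric (n : ℕ) :
    RiemannianMetric (fun x : ComplexProjectiveSpace n =>
      TangentSpace 𝓘(ℝ, EuclideanSpace ℂ (Fin n)) x) where
  inner x := chartBilin (chartIndex x) (affineChart (chartIndex x) x)
  symm _ _ _ := fubiniStudyForm_comm _ _ _
  pos _ v hv := chartForm_pos _ _ v hv
  continuousAt x := by
    have h : Continuous fun v : EuclideanSpace ℂ (Fin n) =>
      chartBilin (chartIndex x) (affineChart (chartIndex x) x) v v := by fun_prop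
    exact h.continuousAt
  isVonNBounded x := isVonNBounded_chartBilin (chartIndex x) (affineChart (chartIndex x) x)

instance (n : ℕ) : RiemannianBundle (fun x : ComplexProjectiveSpace n =>
    TangentSpace 𝓘(ℝ, EuclideanSpace ℂ (Fin n)) x) :=
  ⟨fubiniStudyMetric n⟩

end ComplexProjectiveSpace

end

/-! The proof works on `V = ℂ^(n+1)`: functions, measures and operators on `ℂP^n` are replaced by
their lifts along `Z ↦ [Z]`.

*Distance.* Put `cos² r = |⟨v, w⟩|² / (|v|² |w|²)`. Along a `C^1` path the derivative of `cos² r` is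
bounded by `2 cos r sin r` times the speed (`fderiv_cosSq_sq_le`), so no path is shorter than `r`
(`le_riemannianEDist`). The projection of a great circle arc attains this length
(`riemannianEDist_proj_le`).

*Volume and Laplacian.* In affine coordinates the metric is a rank-two perturbation of a multiple of
the identity matrix, so its inverse and determinant are explicit. Hence the Riemannian volume is,
up to a constant, the image of `w(|Z|²) dZ` for a fixed bump function `w` (`riemannianVolume_eq`),
and `Δφ` at `[Z]` is `-|Z|²` times the flat Laplacian of the lift of `φ` (`laplaceBeltrami_proj`).
Integration by parts on `V` shows that `Δ` is symmetric (`integral_mul_laplaceBeltrami_comm`): the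
derivative of the weight is radial, while lifts have no radial derivative.

*Green's function.* Let `s = sin² r(p, ·)`. Then `Δ(f(s)) = -4 (s(1-s) f'' + (n-(n+1)s) f')`
(`laplaceBeltrami_comp_sinSq`), and up to the factor `-1 / (2 n vol)` the Green's function is `γ(s)`
with `γ' = (∑_{i<n} s^i) / (2 s^n)`. Replace `s^n` in the denominator by `s^n + ε`. The resulting
`γ_ε(s)` is smooth, and `Δ(γ_ε(s)) = 2n (1 - δ_ε(s))` with `δ_ε = ε(1+ε) / (s^n+ε)² ≥ 0`
(`laplaceBeltrami_regProfile`). By symmetry of `Δ` the integral of `δ_ε` is `vol`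
(`integral_regDelta`), so `δ_ε` is `vol` times an approximate identity at `p`, and
`∫ γ_ε(s) Δφ = 2n (∫ φ - ∫ φ δ_ε)`. The limit `ε → 0` is the representation formula
(`integral_profile_mul_laplaceBeltrami`). The dominating function is `γ(s)` itself, which is
integrable by Fatou's lemma and the symmetry of `Δ` applied to `γ_ε(s)` and `s`
(`integral_sub_regProfile_le`).

The integral of `G(p, ·)` is independent of `p` since the unitary group acts transitively and
preserves the volume and `s`. -/

noncomputable section

namespace ComplexProjectiveSpace

section Geometry

variable {n : ℕ}

/-! ### The projection from `ℂ^(n+1)` and the Fubini–Study form -/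

theorem real_inner_eq_re {m : ℕ} (z w : EuclideanSpace ℂ (Fin m)) : ⟪z, w⟫_ℝ = (⟪z, w⟫_ℂ).re := by
  rw [PiLp.inner_apply, PiLp.inner_apply]
  simp

/-- The projection `Z ↦ [Z]`, as a function on all of `ℂ^(n+1)`; its value at `0` is
irrelevant. -/
def proj (Z : EuclideanSpace ℂ (Fin (n + 1))) : ComplexProjectiveSpace n :=
  if h : Z = 0 then Projectivization.mk ℂ (insertCoord 0 1 0) (insertCoord_ne_zero 0 one_ne_zero 0)
  else Projectivization.mk ℂ Z h

theorem proj_of_ne_zero {Z : EuclideanSpace ℂ (Fin (n + 1))} (h : Z ≠ 0) :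
    proj Z = Projectivization.mk ℂ Z h := by
  simp [proj, h]

theorem proj_rep (x : ComplexProjectiveSpace n) : proj x.rep = x := by
  rw [proj_of_ne_zero x.rep_nonzero, x.mk_rep]

theorem proj_smul {a : ℂ} (ha : a ≠ 0) (Z : EuclideanSpace ℂ (Fin (n + 1))) :
    proj (a • Z) = proj Z := by
  by_cases hZ : Z = 0
  · simp [hZ]
  · rw [proj_of_ne_zero hZ, proj_of_ne_zero (smul_ne_zero ha hZ), Projectivization.mk_eq_mk_iff']
    exact ⟨a, rfl⟩

theorem continuousOn_proj : ContinuousOn (proj (n := n)) {0}ᶜ := by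
  rw [continuousOn_iff_continuous_domRestrict]
  convert! (isQuotientMap_mk' n).continuous using 1
  ext Z
  exact proj_of_ne_zero Z.2

theorem measurable_proj : Measurable (proj (n := n)) :=
  measurable_of_continuousOn_compl_singleton 0 continuousOn_proj

/-- A function on projective space is continuous as soon as its lift to `ℂ^(n+1) ∖ {0}` is. -/
theorem continuous_of_comp_proj {Y : Type*} [TopologicalSpace Y] {f : ComplexProjectiveSpace n → Y}
    (h : ContinuousOn (fun Z => f (proj Z)) {0}ᶜ) : Continuous f := by
  rw [(isQuotientMap_mk' n).continuous_iff]
  rw [continuousOn_iff_continuous_domRestrict] at h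
  convert! h using 1
  ext Z
  exact congrArg f (proj_of_ne_zero Z.2).symm

instance : CompactSpace (ComplexProjectiveSpace n) := by
  refine ⟨?_⟩
  have h : (univ : Set (ComplexProjectiveSpace n)) = proj '' Metric.sphere 0 1 := by
    refine (eq_univ_of_forall fun x => ?_).symm
    have hx := x.rep_nonzero
    refine ⟨((‖x.rep‖⁻¹ : ℝ) : ℂ) • x.rep, ?_, ?_⟩
    · rw [mem_sphere_zero_iff_norm, norm_smul]
      simp [hx]
    · rw [proj_smul (by simpa using hx), proj_rep]
  rw [h]
  refine (isCompact_sphere _ _).image_of_continuousOn (continuousOn_proj.mono ?_)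
  rintro Z hZ rfl
  simp at hZ

theorem proj_mem_affineChart_source_iff {i : Fin (n + 1)} {Z : EuclideanSpace ℂ (Fin (n + 1))}
    (h : Z ≠ 0) : proj Z ∈ (affineChart i).source ↔ Z i ≠ 0 := by
  rw [proj_of_ne_zero h]
  exact rep_apply_ne_zero_iff i Z h

theorem affineChart_proj {i : Fin (n + 1)} {Z : EuclideanSpace ℂ (Fin (n + 1))} (h : Z ≠ 0) :
    affineChart i (proj Z) = dehomogenize i Z := by
  rw [proj_of_ne_zero h]
  exact dehomogenize_rep i Z h

theorem affineChart_symm_apply (i : Fin (n + 1)) (z : EuclideanSpace ℂ (Fin n)) :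
    (affineChart i).symm z = proj (insertCoord i 1 z) := by
  rw [proj_of_ne_zero (insertCoord_ne_zero i one_ne_zero z)]
  rfl

theorem insertCoord_one_dehomogenize {i : Fin (n + 1)} {Z : EuclideanSpace ℂ (Fin (n + 1))}
    (h : Z i ≠ 0) : insertCoord i 1 (dehomogenize i Z) = (Z i)⁻¹ • Z := by
  ext j
  rcases Fin.eq_self_or_eq_succAbove i j with rfl | ⟨k, rfl⟩
  · simp [h]
  · simp [dehomogenize, div_eq_inv_mul]

theorem affineChart_mem_maximalAtlas (i : Fin (n + 1)) :
    affineChart i ∈ IsManifold.maximalAtlas 𝓘(ℝ, EuclideanSpace ℂ (Fin n)) ∞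
      (ComplexProjectiveSpace n) :=
  IsManifold.subset_maximalAtlas (mem_range_self i)

theorem contMDiff_affineChart_symm (i : Fin (n + 1)) :
    ContMDiff 𝓘(ℝ, EuclideanSpace ℂ (Fin n)) 𝓘(ℝ, EuclideanSpace ℂ (Fin n)) ∞
      (affineChart i).symm := by
  rw [← contMDiffOn_univ]
  exact contMDiffOn_symm_of_mem_maximalAtlas (affineChart_mem_maximalAtlas i)

theorem contDiffAt_dehomogenize {i : Fin (n + 1)} {Z : EuclideanSpace ℂ (Fin (n + 1))}
    (h : Z i ≠ 0) : ContDiffAt ℝ ∞ (fun Z : EuclideanSpace ℂ (Fin (n + 1)) => dehomogenize i Z) Z :=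
  (contDiffOn_dehomogenize i).contDiffAt
    ((isOpen_ne_fun (by fun_prop) continuous_const).mem_nhds h)

theorem exists_apply_ne_zero {m : ℕ} {Z : EuclideanSpace ℂ (Fin m)} (h : Z ≠ 0) :
    ∃ i, Z i ≠ 0 := by
  by_contra! h'
  exact h (by ext i; exact h' i)

theorem contMDiffAt_proj {Z : EuclideanSpace ℂ (Fin (n + 1))} (h : Z ≠ 0) :
    ContMDiffAt 𝓘(ℝ, EuclideanSpace ℂ (Fin (n + 1))) 𝓘(ℝ, EuclideanSpace ℂ (Fin n)) ∞ proj Z := by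
  obtain ⟨i, hi⟩ := exists_apply_ne_zero h
  have h1 : ContMDiffAt 𝓘(ℝ, EuclideanSpace ℂ (Fin (n + 1))) 𝓘(ℝ, EuclideanSpace ℂ (Fin n)) ∞
      (fun Z => (affineChart i).symm (dehomogenize i Z)) Z :=
    (contMDiff_affineChart_symm i).contMDiffAt.comp Z (contDiffAt_dehomogenize hi).contMDiffAt
  refine h1.congr_of_eventuallyEq ?_
  have h2 : ∀ᶠ Y in 𝓝 Z, Y i ≠ 0 :=
    (isOpen_ne_fun (f := fun Y : EuclideanSpace ℂ (Fin (n + 1)) => Y i) (by fun_prop)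
      continuous_const).mem_nhds hi
  filter_upwards [h2] with Y hY
  rw [affineChart_symm_apply, insertCoord_one_dehomogenize hY, proj_smul (inv_ne_zero hY)]

/-- The Fubini–Study form is invariant under scaling, and vertical vectors are in its kernel. -/
theorem fubiniStudyForm_smul_add {a : ℂ} (ha : a ≠ 0) (b c : ℂ)
    {Z : EuclideanSpace ℂ (Fin (n + 1))} (V W : EuclideanSpace ℂ (Fin (n + 1))) :
    fubiniStudyForm (a • Z) (a • V + b • Z) (a • W + c • Z) = fubiniStudyForm Z V W := by
  have h1 : ⟪a • Z, a • Z⟫_ℂ * ⟪a • V + b • Z, a • W + c • Z⟫_ℂ -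
      ⟪a • V + b • Z, a • Z⟫_ℂ * ⟪a • Z, a • W + c • Z⟫_ℂ =
      ((‖a‖ ^ 4 : ℝ) : ℂ) * (⟪Z, Z⟫_ℂ * ⟪V, W⟫_ℂ - ⟪V, Z⟫_ℂ * ⟪Z, W⟫_ℂ) := by
    have : ((‖a‖ ^ 4 : ℝ) : ℂ) = (starRingEnd ℂ a * a) * (starRingEnd ℂ a * a) := by
      rw [Complex.conj_mul']
      push_cast
      ring
    rw [this]
    simp only [inner_add_left, inner_add_right, inner_smul_left, inner_smul_right]
    ring
  unfold fubiniStudyForm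
  rw [h1, Complex.re_ofReal_mul, norm_smul, mul_pow, mul_div_mul_left]
  exact pow_ne_zero 4 (norm_ne_zero_iff.2 ha)

theorem insertCoord_fderiv_dehomogenize {i : Fin (n + 1)} {Z : EuclideanSpace ℂ (Fin (n + 1))}
    (h : Z i ≠ 0) (V : EuclideanSpace ℂ (Fin (n + 1))) :
    insertCoord i 0 (fderiv ℝ (fun Z => dehomogenize i Z) Z V) =
      (Z i)⁻¹ • V + (-(V i / Z i ^ 2)) • Z := by
  have hd : ∀ k, HasFDerivAt (fun Z : EuclideanSpace ℂ (Fin (n + 1)) => Z k)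
      ((EuclideanSpace.proj k : EuclideanSpace ℂ (Fin (n + 1)) →L[ℂ] ℂ).restrictScalars ℝ) Z :=
    fun k => ((EuclideanSpace.proj k : EuclideanSpace ℂ (Fin (n + 1)) →L[ℂ] ℂ).restrictScalars
      ℝ).hasFDerivAt
  have hk : ∀ k, fderiv ℝ (fun Z => dehomogenize i Z) Z V k =
      (Z i)⁻¹ * V (i.succAbove k) + (-(V i / Z i ^ 2)) * Z (i.succAbove k) := by
    intro k
    have h1 := ((contDiffAt_dehomogenize h).differentiableAt (by simp)).hasFDerivAt
    have h2 := ((EuclideanSpace.proj k : EuclideanSpace ℂ (Fin n) →L[ℂ] ℂ).restrictScalars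
      ℝ).hasFDerivAt.comp Z h1
    have h3 := (hd (i.succAbove k)).mul ((hasFDerivAt_inv' (𝕜 := ℝ) h).comp Z (hd i))
    have h5 := (h3.congr_of_eventuallyEq (Filter.Eventually.of_forall fun Z => by
      simp [dehomogenize, div_eq_mul_inv])).unique h2
    have h6 := DFunLike.congr_fun h5 V
    simp only [_root_.add_apply, _root_.smul_apply, ContinuousLinearMap.comp_apply,
      _root_.neg_apply,
      ContinuousLinearMap.mulLeftRight_apply, ContinuousLinearMap.coe_restrictScalars',
      PiLp.proj_apply, smul_eq_mul, Function.comp_apply] at h6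
    rw [← h6]
    field_simp
    ring
  ext j
  rcases Fin.eq_self_or_eq_succAbove i j with rfl | ⟨k, rfl⟩
  · simp
    field_simp
    ring
  · rw [insertCoord_succAbove, hk]
    simp

/-- The derivative of `Z ↦ [Z]` pulls the Fubini–Study metric back to the Fubini–Study form. -/
theorem inner_mfderiv_proj {Z : EuclideanSpace ℂ (Fin (n + 1))} (h : Z ≠ 0)
    (V W : EuclideanSpace ℂ (Fin (n + 1))) :
    ⟪mfderiv 𝓘(ℝ, EuclideanSpace ℂ (Fin (n + 1))) 𝓘(ℝ, EuclideanSpace ℂ (Fin n)) proj Z V,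
      mfderiv 𝓘(ℝ, EuclideanSpace ℂ (Fin (n + 1))) 𝓘(ℝ, EuclideanSpace ℂ (Fin n)) proj Z W⟫_ℝ =
      fubiniStudyForm Z V W := by
  set j := chartIndex (proj Z) with hj
  have hZj : Z j ≠ 0 := (proj_mem_affineChart_source_iff h).1 (chartIndex_spec (proj Z))
  have h1 : HasMFDerivAt 𝓘(ℝ, EuclideanSpace ℂ (Fin (n + 1))) 𝓘(ℝ, EuclideanSpace ℂ (Fin n))
      proj Z (fderiv ℝ (fun Z => dehomogenize j Z) Z) := by
    refine ⟨(contMDiffAt_proj h).continuousAt, HasFDerivAt.hasFDerivWithinAt ?_⟩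
    refine ((contDiffAt_dehomogenize hZj).differentiableAt
      (by simp)).hasFDerivAt.congr_of_eventuallyEq ?_
    filter_upwards [isOpen_compl_singleton.mem_nhds h] with Y hY
    simp only [writtenInExtChartAt, mfld_simps, Function.comp]
    exact affineChart_proj hY
  -- `T` is a variable so that `mfderiv`, whose target is a tangent space, can be substituted for it
  have h2 : ∀ T : EuclideanSpace ℂ (Fin (n + 1)) →L[ℝ] EuclideanSpace ℂ (Fin n),
      T = fderiv ℝ (fun Z => dehomogenize j Z) Z →
      chartForm j (affineChart j (proj Z)) (T V) (T W) = fubiniStudyForm Z V W := by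
    rintro T rfl
    rw [affineChart_proj h]
    unfold chartForm
    rw [insertCoord_one_dehomogenize hZj, insertCoord_fderiv_dehomogenize hZj,
      insertCoord_fderiv_dehomogenize hZj, fubiniStudyForm_smul_add (inv_ne_zero hZj)]
  exact h2 _ h1.mfderiv

/-! ### The function `cos² r` -/

/-- The function `|⟨P, Z⟩|² / (|P|² |Z|²)`, which is `cos²` of the distance of `[P]` and `[Z]`. -/
def cosSq {m : ℕ} (P Z : EuclideanSpace ℂ (Fin m)) : ℝ :=
  ‖⟪P, Z⟫_ℂ‖ ^ 2 / (‖P‖ ^ 2 * ‖Z‖ ^ 2)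

theorem cosSq_comm {m : ℕ} (P Z : EuclideanSpace ℂ (Fin m)) : cosSq P Z = cosSq Z P := by
  unfold cosSq
  rw [norm_inner_symm, mul_comm]

theorem cosSq_smul_right {m : ℕ} {a : ℂ} (ha : a ≠ 0) (P Z : EuclideanSpace ℂ (Fin m)) :
    cosSq P (a • Z) = cosSq P Z := by
  unfold cosSq
  rw [inner_smul_right, norm_mul, norm_smul, mul_pow, mul_pow, mul_left_comm, mul_div_mul_left]
  exact pow_ne_zero 2 (norm_ne_zero_iff.2 ha)

theorem cosSq_smul_left {m : ℕ} {a : ℂ} (ha : a ≠ 0) (P Z : EuclideanSpace ℂ (Fin m)) :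
    cosSq (a • P) Z = cosSq P Z := by
  rw [cosSq_comm, cosSq_smul_right ha, cosSq_comm]

theorem cosSq_nonneg {m : ℕ} (P Z : EuclideanSpace ℂ (Fin m)) : 0 ≤ cosSq P Z := by
  unfold cosSq
  positivity

theorem cosSq_le_one {m : ℕ} (P Z : EuclideanSpace ℂ (Fin m)) : cosSq P Z ≤ 1 := by
  unfold cosSq
  refine div_le_one_of_le₀ ?_ (by positivity)
  rw [← mul_pow]
  gcongr
  exact norm_inner_le_norm _ _

theorem cosSq_self {m : ℕ} {P : EuclideanSpace ℂ (Fin m)} (h : P ≠ 0) : cosSq P P = 1 := by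
  unfold cosSq
  have : ‖P‖ ≠ 0 := norm_ne_zero_iff.2 h
  rw [inner_self_eq_norm_sq_to_K]
  simp
  field_simp

theorem cosSq_rep (P Z : EuclideanSpace ℂ (Fin (n + 1))) (hP : P ≠ 0) (hZ : Z ≠ 0) :
    cosSq (proj P).rep (proj Z).rep = cosSq P Z := by
  rw [proj_of_ne_zero hP, proj_of_ne_zero hZ]
  obtain ⟨a, ha⟩ := Projectivization.exists_smul_eq_mk_rep ℂ Z hZ
  obtain ⟨b, hb⟩ := Projectivization.exists_smul_eq_mk_rep ℂ P hP
  rw [← ha, ← hb, Units.smul_def, Units.smul_def, cosSq_smul_right a.ne_zero,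
    cosSq_smul_left b.ne_zero]

/-- Equality case of the Cauchy–Schwarz inequality. -/
theorem cosSq_eq_one_iff {P Z : EuclideanSpace ℂ (Fin (n + 1))} (hP : P ≠ 0) (hZ : Z ≠ 0) :
    cosSq P Z = 1 ↔ proj P = proj Z := by
  constructor
  · intro h
    unfold cosSq at h
    have h1 : ‖⟪P, Z⟫_ℂ‖ ^ 2 = (‖P‖ * ‖Z‖) ^ 2 := by
      have : ‖P‖ ^ 2 * ‖Z‖ ^ 2 ≠ 0 := by positivity
      rw [div_eq_one_iff_eq this] at h
      rw [h, mul_pow]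
    have h2 : ‖⟪P, Z⟫_ℂ‖ = ‖P‖ * ‖Z‖ := by
      rwa [pow_left_inj₀ (by positivity) (by positivity) two_ne_zero] at h1
    have h3 : P = 0 ∨ ∃ r : ℂ, Z = r • P := ((norm_inner_eq_norm_tfae ℂ P Z).out 0 2).1 h2
    obtain ⟨r, rfl⟩ := h3.resolve_left hP
    rw [proj_smul]
    rintro rfl
    simp at hZ
  · intro h
    rw [← cosSq_rep P Z hP hZ, h, cosSq_self (Projectivization.rep_nonzero _)]

theorem contDiffAt_cosSq {m : ℕ} {P Z : EuclideanSpace ℂ (Fin m)} (hP : P ≠ 0) (hZ : Z ≠ 0) :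
    ContDiffAt ℝ ∞ (fun x : EuclideanSpace ℂ (Fin m) × EuclideanSpace ℂ (Fin m) => cosSq x.1 x.2)
      (P, Z) := by
  unfold cosSq
  have h1 : ContDiff ℝ ∞ (fun x : EuclideanSpace ℂ (Fin m) × EuclideanSpace ℂ (Fin m) =>
      ⟪x.1, x.2⟫_ℂ) := contDiff_fst.inner ℂ contDiff_snd
  refine ContDiffAt.div ?_ ?_ ?_
  · exact (h1.norm_sq ℝ).contDiffAt
  · exact ((contDiff_fst.norm_sq ℂ).mul (contDiff_snd.norm_sq ℂ)).contDiffAt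
  · positivity

theorem hasFDerivAt_norm_inner_sq {m : ℕ} (P Z : EuclideanSpace ℂ (Fin m)) :
    HasFDerivAt (fun Z => ‖⟪P, Z⟫_ℂ‖ ^ 2)
      (2 • (innerSL ℝ ⟪P, Z⟫_ℂ).comp ((innerSL ℂ P).restrictScalars ℝ)) Z :=
  ((innerSL ℂ P).restrictScalars ℝ).hasFDerivAt.norm_sq

theorem fderiv_cosSq {m : ℕ} (P : EuclideanSpace ℂ (Fin m)) {Z : EuclideanSpace ℂ (Fin m)}
    (hP : P ≠ 0) (hZ : Z ≠ 0) (V : EuclideanSpace ℂ (Fin m)) :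
    fderiv ℝ (cosSq P) Z V =
      2 * (starRingEnd ℂ ⟪P, Z⟫_ℂ * (⟪Z, Z⟫_ℂ * ⟪P, V⟫_ℂ - ⟪P, Z⟫_ℂ * ⟪Z, V⟫_ℂ)).re /
        (‖P‖ ^ 2 * ‖Z‖ ^ 4) := by
  have h1 := hasFDerivAt_norm_inner_sq P Z
  have h2 : HasFDerivAt (fun Z : EuclideanSpace ℂ (Fin m) => ‖P‖ ^ 2 * ‖Z‖ ^ 2)
      (‖P‖ ^ 2 • (2 • innerSL ℝ Z)) Z :=
    ((hasStrictFDerivAt_norm_sq Z).hasFDerivAt).const_mul _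
  have hP' : ‖P‖ ≠ 0 := norm_ne_zero_iff.2 hP
  have hZ' : ‖Z‖ ≠ 0 := norm_ne_zero_iff.2 hZ
  have h3 := h1.mul ((hasDerivAt_inv (by positivity : ‖P‖ ^ 2 * ‖Z‖ ^ 2 ≠ 0)).comp_hasFDerivAt Z h2)
  have h4 : HasFDerivAt (cosSq P) _ Z := h3
  rw [h4.fderiv]
  have h5 : ⟪Z, Z⟫_ℂ = ((‖Z‖ ^ 2 : ℝ) : ℂ) := by
    rw [inner_self_eq_norm_sq_to_K]
    simp
  have h6 : starRingEnd ℂ ⟪P, Z⟫_ℂ * (⟪Z, Z⟫_ℂ * ⟪P, V⟫_ℂ - ⟪P, Z⟫_ℂ * ⟪Z, V⟫_ℂ) =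
      ((‖Z‖ ^ 2 : ℝ) : ℂ) * (⟪P, V⟫_ℂ * starRingEnd ℂ ⟪P, Z⟫_ℂ) -
      ((‖⟪P, Z⟫_ℂ‖ ^ 2 : ℝ) : ℂ) * ⟪Z, V⟫_ℂ := by
    have : ((‖⟪P, Z⟫_ℂ‖ ^ 2 : ℝ) : ℂ) = starRingEnd ℂ ⟪P, Z⟫_ℂ * ⟪P, Z⟫_ℂ := by
      rw [Complex.conj_mul']
      push_cast
      ring
    rw [h5, this]
    ring
  rw [h6, Complex.sub_re, Complex.re_ofReal_mul, Complex.re_ofReal_mul, ← real_inner_eq_re,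
    ← Complex.inner]
  simp only [_root_.smul_apply, _root_.add_apply, ContinuousLinearMap.comp_apply,
    innerSL_apply_apply,
    ContinuousLinearMap.coe_restrictScalars', smul_eq_mul, nsmul_eq_mul, Nat.cast_ofNat,
    Function.comp_apply]
  field_simp
  ring

/-- The pointwise estimate behind the lower bound for lengths of paths: the derivative of `cos² r`
is at most `2 cos r sin r` times the Fubini–Study norm. -/
theorem fderiv_cosSq_sq_le {P Z : EuclideanSpace ℂ (Fin (n + 1))} (hP : P ≠ 0) (hZ : Z ≠ 0)
    (V : EuclideanSpace ℂ (Fin (n + 1))) :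
    (fderiv ℝ (cosSq P) Z V) ^ 2 ≤ 4 * (cosSq P Z * (1 - cosSq P Z)) * fubiniStudyForm Z V V := by
  have hP' : ‖P‖ ≠ 0 := norm_ne_zero_iff.2 hP
  have hZ' : ‖Z‖ ≠ 0 := norm_ne_zero_iff.2 hZ
  -- the components of `P` and `V` orthogonal to `Z`, multiplied by `|Z|²`
  have key : ∀ X Y : EuclideanSpace ℂ (Fin (n + 1)),
      ⟪⟪Z, Z⟫_ℂ • X - ⟪Z, X⟫_ℂ • Z, ⟪Z, Z⟫_ℂ • Y - ⟪Z, Y⟫_ℂ • Z⟫_ℂ =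
      ⟪Z, Z⟫_ℂ * (⟪Z, Z⟫_ℂ * ⟪X, Y⟫_ℂ - ⟪X, Z⟫_ℂ * ⟪Z, Y⟫_ℂ) := by
    intro X Y
    simp only [inner_sub_left, inner_sub_right, inner_smul_left, inner_smul_right, inner_conj_symm]
    ring
  have h5 : ⟪Z, Z⟫_ℂ = ((‖Z‖ ^ 2 : ℝ) : ℂ) := by
    rw [inner_self_eq_norm_sq_to_K]
    simp
  have nrm : ∀ X : EuclideanSpace ℂ (Fin (n + 1)),
      ‖⟪Z, Z⟫_ℂ • X - ⟪Z, X⟫_ℂ • Z‖ ^ 2 =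
        ‖Z‖ ^ 2 * (⟪Z, Z⟫_ℂ * ⟪X, X⟫_ℂ - ⟪X, Z⟫_ℂ * ⟪Z, X⟫_ℂ).re := by
    intro X
    have := congrArg Complex.re (key X X)
    rw [h5, Complex.re_ofReal_mul, ← h5] at this
    rw [← this, ← real_inner_eq_re, real_inner_self_eq_norm_sq]
  set P' := ⟪Z, Z⟫_ℂ • P - ⟪Z, P⟫_ℂ • Z with hPdef
  set V' := ⟪Z, Z⟫_ℂ • V - ⟪Z, V⟫_ℂ • Z with hVdef
  have h1 : fderiv ℝ (cosSq P) Z V =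
      2 * (starRingEnd ℂ ⟪P, Z⟫_ℂ * ⟪P', V'⟫_ℂ).re / (‖P‖ ^ 2 * ‖Z‖ ^ 6) := by
    rw [fderiv_cosSq P hP hZ, key P V, mul_left_comm (starRingEnd ℂ _) ⟪Z, Z⟫_ℂ]
    have : ∀ x : ℂ, (⟪Z, Z⟫_ℂ * x).re = ‖Z‖ ^ 2 * x.re := fun x => by
      rw [h5, Complex.re_ofReal_mul]
    rw [this]
    field_simp
  have h2 : |(starRingEnd ℂ ⟪P, Z⟫_ℂ * ⟪P', V'⟫_ℂ).re| ≤ ‖⟪P, Z⟫_ℂ‖ * (‖P'‖ * ‖V'‖) := by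
    refine (Complex.abs_re_le_norm _).trans ?_
    rw [norm_mul, RCLike.norm_conj]
    gcongr
    exact norm_inner_le_norm _ _
  have h3 : ‖P'‖ ^ 2 = ‖Z‖ ^ 2 * (‖Z‖ ^ 2 * ‖P‖ ^ 2 - ‖⟪P, Z⟫_ℂ‖ ^ 2) := by
    rw [hPdef, nrm P]
    congr 1
    rw [← inner_conj_symm Z P, Complex.mul_conj, h5, inner_self_eq_norm_sq_to_K,
      Complex.normSq_eq_norm_sq]
    simp [← Complex.ofReal_pow]
  have h4 : ‖V'‖ ^ 2 = ‖Z‖ ^ 6 * fubiniStudyForm Z V V := by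
    rw [hVdef, nrm V, fubiniStudyForm]
    field_simp
  have h6 : 2 * |(starRingEnd ℂ ⟪P, Z⟫_ℂ * ⟪P', V'⟫_ℂ).re| / (‖P‖ ^ 2 * ‖Z‖ ^ 6) ≤
      2 * (‖⟪P, Z⟫_ℂ‖ * (‖P'‖ * ‖V'‖)) / (‖P‖ ^ 2 * ‖Z‖ ^ 6) := by gcongr
  calc (fderiv ℝ (cosSq P) Z V) ^ 2
      = (2 * |(starRingEnd ℂ ⟪P, Z⟫_ℂ * ⟪P', V'⟫_ℂ).re| / (‖P‖ ^ 2 * ‖Z‖ ^ 6)) ^ 2 := by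
        rw [h1, div_pow, div_pow, mul_pow, mul_pow 2 |_|, sq_abs]
    _ ≤ (2 * (‖⟪P, Z⟫_ℂ‖ * (‖P'‖ * ‖V'‖)) / (‖P‖ ^ 2 * ‖Z‖ ^ 6)) ^ 2 := by gcongr
    _ = 4 * (‖⟪P, Z⟫_ℂ‖ ^ 2 * (‖P'‖ ^ 2 * ‖V'‖ ^ 2)) / (‖P‖ ^ 4 * ‖Z‖ ^ 12) := by ring
    _ = _ := by
        rw [h3, h4, cosSq]
        field_simp

/-- The local section of the projection that puts `1` in position `i` is smooth. -/
theorem contMDiffOn_section (i : Fin (n + 1)) :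
    ContMDiffOn 𝓘(ℝ, EuclideanSpace ℂ (Fin n)) 𝓘(ℝ, EuclideanSpace ℂ (Fin (n + 1))) ∞
      (fun x => insertCoord i 1 (affineChart i x)) (affineChart i).source :=
  (contDiff_insertCoord i 1).contMDiff.comp_contMDiffOn
    (contMDiffOn_of_mem_maximalAtlas (affineChart_mem_maximalAtlas i))

theorem proj_section {i : Fin (n + 1)} {x : ComplexProjectiveSpace n}
    (hx : x ∈ (affineChart i).source) : proj (insertCoord i 1 (affineChart i x)) = x := by
  rw [← affineChart_symm_apply, (affineChart i).left_inv hx]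

theorem exists_contMDiffAt_section (x : ComplexProjectiveSpace n) :
    ∃ σ : ComplexProjectiveSpace n → EuclideanSpace ℂ (Fin (n + 1)),
      ContMDiffAt 𝓘(ℝ, EuclideanSpace ℂ (Fin n)) 𝓘(ℝ, EuclideanSpace ℂ (Fin (n + 1))) ∞ σ x ∧
      (∀ y, σ y ≠ 0) ∧ ∀ᶠ y in 𝓝 x, proj (σ y) = y := by
  have h : (affineChart (chartIndex x)).source ∈ 𝓝 x :=
    (affineChart (chartIndex x)).open_source.mem_nhds (chartIndex_spec x)
  exact ⟨_, (contMDiffOn_section (chartIndex x)).contMDiffAt h,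
    fun y => insertCoord_ne_zero _ one_ne_zero _, Filter.mem_of_superset h fun y => proj_section⟩

/-- Although `rep` is an arbitrary choice of representatives, `cosSq` of representatives is smooth,
since it can be computed from smooth local sections. -/
theorem contMDiff_cosSq : ContMDiff (𝓘(ℝ, EuclideanSpace ℂ (Fin n)).prod
    𝓘(ℝ, EuclideanSpace ℂ (Fin n))) 𝓘(ℝ, ℝ) ∞
    (fun x : ComplexProjectiveSpace n × ComplexProjectiveSpace n => cosSq x.1.rep x.2.rep) := by
  rintro ⟨p, q⟩
  obtain ⟨σ, hσ, hσ0, hσ1⟩ := exists_contMDiffAt_section p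
  obtain ⟨τ, hτ, hτ0, hτ1⟩ := exists_contMDiffAt_section q
  have h1 : ContMDiffAt (𝓘(ℝ, EuclideanSpace ℂ (Fin n)).prod 𝓘(ℝ, EuclideanSpace ℂ (Fin n)))
      𝓘(ℝ, EuclideanSpace ℂ (Fin (n + 1))) ∞
      (fun x : ComplexProjectiveSpace n × ComplexProjectiveSpace n => σ x.1) (p, q) :=
    ContMDiffAt.comp (p, q) hσ contMDiffAt_fst
  have h1' : ContMDiffAt (𝓘(ℝ, EuclideanSpace ℂ (Fin n)).prod 𝓘(ℝ, EuclideanSpace ℂ (Fin n)))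
      𝓘(ℝ, EuclideanSpace ℂ (Fin (n + 1))) ∞
      (fun x : ComplexProjectiveSpace n × ComplexProjectiveSpace n => τ x.2) (p, q) :=
    ContMDiffAt.comp (p, q) hτ contMDiffAt_snd
  have h2 : ContMDiffAt (𝓘(ℝ, EuclideanSpace ℂ (Fin n)).prod 𝓘(ℝ, EuclideanSpace ℂ (Fin n)))
      𝓘(ℝ, ℝ) ∞
      (fun x : ComplexProjectiveSpace n × ComplexProjectiveSpace n => cosSq (σ x.1) (τ x.2))
      (p, q) :=
    (contDiffAt_cosSq (hσ0 p) (hτ0 q)).contMDiffAt.comp (p, q) (h1.prodMk_space h1')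
  refine h2.congr_of_eventuallyEq ?_
  filter_upwards [continuous_fst.continuousAt.eventually hσ1,
    continuous_snd.continuousAt.eventually hτ1] with x hx1 hx2
  rw [← cosSq_rep _ _ (hσ0 _) (hτ0 _), hx1, hx2]

theorem continuous_cosSq (p : ComplexProjectiveSpace n) :
    Continuous fun q : ComplexProjectiveSpace n => cosSq p.rep q.rep :=
  continuous_of_comp_proj fun Z hZ =>
    ((contDiffAt_cosSq p.rep_nonzero hZ).continuousAt.comp (f := fun Z => (p.rep, Z))
      (by fun_prop)).continuousWithinAt.congr_of_eventuallyEq (by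
        filter_upwards [self_mem_nhdsWithin] with Y hY
        have := cosSq_rep p.rep Y p.rep_nonzero hY
        rwa [proj_rep] at this) (by
        have := cosSq_rep p.rep Z p.rep_nonzero hZ
        rwa [proj_rep] at this)

/-- The half-angle formula `cos (2 r) = 2 cos² r - 1`. -/
theorem arccos_sqrt {c : ℝ} (h0 : 0 ≤ c) (h1 : c ≤ 1) :
    Real.arccos √c = Real.arccos (2 * c - 1) / 2 := by
  have h2 : √c ≤ 1 := Real.sqrt_le_one.2 h1
  have h3 := Real.cos_arccos (by linarith [Real.sqrt_nonneg c]) h2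
  have h4 : 2 * c - 1 = Real.cos (2 * Real.arccos √c) := by
    rw [Real.cos_two_mul, h3, Real.sq_sqrt h0]
  rw [h4, Real.arccos_cos]
  · ring
  · have := Real.arccos_nonneg √c
    linarith
  · have := Real.arccos_le_pi_div_two.2 (Real.sqrt_nonneg c)
    linarith

/-! ### The geodesic distance -/

theorem norm_sq_mfderiv_proj {Z : EuclideanSpace ℂ (Fin (n + 1))} (h : Z ≠ 0)
    (V : EuclideanSpace ℂ (Fin (n + 1))) :
    ‖mfderiv 𝓘(ℝ, EuclideanSpace ℂ (Fin (n + 1))) 𝓘(ℝ, EuclideanSpace ℂ (Fin n)) proj Z V‖ ^ 2 =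
      fubiniStudyForm Z V V := by
  rw [← inner_mfderiv_proj h]
  exact (real_inner_self_eq_norm_sq _).symm

/-- The speed of a path `t ↦ [Z t]` is computed by the Fubini–Study form. -/
theorem norm_sq_mfderiv_of_lift {γ : ℝ → ComplexProjectiveSpace n}
    {Z : ℝ → EuclideanSpace ℂ (Fin (n + 1))} {Z' : EuclideanSpace ℂ (Fin (n + 1))} {t : ℝ}
    (hZ : HasDerivAt Z Z' t) (h0 : Z t ≠ 0) (hγ : ∀ᶠ s in 𝓝 t, γ s = proj (Z s)) :
    ‖mfderiv 𝓘(ℝ, ℝ) 𝓘(ℝ, EuclideanSpace ℂ (Fin n)) γ t 1‖ ^ 2 =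
      fubiniStudyForm (Z t) Z' Z' := by
  have h1 : HasMFDerivAt 𝓘(ℝ, ℝ) 𝓘(ℝ, EuclideanSpace ℂ (Fin (n + 1))) Z t
      (ContinuousLinearMap.toSpanSingleton ℝ Z') := hZ.hasFDerivAt.hasMFDerivAt
  have h2 := ((contMDiffAt_proj h0).mdifferentiableAt (by simp)).hasMFDerivAt.comp t h1
  have h3 := h2.congr_of_eventuallyEq hγ
  have h4 : γ t = proj (Z t) := hγ.self_of_nhds
  rw [← norm_sq_mfderiv_proj h0]
  -- transport of norms along an equality of base points
  have h5 : ∀ (x y : ComplexProjectiveSpace n) (_ : x = y)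
      (v w : EuclideanSpace ℂ (Fin n)), v = w →
      ‖(show TangentSpace 𝓘(ℝ, EuclideanSpace ℂ (Fin n)) x from v)‖ ^ 2 =
      ‖(show TangentSpace 𝓘(ℝ, EuclideanSpace ℂ (Fin n)) y from w)‖ ^ 2 := by
    rintro x _ rfl v _ rfl
    rfl
  refine h5 _ _ h4 _ _ ?_
  have h6 : ∀ T S : ℝ →L[ℝ] EuclideanSpace ℂ (Fin n), T = S → T 1 = S 1 := by
    rintro T _ rfl
    rfl
  refine (h6 _ _ h3.mfderiv).trans ?_
  change (mfderiv 𝓘(ℝ, EuclideanSpace ℂ (Fin (n + 1))) 𝓘(ℝ, EuclideanSpace ℂ (Fin n)) proj (Z t))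
    ((1 : ℝ) • Z') = _
  rw [one_smul]

/-- A `C^1` path in `ℂP^n` lifts locally to a `C^1` path in `ℂ^(n+1) ∖ {0}`. -/
theorem exists_lift {γ : ℝ → ComplexProjectiveSpace n} {t : ℝ}
    (hγ : ContMDiffAt 𝓘(ℝ, ℝ) 𝓘(ℝ, EuclideanSpace ℂ (Fin n)) 1 γ t) :
    ∃ Z : ℝ → EuclideanSpace ℂ (Fin (n + 1)), ContDiffAt ℝ 1 Z t ∧ (∀ s, Z s ≠ 0) ∧
      ∀ᶠ s in 𝓝 t, γ s = proj (Z s) := by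
  obtain ⟨σ, hσ, hσ0, hσ1⟩ := exists_contMDiffAt_section (γ t)
  refine ⟨fun s => σ (γ s), ?_, fun s => hσ0 _, ?_⟩
  · rw [← contMDiffAt_iff_contDiffAt]
    exact (hσ.of_le (by simp)).comp t hγ
  · filter_upwards [hγ.continuousAt.eventually hσ1] with s hs using hs.symm

/-- Along a `C^1` path, `cos² r` is `C^1` and its derivative is at most `2 cos r sin r` times the
speed. -/
theorem cosSq_along_path {γ : ℝ → ComplexProjectiveSpace n} {t : ℝ}
    (hγ : ContMDiffAt 𝓘(ℝ, ℝ) 𝓘(ℝ, EuclideanSpace ℂ (Fin n)) 1 γ t)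
    (p : ComplexProjectiveSpace n) :
    ContDiffAt ℝ 1 (fun s => cosSq p.rep (γ s).rep) t ∧
    (deriv (fun s => cosSq p.rep (γ s).rep) t) ^ 2 ≤
      4 * (cosSq p.rep (γ t).rep * (1 - cosSq p.rep (γ t).rep)) *
        ‖mfderiv 𝓘(ℝ, ℝ) 𝓘(ℝ, EuclideanSpace ℂ (Fin n)) γ t 1‖ ^ 2 := by
  obtain ⟨Z, hZ, hZ0, hZ1⟩ := exists_lift hγ
  have h1 : (fun s => cosSq p.rep (γ s).rep) =ᶠ[𝓝 t] fun s => cosSq p.rep (Z s) := by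
    filter_upwards [hZ1] with s hs
    have := cosSq_rep p.rep (Z s) p.rep_nonzero (hZ0 s)
    rwa [proj_rep, ← hs] at this
  have h2 : ContDiffAt ℝ ∞ (cosSq p.rep) (Z t) :=
    (contDiffAt_cosSq p.rep_nonzero (hZ0 t)).comp (Z t)
      (contDiffAt_const.prodMk contDiffAt_id)
  have h3 := (hZ.differentiableAt (by simp)).hasDerivAt
  refine ⟨((h2.of_le (by simp)).comp t hZ).congr_of_eventuallyEq h1, ?_⟩
  have h4 : HasDerivAt (fun s => cosSq p.rep (Z s)) _ t :=
    ((h2.differentiableAt (by simp)).hasFDerivAt).comp_hasDerivAt t h3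
  have h5 : cosSq p.rep (γ t).rep = cosSq p.rep (Z t) := h1.self_of_nhds
  rw [h1.deriv_eq, h4.deriv, norm_sq_mfderiv_of_lift h3 (hZ0 t) hZ1, h5]
  exact fderiv_cosSq_sq_le p.rep_nonzero (hZ0 t) _

/-- The estimate for the derivative of `arccos (l (2 u - 1)) / 2`, where `u` is `cos² r` along a path
of speed `g`. -/
theorem abs_deriv_arccos_le {l u u' g : ℝ} (hl0 : 0 ≤ l) (hl : l < 1) (hu0 : 0 ≤ u) (hu1 : u ≤ 1)
    (hg : 0 ≤ g) (h : u' ^ 2 ≤ 4 * (u * (1 - u)) * g ^ 2) :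
    |-(1 / √(1 - (l * (2 * u - 1)) ^ 2)) * (l * (2 * u')) / 2| ≤ g := by
  have h1 : 0 < 1 - (l * (2 * u - 1)) ^ 2 := by
    have : (l * (2 * u - 1)) ^ 2 ≤ l ^ 2 := by
      rw [mul_pow]
      exact mul_le_of_le_one_right (sq_nonneg _) (by nlinarith)
    nlinarith
  have h2 : l ^ 2 * u' ^ 2 ≤ (1 - (l * (2 * u - 1)) ^ 2) * g ^ 2 := by
    calc l ^ 2 * u' ^ 2 ≤ l ^ 2 * (4 * (u * (1 - u)) * g ^ 2) := by gcongr
      _ = l ^ 2 * (4 * (u * (1 - u))) * g ^ 2 := by ring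
      _ ≤ _ := by
        gcongr
        nlinarith
  rw [show -(1 / √(1 - (l * (2 * u - 1)) ^ 2)) * (l * (2 * u')) / 2 =
    -((l * u') / √(1 - (l * (2 * u - 1)) ^ 2)) by ring, abs_neg, abs_div,
    abs_of_pos (Real.sqrt_pos.2 h1), div_le_iff₀ (Real.sqrt_pos.2 h1)]
  refine abs_le_of_sq_le_sq ?_ (by positivity)
  rw [mul_pow, mul_pow, Real.sq_sqrt h1.le]
  linarith

/-- A `C^1` path from `p` to `q` is at least as long as `r = arccos √(cosSq p.rep q.rep)`. As
`arccos` is not differentiable at `±1`, the estimate is made for `arccos (l * cos (2 r)) / 2` with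
`l < 1`, and `l` tends to `1`. -/
theorem le_riemannianEDist (p q : ComplexProjectiveSpace n) :
    ENNReal.ofReal (Real.arccos √(cosSq p.rep q.rep)) ≤
      Manifold.riemannianEDist 𝓘(ℝ, EuclideanSpace ℂ (Fin n)) p q := by
  refine le_of_forall_gt fun r hr => ?_
  obtain ⟨γ, γ0, γ1, hγ, hlen, -, -⟩ :=
    Manifold.exists_lt_locally_constant_of_riemannianEDist_lt hr (zero_lt_one (α := ℝ))
  refine lt_of_le_of_lt ?_ hlen
  set u : ℝ → ℝ := fun s => cosSq p.rep (γ s).rep with hu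
  have hu1 : ContDiff ℝ 1 u := contDiff_iff_contDiffAt.2 fun t => (cosSq_along_path (hγ t) p).1
  have hlow : ∀ l ∈ Ico (0 : ℝ) 1, ENNReal.ofReal
      (Real.arccos (l * (2 * cosSq p.rep q.rep - 1)) / 2 - Real.arccos (l * 1) / 2) ≤
      Manifold.pathELength 𝓘(ℝ, EuclideanSpace ℂ (Fin n)) γ 0 1 := by
    rintro l ⟨hl0, hl1⟩
    have hb : ∀ t, -1 < l * (2 * u t - 1) ∧ l * (2 * u t - 1) < 1 := by
      intro t
      have h0 := cosSq_nonneg p.rep (γ t).rep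
      have h1 := cosSq_le_one p.rep (γ t).rep
      constructor <;> simp only [hu] <;> nlinarith
    have hd : ∀ t, HasDerivAt (fun t => Real.arccos (l * (2 * u t - 1)) / 2)
        (-(1 / √(1 - (l * (2 * u t - 1)) ^ 2)) * (l * (2 * deriv u t)) / 2) t := by
      intro t
      have h1 : HasDerivAt (fun t => l * (2 * u t - 1)) (l * (2 * deriv u t)) t :=
        (((hu1.differentiable (by simp) t).hasDerivAt.const_mul 2).sub_const 1).const_mul l
      exact ((Real.hasDerivAt_arccos (hb t).1.ne' (hb t).2.ne).comp t h1).div_const 2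
    have hc : Continuous fun t =>
        -(1 / √(1 - (l * (2 * u t - 1)) ^ 2)) * (l * (2 * deriv u t)) / 2 := by
      have h1 := hu1.continuous
      have h2 := hu1.continuous_deriv (by simp)
      have h3 : ∀ t, √(1 - (l * (2 * u t - 1)) ^ 2) ≠ 0 := fun t => by
        have := hb t
        exact (Real.sqrt_pos.2 (by nlinarith)).ne'
      fun_prop (disch := exact h3 _)
    have hftc := intervalIntegral.integral_eq_sub_of_hasDerivAt (a := 0) (b := 1)
      (fun t _ => hd t) (hc.intervalIntegrable 0 1)
    have hu0' : u 0 = 1 := by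
      simp only [hu, γ0]
      exact cosSq_self p.rep_nonzero
    have hu1' : u 1 = cosSq p.rep q.rep := by simp only [hu, γ1]
    simp only [hu0', hu1'] at hftc
    rw [show (2 * 1 - 1 : ℝ) = 1 by norm_num] at hftc
    rw [← hftc, intervalIntegral.integral_of_le zero_le_one]
    refine (ENNReal.ofReal_le_ofReal (le_abs_self _)).trans ?_
    rw [← Real.enorm_eq_ofReal_abs]
    refine (enorm_integral_le_lintegral_enorm _).trans ?_
    rw [Manifold.pathELength_eq_lintegral_mfderiv_Icc, ← restrict_Ioc_eq_restrict_Icc]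
    refine lintegral_mono fun t => ?_
    rw [Real.enorm_eq_ofReal_abs, ← ofReal_norm]
    exact ENNReal.ofReal_le_ofReal (abs_deriv_arccos_le hl0 hl1 (cosSq_nonneg _ _)
      (cosSq_le_one _ _) (norm_nonneg _) (cosSq_along_path (hγ t) p).2)
  have hlim : Filter.Tendsto (fun l : ℝ => ENNReal.ofReal
      (Real.arccos (l * (2 * cosSq p.rep q.rep - 1)) / 2 - Real.arccos (l * 1) / 2)) (𝓝[<] 1)
      (𝓝 (ENNReal.ofReal (Real.arccos √(cosSq p.rep q.rep)))) := by
    have h1 : Continuous (fun l : ℝ => ENNReal.ofReal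
        (Real.arccos (l * (2 * cosSq p.rep q.rep - 1)) / 2 - Real.arccos (l * 1) / 2)) := by
      have := Real.continuous_arccos
      exact ENNReal.continuous_ofReal.comp (by fun_prop)
    have h2 := (h1.tendsto 1).mono_left (nhdsWithin_le_nhds (s := Iio (1 : ℝ)))
    simpa [arccos_sqrt (cosSq_nonneg p.rep q.rep) (cosSq_le_one _ _)] using h2
  refine le_of_tendsto hlim ?_
  filter_upwards [Ico_mem_nhdsLT (zero_lt_one (α := ℝ))] with l hl using hlow l hl

/-- Points joined by the projection of a great circle arc of length `θ` have distance at most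
`θ`. -/
theorem riemannianEDist_proj_le {u e : EuclideanSpace ℂ (Fin (n + 1))} (hu : ‖u‖ = 1)
    (he : ‖e‖ = 1) (hue : ⟪u, e⟫_ℂ = 0) {θ : ℝ} (hθ : 0 ≤ θ) :
    Manifold.riemannianEDist 𝓘(ℝ, EuclideanSpace ℂ (Fin n)) (proj u)
      (proj (Real.cos θ • u + Real.sin θ • e)) ≤ ENNReal.ofReal θ := by
  set Z : ℝ → EuclideanSpace ℂ (Fin (n + 1)) := fun t => Real.cos t • u + Real.sin t • e with hZ
  have heu : ⟪e, u⟫_ℂ = 0 := by rw [← inner_conj_symm, hue, map_zero]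
  have huu : ⟪u, u⟫_ℂ = 1 := by rw [inner_self_eq_norm_sq_to_K, hu]; simp
  have hee : ⟪e, e⟫_ℂ = 1 := by rw [inner_self_eq_norm_sq_to_K, he]; simp
  have hcs : ∀ t : ℝ, (Real.cos t : ℂ) * Real.cos t + Real.sin t * Real.sin t = 1 := fun t => by
    exact_mod_cast (by nlinarith [Real.sin_sq_add_cos_sq t] :
      Real.cos t * Real.cos t + Real.sin t * Real.sin t = 1)
  have hin : ∀ a b c d : ℝ, ⟪a • u + b • e, c • u + d • e⟫_ℂ = (a : ℂ) * c + b * d := by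
    intro a b c d
    simp only [inner_add_left, inner_add_right, inner_smul_left_eq_smul, inner_smul_right_eq_smul,
      huu, hee, hue, heu, Complex.real_smul]
    ring
  have hZn : ∀ t, ⟪Z t, Z t⟫_ℂ = 1 := fun t => by rw [hin, hcs]
  have hZ0 : ∀ t, Z t ≠ 0 := fun t h => by
    have := hZn t
    rw [h, inner_zero_left] at this
    exact zero_ne_one this
  have hZn' : ∀ t, ‖Z t‖ = 1 := fun t => by
    have h1 := real_inner_self_eq_norm_sq (Z t)
    rw [real_inner_eq_re, hZn] at h1
    rw [← pow_left_inj₀ (norm_nonneg _) zero_le_one two_ne_zero, ← h1]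
    simp
  have hd : ∀ t, HasDerivAt Z (-Real.sin t • u + Real.cos t • e) t := fun t =>
    ((Real.hasDerivAt_cos t).smul_const u).add ((Real.hasDerivAt_sin t).smul_const e)
  have hZs : ContDiff ℝ ∞ Z := (Real.contDiff_cos.smul contDiff_const).add
    (Real.contDiff_sin.smul contDiff_const)
  have hγ : ContMDiff 𝓘(ℝ, ℝ) 𝓘(ℝ, EuclideanSpace ℂ (Fin n)) 1 (fun t => proj (Z t)) := fun t =>
    ((contMDiffAt_proj (hZ0 t)).comp t hZs.contMDiff.contMDiffAt).of_le (by simp)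
  have hspeed : ∀ t, ‖mfderiv 𝓘(ℝ, ℝ) 𝓘(ℝ, EuclideanSpace ℂ (Fin n)) (fun t => proj (Z t)) t 1‖ₑ
      = 1 := by
    intro t
    have h1 := norm_sq_mfderiv_of_lift (hd t) (hZ0 t) (Filter.Eventually.of_forall fun _ => rfl)
    have h2 : fubiniStudyForm (Z t) (-Real.sin t • u + Real.cos t • e)
        (-Real.sin t • u + Real.cos t • e) = 1 := by
      unfold fubiniStudyForm
      rw [hZn, hZn', hin, hin, hin]
      have := hcs t
      have h3 : (1 : ℂ) * (((-Real.sin t : ℝ) : ℂ) * ((-Real.sin t : ℝ) : ℂ) +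
          (Real.cos t : ℂ) * Real.cos t) -
          (((-Real.sin t : ℝ) : ℂ) * Real.cos t + Real.cos t * Real.sin t) *
          (Real.cos t * ((-Real.sin t : ℝ) : ℂ) + Real.sin t * Real.cos t) = 1 := by
        push_cast
        push_cast at this
        linear_combination this
      rw [h3]
      simp
    rw [h2] at h1
    rw [← ofReal_norm, (pow_eq_one_iff_of_nonneg (norm_nonneg _) two_ne_zero).1 h1]
    simp
  have h := Manifold.riemannianEDist_le_pathELength (hγ.contMDiffOn (s := Icc 0 θ)) rfl rfl hθ
  rw [Manifold.pathELength_eq_lintegral_mfderiv_Icc] at h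
  simp only [hspeed] at h
  simpa [hZ] using h

/-- The distance formula. For the upper bound, `w` is rotated by a phase so that `⟨v, w⟩ ≥ 0`; the
points are then joined by the projection of a great circle arc. -/
theorem riemannianEDist_proj {v w : EuclideanSpace ℂ (Fin (n + 1))} (hv : v ≠ 0) (hw : w ≠ 0) :
    Manifold.riemannianEDist 𝓘(ℝ, EuclideanSpace ℂ (Fin n)) (proj v) (proj w) =
      ENNReal.ofReal (Real.arccos √(cosSq v w)) := by
  refine le_antisymm ?_ ((cosSq_rep v w hv hw) ▸ le_riemannianEDist (proj v) (proj w))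
  by_cases hvw : proj v = proj w
  · rw [hvw, Manifold.riemannianEDist_self]
    exact zero_le
  have hv' : ‖v‖ ≠ 0 := norm_ne_zero_iff.2 hv
  have hw' : ‖w‖ ≠ 0 := norm_ne_zero_iff.2 hw
  set u : EuclideanSpace ℂ (Fin (n + 1)) := ((‖v‖⁻¹ : ℝ) : ℂ) • v with hu
  have hu0 : ((‖v‖⁻¹ : ℝ) : ℂ) ≠ 0 := by simpa using hv
  have hpu : proj v = proj u := (proj_smul hu0 v).symm
  have hun : ‖u‖ = 1 := by
    rw [hu, norm_smul]
    simp [hv']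
  have hcu : cosSq v w = cosSq u w := (cosSq_smul_left hu0 v w).symm
  obtain ⟨φ, hφ, hφs⟩ : ∃ φ : ℂ, ‖φ‖ = 1 ∧ ((‖⟪u, w⟫_ℂ‖ : ℝ) : ℂ) = φ * ⟪u, w⟫_ℂ :=
    RCLike.exists_norm_eq_mul_self ⟪u, w⟫_ℂ
  have hφ0 : φ ≠ 0 := by
    rintro rfl
    simp at hφ
  set a : ℝ := ‖⟪u, w⟫_ℂ‖ with ha
  -- the component of the rotated `w` orthogonal to `u`
  set e' : EuclideanSpace ℂ (Fin (n + 1)) := φ • w - a • u with he'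
  have huu : ⟪u, u⟫_ℂ = 1 := by rw [inner_self_eq_norm_sq_to_K, hun]; simp
  have hue' : ⟪u, e'⟫_ℂ = 0 := by
    rw [he', inner_sub_right, inner_smul_right, inner_smul_right_eq_smul, huu, ← hφs]
    simp
  have he'0 : e' ≠ 0 := by
    intro h
    apply hvw
    have h1 : φ • w = (a : ℂ) • u := by
      rw [he', sub_eq_zero] at h
      rw [h]
      rfl
    have ha0 : (a : ℂ) ≠ 0 := by
      intro h2
      rw [h2, zero_smul] at h1
      exact (smul_ne_zero hφ0 hw) h1
    rw [hpu, ← proj_smul ha0, ← h1, proj_smul hφ0]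
  have he'n : ‖e'‖ ≠ 0 := norm_ne_zero_iff.2 he'0
  set e : EuclideanSpace ℂ (Fin (n + 1)) := ‖e'‖⁻¹ • e' with he
  have hen : ‖e‖ = 1 := by
    rw [he, norm_smul]
    simp [he'n]
  have hue : ⟪u, e⟫_ℂ = 0 := by rw [he, inner_smul_right_eq_smul, hue', smul_zero]
  have hpyth : ‖w‖ ^ 2 = a ^ 2 + ‖e'‖ ^ 2 := by
    have h1 : φ • w = a • u + e' := by rw [he']; abel
    have h2 : ‖φ • w‖ = ‖w‖ := by rw [norm_smul, hφ, one_mul]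
    have h3 : ⟪a • u, e'⟫_ℝ = 0 := by
      rw [real_inner_smul_left, real_inner_eq_re, hue']
      simp
    rw [← h2, h1, norm_add_sq_real, h3, norm_smul, hun]
    simp
  have ha0 : 0 ≤ a := norm_nonneg _
  have hc : √(cosSq v w) = a / ‖w‖ := by
    rw [hcu, cosSq, hun, one_pow, one_mul, ← div_pow, Real.sqrt_sq (by positivity)]
  have hw0 : 0 < ‖w‖ := norm_pos_iff.2 hw
  have hle : a / ‖w‖ ≤ 1 := by
    rw [← hc]
    exact Real.sqrt_le_one.2 (cosSq_le_one v w)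
  have hcos : Real.cos (Real.arccos √(cosSq v w)) = a / ‖w‖ := by
    rw [hc, Real.cos_arccos (by linarith [div_nonneg ha0 hw0.le]) hle]
  have hsin : Real.sin (Real.arccos √(cosSq v w)) = ‖e'‖ / ‖w‖ := by
    rw [Real.sin_arccos, hc, div_pow]
    have : 1 - a ^ 2 / ‖w‖ ^ 2 = (‖e'‖ / ‖w‖) ^ 2 := by
      field_simp
      linarith
    rw [this, Real.sqrt_sq (by positivity)]
  have h := riemannianEDist_proj_le hun hen hue (Real.arccos_nonneg √(cosSq v w))
  rw [hcos, hsin] at h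
  have hfin : (a / ‖w‖) • u + (‖e'‖ / ‖w‖) • e = ((‖w‖⁻¹ : ℝ) : ℂ) • φ • w := by
    have h1 : φ • w = a • u + e' := by rw [he']; abel
    have h2 : (‖e'‖ / ‖w‖) • e = ‖w‖⁻¹ • e' := by
      rw [he, smul_smul]
      congr 1
      field_simp
    rw [h1, h2, Complex.coe_smul, smul_add, smul_smul]
    congr 2
    field_simp
  rw [hfin, proj_smul (a := ((‖w‖⁻¹ : ℝ) : ℂ)) (by simpa using hw), proj_smul hφ0, ← hpu] at h
  exact h

theorem geodesicDist_eq (p q : ComplexProjectiveSpace n) :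
    RiemannianGeometry.geodesicDist (EuclideanSpace ℂ (Fin n)) p q =
      Real.arccos √(cosSq p.rep q.rep) := by
  have h := riemannianEDist_proj p.rep_nonzero q.rep_nonzero
  rw [proj_rep, proj_rep] at h
  rw [RiemannianGeometry.geodesicDist, h, ENNReal.toReal_ofReal (Real.arccos_nonneg _)]

theorem sin_geodesicDist (p q : ComplexProjectiveSpace n) :
    Real.sin (RiemannianGeometry.geodesicDist (EuclideanSpace ℂ (Fin n)) p q) =
      √(1 - cosSq p.rep q.rep) := by
  rw [geodesicDist_eq, Real.sin_arccos, Real.sq_sqrt (cosSq_nonneg _ _)]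

/-! ### The metric in affine coordinates -/

theorem norm_insertCoord_sq (i : Fin (n + 1)) (a : ℂ) (z : EuclideanSpace ℂ (Fin n)) :
    ‖insertCoord i a z‖ ^ 2 = ‖a‖ ^ 2 + ‖z‖ ^ 2 := by
  rw [EuclideanSpace.norm_sq_eq, EuclideanSpace.norm_sq_eq, Fin.sum_univ_succAbove _ i]
  simp

theorem inner_insertCoord (i : Fin (n + 1)) (a b : ℂ) (z w : EuclideanSpace ℂ (Fin n)) :
    ⟪insertCoord i a z, insertCoord i b w⟫_ℂ = starRingEnd ℂ a * b + ⟪z, w⟫_ℂ := by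
  rw [PiLp.inner_apply, PiLp.inner_apply, Fin.sum_univ_succAbove _ i]
  simp [mul_comm]

/-- Splitting off the `i`-th coordinate, as a linear isometry. -/
def insertCoordEquiv (i : Fin (n + 1)) :
    WithLp 2 (ℂ × EuclideanSpace ℂ (Fin n)) ≃ₗᵢ[ℝ] EuclideanSpace ℂ (Fin (n + 1)) where
  toFun x := insertCoord i x.fst x.snd
  invFun Z := WithLp.toLp 2 (Z i, WithLp.toLp 2 fun k => Z (i.succAbove k))
  map_add' x y := by
    ext j
    rcases Fin.eq_self_or_eq_succAbove i j with rfl | ⟨k, rfl⟩ <;> simp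
  map_smul' t x := by
    ext j
    rcases Fin.eq_self_or_eq_succAbove i j with rfl | ⟨k, rfl⟩ <;> simp
  left_inv x := by
    refine WithLp.ofLp_injective 2 (Prod.ext ?_ ?_)
    · simp
    · ext k
      simp
  right_inv Z := by
    ext j
    rcases Fin.eq_self_or_eq_succAbove i j with rfl | ⟨k, rfl⟩ <;> simp
  norm_map' x := by
    rw [← pow_left_inj₀ (norm_nonneg _) (norm_nonneg _) two_ne_zero]
    exact (norm_insertCoord_sq i _ _).trans (WithLp.prod_norm_sq_eq_of_L2 x).symm

theorem insertCoordEquiv_apply (i : Fin (n + 1)) (a : ℂ) (z : EuclideanSpace ℂ (Fin n)) :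
    insertCoordEquiv i (WithLp.toLp 2 (a, z)) = insertCoord i a z := rfl

/-- The derivative of `z ↦ insertCoord i a z` is `insertCoord i 0`. -/
theorem hasFDerivAt_insertCoord (i : Fin (n + 1)) (a : ℂ) (z : EuclideanSpace ℂ (Fin n)) :
    ∃ T : EuclideanSpace ℂ (Fin n) →L[ℝ] EuclideanSpace ℂ (Fin (n + 1)),
      HasFDerivAt (fun z => insertCoord i a z) T z ∧ ∀ v, T v = insertCoord i 0 v := by
  let T : EuclideanSpace ℂ (Fin n) →L[ℝ] EuclideanSpace ℂ (Fin (n + 1)) :=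
    LinearMap.toContinuousLinearMap
      { toFun := insertCoord i 0
        map_add' := insertCoord_zero_add i
        map_smul' := insertCoord_zero_smul i }
  refine ⟨T, ?_, fun _ => rfl⟩
  have h : (fun z => insertCoord i a z) = fun z : EuclideanSpace ℂ (Fin n) =>
      T z + insertCoord i a 0 := by
    ext z j
    change insertCoord i a z j = (insertCoord i 0 z + insertCoord i a 0) j
    rcases Fin.eq_self_or_eq_succAbove i j with rfl | ⟨k, rfl⟩ <;> simp
  rw [h]
  exact T.hasFDerivAt.add_const _

theorem metricMatrix_affineChart (i : Fin (n + 1)) (z : EuclideanSpace ℂ (Fin n))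
    (j k : Fin (Module.finrank ℝ (EuclideanSpace ℂ (Fin n)))) :
    RiemannianGeometry.metricMatrix (affineChart i) z j k =
      chartForm i z (stdOrthonormalBasis ℝ (EuclideanSpace ℂ (Fin n)) j)
        (stdOrthonormalBasis ℝ (EuclideanSpace ℂ (Fin n)) k) := by
  obtain ⟨T, hT, hT'⟩ := hasFDerivAt_insertCoord i 1 z
  have h0 : insertCoord i 1 z ≠ 0 := insertCoord_ne_zero i one_ne_zero z
  have h1 : HasMFDerivAt 𝓘(ℝ, EuclideanSpace ℂ (Fin n)) 𝓘(ℝ, EuclideanSpace ℂ (Fin (n + 1)))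
      (fun z => insertCoord i 1 z) z T := hT.hasMFDerivAt
  have h2 := ((contMDiffAt_proj h0).mdifferentiableAt (by simp)).hasMFDerivAt.comp z h1
  have h3 : proj ∘ (fun z => insertCoord i 1 z) = (affineChart i).symm := by
    ext z
    exact (affineChart_symm_apply i z).symm
  rw [h3] at h2
  have h4 := h2.mfderiv
  have h5 := inner_mfderiv_proj h0 (T (stdOrthonormalBasis ℝ (EuclideanSpace ℂ (Fin n)) j))
    (T (stdOrthonormalBasis ℝ (EuclideanSpace ℂ (Fin n)) k))
  rw [hT', hT'] at h5
  unfold chartForm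
  rw [← h5]
  -- transport of inner products along an equality of base points
  have h6 : ∀ (x : ComplexProjectiveSpace n) (_ : x = proj (insertCoord i 1 z))
      (S : EuclideanSpace ℂ (Fin n) →L[ℝ] EuclideanSpace ℂ (Fin n)),
      S = (mfderiv 𝓘(ℝ, EuclideanSpace ℂ (Fin (n + 1))) 𝓘(ℝ, EuclideanSpace ℂ (Fin n)) proj
        (insertCoord i 1 z) : EuclideanSpace ℂ (Fin (n + 1)) →L[ℝ] EuclideanSpace ℂ (Fin n)).comp
          T →
      ∀ v w : EuclideanSpace ℂ (Fin n),
      ⟪(show TangentSpace 𝓘(ℝ, EuclideanSpace ℂ (Fin n)) x from S v),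
        (show TangentSpace 𝓘(ℝ, EuclideanSpace ℂ (Fin n)) x from S w)⟫_ℝ =
      ⟪mfderiv 𝓘(ℝ, EuclideanSpace ℂ (Fin (n + 1))) 𝓘(ℝ, EuclideanSpace ℂ (Fin n)) proj
        (insertCoord i 1 z) (T v),
       mfderiv 𝓘(ℝ, EuclideanSpace ℂ (Fin (n + 1))) 𝓘(ℝ, EuclideanSpace ℂ (Fin n)) proj
        (insertCoord i 1 z) (T w)⟫_ℝ := by
    rintro _ rfl _ rfl v w
    rfl
  have h7 := h6 _ (affineChart_symm_apply i z) _ h4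
    (stdOrthonormalBasis ℝ (EuclideanSpace ℂ (Fin n)) j)
    (stdOrthonormalBasis ℝ (EuclideanSpace ℂ (Fin n)) k)
  rw [hT', hT'] at h7
  exact h7

/-- Polarized form of `|⟨z, v⟩|² = ⟨z, v⟩_ℝ² + ⟨i z, v⟩_ℝ²`. -/
theorem re_inner_mul_inner {m : ℕ} (v z w : EuclideanSpace ℂ (Fin m)) :
    (⟪v, z⟫_ℂ * ⟪z, w⟫_ℂ).re =
      ⟪v, z⟫_ℝ * ⟪w, z⟫_ℝ + ⟪v, Complex.I • z⟫_ℝ * ⟪w, Complex.I • z⟫_ℝ := by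
  rw [← inner_conj_symm z w]
  simp only [real_inner_eq_re, inner_smul_right, Complex.mul_re, Complex.conj_re, Complex.conj_im,
    Complex.I_re, Complex.I_im]
  ring

theorem real_inner_I_smul_self {m : ℕ} (z : EuclideanSpace ℂ (Fin m)) :
    ⟪z, Complex.I • z⟫_ℝ = 0 := by
  rw [real_inner_eq_re, inner_smul_right, inner_self_eq_norm_sq_to_K]
  simp [← Complex.ofReal_pow]

theorem norm_I_smul {m : ℕ} (z : EuclideanSpace ℂ (Fin m)) : ‖Complex.I • z‖ = ‖z‖ := by
  rw [norm_smul]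
  simp

theorem chartForm_eq (i : Fin (n + 1)) (z v w : EuclideanSpace ℂ (Fin n)) :
    chartForm i z v w = (1 + ‖z‖ ^ 2)⁻¹ * (⟪v, w⟫_ℝ - (1 + ‖z‖ ^ 2)⁻¹ *
      (⟪v, z⟫_ℝ * ⟪w, z⟫_ℝ + ⟪v, Complex.I • z⟫_ℝ * ⟪w, Complex.I • z⟫_ℝ)) := by
  have hz : 1 + ‖z‖ ^ 2 ≠ 0 := by positivity
  have h1 : ‖insertCoord i 1 z‖ ^ 2 = 1 + ‖z‖ ^ 2 := by
    rw [norm_insertCoord_sq]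
    simp
  have h2 : ⟪insertCoord i 1 z, insertCoord i 1 z⟫_ℂ = ((1 + ‖z‖ ^ 2 : ℝ) : ℂ) := by
    rw [← h1, inner_self_eq_norm_sq_to_K]
    simp
  unfold chartForm fubiniStudyForm
  rw [h2, inner_insertCoord, inner_insertCoord, inner_insertCoord, Complex.sub_re,
    Complex.re_ofReal_mul]
  simp only [map_zero, zero_mul, zero_add, mul_zero]
  rw [re_inner_mul_inner, ← real_inner_eq_re, show ‖insertCoord i 1 z‖ ^ 4 =
    (‖insertCoord i 1 z‖ ^ 2) ^ 2 by ring, h1]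
  field_simp

/-- The coordinates of `z` and `i z` in the standard real orthonormal basis, as the columns of
a matrix. -/
def coordColumns (z : EuclideanSpace ℂ (Fin n)) :
    Matrix (Fin (Module.finrank ℝ (EuclideanSpace ℂ (Fin n)))) (Fin 2) ℝ :=
  Matrix.of fun j => ![⟪stdOrthonormalBasis ℝ (EuclideanSpace ℂ (Fin n)) j, z⟫_ℝ,
    ⟪stdOrthonormalBasis ℝ (EuclideanSpace ℂ (Fin n)) j, Complex.I • z⟫_ℝ]

theorem coordColumns_transpose_mul (z : EuclideanSpace ℂ (Fin n)) :
    (coordColumns z).transpose * coordColumns z = ‖z‖ ^ 2 • (1 : Matrix (Fin 2) (Fin 2) ℝ) := by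
  have h : ∀ x y : EuclideanSpace ℂ (Fin n),
      ∑ j, ⟪stdOrthonormalBasis ℝ (EuclideanSpace ℂ (Fin n)) j, x⟫_ℝ *
        ⟪stdOrthonormalBasis ℝ (EuclideanSpace ℂ (Fin n)) j, y⟫_ℝ = ⟪x, y⟫_ℝ := by
    intro x y
    rw [← (stdOrthonormalBasis ℝ (EuclideanSpace ℂ (Fin n))).sum_inner_mul_inner x y]
    simp only [real_inner_comm]
  ext a b
  fin_cases a <;> fin_cases b <;>
    simp [Matrix.mul_apply, coordColumns, h, real_inner_I_smul_self,
      real_inner_comm z (Complex.I • z), norm_I_smul]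

theorem metricMatrix_eq (i : Fin (n + 1)) (z : EuclideanSpace ℂ (Fin n)) :
    RiemannianGeometry.metricMatrix (affineChart i) z = (1 + ‖z‖ ^ 2)⁻¹ •
      (1 - ((1 + ‖z‖ ^ 2)⁻¹ • coordColumns z) * (coordColumns z).transpose) := by
  ext j k
  rw [metricMatrix_affineChart, chartForm_eq]
  have := (stdOrthonormalBasis ℝ (EuclideanSpace ℂ (Fin n))).inner_eq_ite j k
  simp [Matrix.mul_apply, coordColumns, this, Matrix.one_apply, mul_add, mul_assoc]

/-- The inverse of the metric matrix. The columns of `coordColumns z` are orthogonal of norm `‖z‖`,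
so that this is the inverse of a rank-two perturbation of the identity. -/
theorem metricMatrix_inv (i : Fin (n + 1)) (z : EuclideanSpace ℂ (Fin n)) :
    (RiemannianGeometry.metricMatrix (affineChart i) z)⁻¹ =
      (1 + ‖z‖ ^ 2) • (1 + coordColumns z * (coordColumns z).transpose) := by
  have hz : 1 + ‖z‖ ^ 2 ≠ 0 := by positivity
  refine Matrix.inv_eq_right_inv ?_
  have h1 : coordColumns z * (coordColumns z).transpose *
      (coordColumns z * (coordColumns z).transpose) =
      ‖z‖ ^ 2 • (coordColumns z * (coordColumns z).transpose) := by
    rw [Matrix.mul_assoc, ← Matrix.mul_assoc _ (coordColumns z), coordColumns_transpose_mul]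
    simp
  rw [metricMatrix_eq, Matrix.smul_mul, Matrix.mul_smul, smul_smul, inv_mul_cancel₀ hz, one_smul,
    Matrix.smul_mul, sub_mul, one_mul, Matrix.smul_mul, mul_add, mul_one, h1]
  have h2 : ∀ A : Matrix (Fin (Module.finrank ℝ (EuclideanSpace ℂ (Fin n)))) (Fin (Module.finrank ℝ
      (EuclideanSpace ℂ (Fin n)))) ℝ, (1 + ‖z‖ ^ 2)⁻¹ • (A + ‖z‖ ^ 2 • A) = A := fun A => by
    rw [← one_smul ℝ A, smul_smul, mul_one, ← add_smul, smul_smul, inv_mul_cancel₀ hz]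
  rw [h2, add_sub_cancel_right]

theorem finrank_real : Module.finrank ℝ (EuclideanSpace ℂ (Fin n)) = 2 * n := by
  rw [← Module.finrank_mul_finrank ℝ ℂ]
  simp

/-- The volume density. The determinant reduces to a `2 × 2` determinant by the identity
`det (1 - A B) = det (1 - B A)`. -/
theorem volumeDensity_eq (i : Fin (n + 1)) (z : EuclideanSpace ℂ (Fin n)) :
    RiemannianGeometry.volumeDensity (affineChart i) z = ((1 + ‖z‖ ^ 2) ^ (n + 1))⁻¹ := by
  have hz : 0 < 1 + ‖z‖ ^ 2 := by positivity
  have h1 : (RiemannianGeometry.metricMatrix (affineChart i) z).det =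
      (((1 + ‖z‖ ^ 2) ^ (n + 1))⁻¹) ^ 2 := by
    rw [metricMatrix_eq, Matrix.det_smul, Matrix.det_one_sub_mul_comm, Matrix.mul_smul,
      coordColumns_transpose_mul, smul_smul, Matrix.det_fin_two]
    simp only [Fintype.card_fin, finrank_real, Matrix.sub_apply, Matrix.smul_apply,
      Matrix.one_apply_eq, ne_eq, zero_ne_one, one_ne_zero, not_false_eq_true,
      Matrix.one_apply_ne, smul_eq_mul, mul_one, mul_zero, sub_zero]
    have h2 : 1 - (1 + ‖z‖ ^ 2)⁻¹ * ‖z‖ ^ 2 = (1 + ‖z‖ ^ 2)⁻¹ := by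
      field_simp
      ring
    rw [h2, ← inv_pow]
    ring
  rw [RiemannianGeometry.volumeDensity, h1, abs_of_nonneg (by positivity),
    Real.sqrt_sq (by positivity)]

/-! ### The Riemannian volume -/

section Volume

open scoped ENNReal

/-- Multiplication by a complex number of modulus one, as a real linear isometry. -/
def rotation {m : ℕ} (φ : ℂ) (h : ‖φ‖ = 1) :
    EuclideanSpace ℂ (Fin m) ≃ₗᵢ[ℝ] EuclideanSpace ℂ (Fin m) where
  toLinearEquiv := ((LinearEquiv.smulOfNeZero ℂ (EuclideanSpace ℂ (Fin m)) φ
    (by rintro rfl; simp at h)).restrictScalars ℝ)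
  norm_map' z := by
    change ‖φ • z‖ = ‖z‖
    rw [norm_smul, h, one_mul]

theorem lintegral_comp_real_smul {F : Type*} [NormedAddCommGroup F] [NormedSpace ℝ F]
    [MeasurableSpace F] [BorelSpace F] [FiniteDimensional ℝ F] (μ : Measure F)
    [μ.IsAddHaarMeasure] {r : ℝ} (hr : 0 < r) {g : F → ℝ≥0∞} (hg : Measurable g) :
    ∫⁻ y, g y ∂μ = ENNReal.ofReal (r ^ Module.finrank ℝ F) * ∫⁻ z, g (r • z) ∂μ := by
  have h1 : ∫⁻ z, g (r • z) ∂μ = ∫⁻ y, g y ∂(μ.map (fun z => r • z)) :=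
    (lintegral_map hg (measurable_const_smul r)).symm
  rw [h1, Measure.map_addHaar_smul μ hr.ne', lintegral_smul_measure, smul_eq_mul, ← mul_assoc,
    ← ENNReal.ofReal_mul (by positivity), abs_of_pos (by positivity),
    mul_inv_cancel₀ (by positivity), ENNReal.ofReal_one, one_mul]

theorem lintegral_comp_complex_smul {ζ : ℂ} (hζ : ζ ≠ 0) {g : EuclideanSpace ℂ (Fin n) → ℝ≥0∞}
    (hg : Measurable g) :
    ∫⁻ y, g y = ENNReal.ofReal (‖ζ‖ ^ (2 * n)) * ∫⁻ z, g (ζ • z) := by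
  have hr : 0 < ‖ζ‖ := norm_pos_iff.2 hζ
  rw [lintegral_comp_real_smul volume hr hg, finrank_real]
  congr 1
  have hφ : ‖ζ / ‖ζ‖‖ = 1 := by
    rw [norm_div, Complex.norm_real, norm_norm, div_self hr.ne']
  rw [← (rotation (m := n) (ζ / ‖ζ‖) hφ).measurePreserving.lintegral_comp
    (f := fun z => g (‖ζ‖ • z)) (hg.comp (measurable_const_smul _))]
  refine lintegral_congr fun z => congrArg g ?_
  change ‖ζ‖ • (ζ / ‖ζ‖) • z = ζ • z
  rw [← Complex.coe_smul, smul_smul, mul_div_cancel₀]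
  exact_mod_cast hr.ne'

/-- The constant `∫ |η|^(2n) w(|η|²) dη` relating the weighted volume `w(|Z|²) dZ` of `ℂ^(n+1)` to
the Riemannian volume of projective space. -/
def weightConst (n : ℕ) (w : ℝ → ℝ≥0∞) : ℝ≥0∞ :=
  ∫⁻ η : ℂ, ENNReal.ofReal (‖η‖ ^ (2 * n)) * w (‖η‖ ^ 2)

theorem lintegral_weight_scaled {w : ℝ → ℝ≥0∞} (hw : Measurable w) {s : ℝ} (hs : 0 < s) :
    ∫⁻ ζ : ℂ, ENNReal.ofReal (‖ζ‖ ^ (2 * n)) * w (‖ζ‖ ^ 2 * s) =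
      ENNReal.ofReal (s ^ (n + 1))⁻¹ * weightConst n w := by
  have hr : 0 < (√s)⁻¹ := inv_pos.2 (Real.sqrt_pos.2 hs)
  have hsq : ((√s)⁻¹) ^ 2 = s⁻¹ := by rw [inv_pow, Real.sq_sqrt hs.le]
  have hm : Measurable fun ζ : ℂ => ENNReal.ofReal (‖ζ‖ ^ (2 * n)) * w (‖ζ‖ ^ 2 * s) := by
    fun_prop
  rw [lintegral_comp_real_smul volume hr hm, Complex.finrank_real_complex, hsq, weightConst,
    ← lintegral_const_mul' _ _ ENNReal.ofReal_ne_top,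
    ← lintegral_const_mul' _ _ ENNReal.ofReal_ne_top]
  refine lintegral_congr fun ζ => ?_
  rw [norm_smul, mul_pow, mul_pow, pow_mul ‖(√s)⁻¹‖, Real.norm_of_nonneg hr.le, hsq, ← mul_assoc,
    ← mul_assoc, ← ENNReal.ofReal_mul (by positivity), ← ENNReal.ofReal_mul (by positivity)]
  congr 2
  · rw [pow_succ, mul_inv, inv_pow]
    ring
  · field_simp

theorem lintegral_chartVolume (i : Fin (n + 1)) {f : ComplexProjectiveSpace n → ℝ≥0∞}
    (hf : Measurable f) :
    ∫⁻ x, f x ∂(RiemannianGeometry.chartVolume (affineChart i)) =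
      ∫⁻ z, ENNReal.ofReal ((1 + ‖z‖ ^ 2) ^ (n + 1))⁻¹ * f (proj (insertCoord i 1 z)) := by
  have hc : Measurable (affineChart i).symm := by
    have : Continuous (affineChart i).symm := (contMDiff_affineChart_symm i).continuous
    exact this.measurable
  rw [RiemannianGeometry.chartVolume, lintegral_map hf hc]
  have h1 : (affineChart i).target = univ := rfl
  rw [h1, Measure.restrict_univ]
  simp only [volumeDensity_eq, affineChart_symm_apply]
  have hf' : Measurable fun z => f (proj (insertCoord i 1 z)) := by
    simp only [← affineChart_symm_apply]
    exact hf.comp hc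
  rw [lintegral_withDensity_eq_lintegral_mul _ (by fun_prop) hf']
  rfl

theorem insertCoord_mul_smul (i : Fin (n + 1)) (ζ : ℂ) (z : EuclideanSpace ℂ (Fin n)) :
    insertCoord i ζ (ζ • z) = ζ • insertCoord i 1 z := by
  ext j
  rcases Fin.eq_self_or_eq_succAbove i j with rfl | ⟨k, rfl⟩ <;> simp

/-- Integration over `ℂ^(n+1)` in the coordinates `Z = ζ (1, z)`. -/
theorem lintegral_proj_weight_chart (i : Fin (n + 1)) {w : ℝ → ℝ≥0∞} (hw : Measurable w)
    {f : ComplexProjectiveSpace n → ℝ≥0∞} (hf : Measurable f) :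
    ∫⁻ Z : EuclideanSpace ℂ (Fin (n + 1)), f (proj Z) * w (‖Z‖ ^ 2) =
      weightConst n w * ∫⁻ x, f x ∂(RiemannianGeometry.chartVolume (affineChart i)) := by
  have hm : Measurable fun Z : EuclideanSpace ℂ (Fin (n + 1)) => f (proj Z) * w (‖Z‖ ^ 2) := by
    have := measurable_proj (n := n)
    fun_prop
  have hins : Measurable fun x : ℂ × EuclideanSpace ℂ (Fin n) => insertCoord i x.1 x.2 :=
    ((insertCoordEquiv i).continuous.comp (WithLp.prod_continuous_toLp 2 _ _)).measurable
  have hmp : MeasurePreserving (fun x : ℂ × EuclideanSpace ℂ (Fin n) => insertCoord i x.1 x.2)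
      (volume.prod volume) volume :=
    (insertCoordEquiv i).measurePreserving.comp (WithLp.volume_preserving_toLp _ _)
  rw [← hmp.lintegral_comp hm, lintegral_prod (fun x =>
      f (proj (insertCoord i x.1 x.2)) * w (‖insertCoord i x.1 x.2‖ ^ 2))
      (hm.comp hins).aemeasurable]
  have h1 : ∀ᵐ ζ : ℂ, ∫⁻ y : EuclideanSpace ℂ (Fin n),
      f (proj (insertCoord i ζ y)) * w (‖insertCoord i ζ y‖ ^ 2) =
      ∫⁻ z : EuclideanSpace ℂ (Fin n), f (proj (insertCoord i 1 z)) *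
        (ENNReal.ofReal (‖ζ‖ ^ (2 * n)) * w (‖ζ‖ ^ 2 * (1 + ‖z‖ ^ 2))) := by
    have h0 : ∀ᵐ ζ : ℂ, ζ ≠ 0 := by simp [ae_iff]
    filter_upwards [h0] with ζ hζ
    rw [lintegral_comp_complex_smul hζ (g := fun y => f (proj (insertCoord i ζ y)) *
        w (‖insertCoord i ζ y‖ ^ 2)) ((hm.comp hins).comp measurable_prodMk_left),
      ← lintegral_const_mul' _ _ ENNReal.ofReal_ne_top]
    refine lintegral_congr fun z => ?_
    rw [insertCoord_mul_smul, proj_smul hζ, norm_smul, mul_pow, norm_insertCoord_sq, norm_one,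
      one_pow]
    ring
  have hf' : Measurable fun z : EuclideanSpace ℂ (Fin n) => f (proj (insertCoord i 1 z)) :=
    (hf.comp measurable_proj).comp (hins.comp measurable_prodMk_left)
  have hk : Measurable fun x : ℂ × EuclideanSpace ℂ (Fin n) =>
      ENNReal.ofReal (‖x.1‖ ^ (2 * n)) * w (‖x.1‖ ^ 2 * (1 + ‖x.2‖ ^ 2)) :=
    (by fun_prop : Measurable fun x : ℂ × EuclideanSpace ℂ (Fin n) =>
      ENNReal.ofReal (‖x.1‖ ^ (2 * n))).mul (hw.comp (by fun_prop))
  have hd : Measurable fun z : EuclideanSpace ℂ (Fin n) =>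
      ENNReal.ofReal ((1 + ‖z‖ ^ 2) ^ (n + 1))⁻¹ * f (proj (insertCoord i 1 z)) :=
    (by fun_prop : Measurable fun z : EuclideanSpace ℂ (Fin n) =>
      ENNReal.ofReal ((1 + ‖z‖ ^ 2) ^ (n + 1))⁻¹).mul hf'
  rw [lintegral_congr_ae h1, lintegral_lintegral_swap
    ((hf'.comp measurable_snd).mul hk).aemeasurable, lintegral_chartVolume i hf,
    ← lintegral_const_mul _ hd]
  refine lintegral_congr fun z => ?_
  rw [lintegral_const_mul _ (f := fun ζ : ℂ => ENNReal.ofReal (‖ζ‖ ^ (2 * n)) *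
    w (‖ζ‖ ^ 2 * (1 + ‖z‖ ^ 2))) (hk.comp measurable_prodMk_right),
    lintegral_weight_scaled hw (by positivity)]
  ring

/-- A bump function on the real line, supported in `[1, 3]`. -/
def annulusBump : ContDiffBump (2 : ℝ) := ⟨1 / 2, 1, by norm_num, by norm_num⟩

/-- `annulusBump` as a function on the real line. -/
def weight (t : ℝ) : ℝ := annulusBump t

theorem contDiff_weight : ContDiff ℝ ∞ weight := annulusBump.contDiff

theorem weight_nonneg (t : ℝ) : 0 ≤ weight t := annulusBump.nonneg

theorem weight_eq_zero {t : ℝ} (h : t ≤ 1 ∨ 3 ≤ t) : weight t = 0 := by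
  refine annulusBump.zero_of_le_dist ?_
  rw [Real.dist_eq]
  change (1 : ℝ) ≤ |t - 2|
  rcases h with h | h
  · rw [abs_of_neg] <;> linarith
  · rw [abs_of_pos] <;> linarith

theorem weight_two : weight 2 = 1 := annulusBump.one_of_mem_closedBall (by
  rw [Metric.mem_closedBall, dist_self]
  exact annulusBump.rIn_pos.le)

theorem measurable_weight : Measurable fun t => ENNReal.ofReal (weight t) :=
  ENNReal.measurable_ofReal.comp contDiff_weight.continuous.measurable

/-- The measure `w(|Z|²) dZ` on `ℂ^(n+1)`, where `w` is `weight`. -/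
def weightedVolume (n : ℕ) : Measure (EuclideanSpace ℂ (Fin (n + 1))) :=
  volume.withDensity fun Z => ENNReal.ofReal (weight (‖Z‖ ^ 2))

theorem continuous_weight_norm {m : ℕ} :
    Continuous fun Z : EuclideanSpace ℂ (Fin m) => weight (‖Z‖ ^ 2) :=
  contDiff_weight.continuous.comp (by fun_prop)

theorem hasCompactSupport_weight_norm {m : ℕ} :
    HasCompactSupport fun Z : EuclideanSpace ℂ (Fin m) => weight (‖Z‖ ^ 2) := by
  refine HasCompactSupport.intro (isCompact_closedBall 0 2) fun Z hZ => weight_eq_zero (Or.inr ?_)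
  have : 2 < ‖Z‖ := by simpa using hZ
  nlinarith

theorem weightConst_ne_top : weightConst n (fun t => ENNReal.ofReal (weight t)) ≠ ⊤ := by
  have h1 : Continuous fun η : ℂ => ‖η‖ ^ (2 * n) * weight (‖η‖ ^ 2) :=
    (by fun_prop : Continuous fun η : ℂ => ‖η‖ ^ (2 * n)).mul
      (contDiff_weight.continuous.comp (by fun_prop))
  have h2 : HasCompactSupport fun η : ℂ => ‖η‖ ^ (2 * n) * weight (‖η‖ ^ 2) := by
    refine HasCompactSupport.intro (isCompact_closedBall 0 2) fun Z hZ => ?_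
    have : 2 < ‖Z‖ := by simpa using hZ
    rw [weight_eq_zero (Or.inr (by nlinarith)), mul_zero]
  have h3 := (h1.integrable_of_hasCompactSupport h2 (μ := volume)).lintegral_lt_top
  unfold weightConst
  simp only [← ENNReal.ofReal_mul (pow_nonneg (norm_nonneg _) _)]
  exact h3.ne

theorem weightConst_ne_zero : weightConst n (fun t => ENNReal.ofReal (weight t)) ≠ 0 := by
  unfold weightConst
  have h1 : Continuous fun η : ℂ => ‖η‖ ^ (2 * n) * weight (‖η‖ ^ 2) :=
    (by fun_prop : Continuous fun η : ℂ => ‖η‖ ^ (2 * n)).mul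
      (contDiff_weight.continuous.comp (by fun_prop))
  simp only [← ENNReal.ofReal_mul (pow_nonneg (norm_nonneg _) _)]
  have h2 : Continuous fun η : ℂ => ENNReal.ofReal (‖η‖ ^ (2 * n) * weight (‖η‖ ^ 2)) :=
    ENNReal.continuous_ofReal.comp h1
  refine ((lintegral_pos_iff_support h2.measurable).2
    ((isOpen_ne_fun h2 continuous_const).measure_pos volume ⟨((√2 : ℝ) : ℂ), ?_⟩)).ne'
  have h3 : ‖((√2 : ℝ) : ℂ)‖ = √2 := by
    rw [Complex.norm_real, Real.norm_of_nonneg (Real.sqrt_nonneg 2)]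
  rw [mem_ofPred_eq, h3, Real.sq_sqrt zero_le_two, weight_two]
  simp

theorem chartVolume_affineChart (i : Fin (n + 1)) :
    RiemannianGeometry.chartVolume (affineChart i) =
      (weightConst n (fun t => ENNReal.ofReal (weight t)))⁻¹ • (weightedVolume n).map proj := by
  refine Measure.ext_of_lintegral _ fun f hf => ?_
  rw [lintegral_smul_measure, lintegral_map hf measurable_proj, weightedVolume,
    lintegral_withDensity_eq_lintegral_mul _ (by
      exact (measurable_weight.comp (by fun_prop : Measurable fun Z : EuclideanSpace ℂ (Fin (n + 1))
        => ‖Z‖ ^ 2))) (g := fun Z => f (proj Z)) (hf.comp measurable_proj)]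
  have h := lintegral_proj_weight_chart i measurable_weight hf
  simp only [Pi.mul_apply, mul_comm (ENNReal.ofReal _)]
  rw [h, smul_eq_mul, ← mul_assoc, ENNReal.inv_mul_cancel weightConst_ne_zero weightConst_ne_top,
    one_mul]

/-- The Riemannian volume is, up to a constant factor, the image of `weightedVolume`: the volumes of
the affine charts are all equal to this measure, since the complement of a chart is a null set. -/
theorem riemannianVolume_eq :
    RiemannianGeometry.riemannianVolume (EuclideanSpace ℂ (Fin n)) (ComplexProjectiveSpace n) =
      (weightConst n (fun t => ENNReal.ofReal (weight t)))⁻¹ • (weightedVolume n).map proj := by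
  unfold RiemannianGeometry.riemannianVolume
  have h : atlas (EuclideanSpace ℂ (Fin n)) (ComplexProjectiveSpace n) = range affineChart := rfl
  rw [h, iSup_range]
  simp only [chartVolume_affineChart]
  exact ciSup_const

end Volume

/-! ### The Laplacian of a homogeneous function -/

section Laplacian

open scoped Laplacian

theorem laplacian_eq_sum {F' : Type*} [NormedAddCommGroup F'] [InnerProductSpace ℝ F']
    [FiniteDimensional ℝ F'] {ι : Type*} [Fintype ι] (b : OrthonormalBasis ι ℝ F') (F : F' → ℝ)
    (Z : F') : (Δ F) Z = ∑ i, fderiv ℝ (fderiv ℝ F) Z (b i) (b i) := by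
  rw [InnerProductSpace.laplacian_eq_iteratedFDeriv_orthonormalBasis F b]
  simp [iteratedFDeriv_two_apply]

/-- Multiplication by a nonzero complex number as a real continuous linear equivalence. -/
def smulEquiv {m : ℕ} (a : ℂ) (ha : a ≠ 0) :
    EuclideanSpace ℂ (Fin m) ≃L[ℝ] EuclideanSpace ℂ (Fin m) :=
  ((LinearEquiv.smulOfNeZero ℂ (EuclideanSpace ℂ (Fin m)) a ha).restrictScalars
    ℝ).toContinuousLinearEquiv

theorem smulEquiv_apply {m : ℕ} (a : ℂ) (ha : a ≠ 0) (Z : EuclideanSpace ℂ (Fin m)) :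
    smulEquiv a ha Z = a • Z := rfl

section Homogeneous

variable {m : ℕ} {F : EuclideanSpace ℂ (Fin m) → ℝ}

/-- The derivative of a function invariant under complex scaling is homogeneous of degree `-1`. -/
theorem fderiv_smul_smul (hF : ∀ a : ℂ, a ≠ 0 → ∀ Z, F (a • Z) = F Z) {a : ℂ} (ha : a ≠ 0)
    (Z V : EuclideanSpace ℂ (Fin m)) : fderiv ℝ F (a • Z) (a • V) = fderiv ℝ F Z V := by
  have h1 : F ∘ smulEquiv a ha = F := funext fun Z => hF a ha Z
  have h2 := (smulEquiv (m := m) a ha).comp_right_fderiv (f := F) (x := Z)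
  rw [h1] at h2
  rw [h2]
  rfl

theorem fderiv_fderiv_smul (hF : ∀ a : ℂ, a ≠ 0 → ∀ Z, F (a • Z) = F Z) {a : ℂ} (ha : a ≠ 0)
    (Z V W : EuclideanSpace ℂ (Fin m)) (hd : DifferentiableAt ℝ (fderiv ℝ F) (a • Z)) :
    fderiv ℝ (fderiv ℝ F) (a • Z) (a • V) (a • W) = fderiv ℝ (fderiv ℝ F) Z V W := by
  have h1 : (fun Z => (fderiv ℝ F (a • Z)).comp
      (smulEquiv (m := m) a ha : EuclideanSpace ℂ (Fin m) →L[ℝ] EuclideanSpace ℂ (Fin m))) =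
      fderiv ℝ F := by
    ext Z V
    exact fderiv_smul_smul hF ha Z V
  have h2 : HasFDerivAt (fun Z : EuclideanSpace ℂ (Fin m) => fderiv ℝ F (a • Z))
      ((fderiv ℝ (fderiv ℝ F) (a • Z)).comp
        (smulEquiv (m := m) a ha : EuclideanSpace ℂ (Fin m) →L[ℝ] EuclideanSpace ℂ (Fin m))) Z :=
    hd.hasFDerivAt.comp Z (smulEquiv (m := m) a ha).hasFDerivAt
  have h3 := h2.clm_comp (hasFDerivAt_const
    (smulEquiv (m := m) a ha : EuclideanSpace ℂ (Fin m) →L[ℝ] EuclideanSpace ℂ (Fin m)) Z)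
  rw [h1] at h3
  rw [h3.fderiv]
  simp
  rfl

theorem laplacian_smul_of_homogeneous (hF : ∀ a : ℂ, a ≠ 0 → ∀ Z, F (a • Z) = F Z) {a : ℂ}
    (ha : a ≠ 0) (Z : EuclideanSpace ℂ (Fin m))
    (hd : DifferentiableAt ℝ (fderiv ℝ F) (a • Z)) :
    ‖a‖ ^ 2 * (Δ F) (a • Z) = (Δ F) Z := by
  have hr : 0 < ‖a‖ := norm_pos_iff.2 ha
  have hφ : ‖a / ‖a‖‖ = 1 := by
    rw [norm_div, Complex.norm_real, norm_norm, div_self hr.ne']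
  set b := stdOrthonormalBasis ℝ (EuclideanSpace ℂ (Fin m))
  rw [laplacian_eq_sum b F Z, laplacian_eq_sum (b.map (rotation (a / ‖a‖) hφ)) F (a • Z),
    Finset.mul_sum]
  refine Finset.sum_congr rfl fun i _ => ?_
  rw [← fderiv_fderiv_smul hF ha Z (b i) (b i) hd]
  have h1 : a • b i = ‖a‖ • (b.map (rotation (a / ‖a‖) hφ)) i := by
    change a • b i = ‖a‖ • (a / ‖a‖) • b i
    rw [← Complex.coe_smul, smul_smul, mul_div_cancel₀]
    exact_mod_cast hr.ne'
  rw [h1]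
  simp
  ring

theorem eventually_one_add_ne_zero (α : ℂ) : ∀ᶠ h : ℝ in 𝓝 0, 1 + (h : ℂ) * α ≠ 0 := by
  have h1 : Continuous fun h : ℝ => 1 + (h : ℂ) * α := by fun_prop
  exact h1.continuousAt.eventually_ne (by simp)

theorem hasDerivAt_one_add_smul (α : ℂ) (Z : EuclideanSpace ℂ (Fin m)) :
    HasDerivAt (fun h : ℝ => (1 + (h : ℂ) * α) • Z) (α • Z) 0 := by
  have h1 : HasDerivAt (fun h : ℝ => 1 + (h : ℂ) * α) α 0 := by
    simpa using ((Complex.ofRealCLM.hasDerivAt (x := (0 : ℝ))).mul_const α).const_add 1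
  exact h1.smul_const Z

/-- Euler's relation for functions invariant under complex scaling. -/
theorem fderiv_complex_smul (hF : ∀ a : ℂ, a ≠ 0 → ∀ Z, F (a • Z) = F Z)
    {Z : EuclideanSpace ℂ (Fin m)} (hd : DifferentiableAt ℝ F Z) (α : ℂ) :
    fderiv ℝ F Z (α • Z) = 0 := by
  have h1 : HasDerivAt (fun h : ℝ => F ((1 + (h : ℂ) * α) • Z)) (fderiv ℝ F Z (α • Z)) 0 := by
    have h2 : HasFDerivAt F (fderiv ℝ F Z) ((1 + ((0 : ℝ) : ℂ) * α) • Z) := by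
      simpa using hd.hasFDerivAt
    exact h2.comp_hasDerivAt 0 (hasDerivAt_one_add_smul α Z)
  have h3 : (fun h : ℝ => F ((1 + (h : ℂ) * α) • Z)) =ᶠ[𝓝 0] fun _ => F Z := by
    filter_upwards [eventually_one_add_ne_zero α] with h hh using hF _ hh Z
  exact h1.unique ((hasDerivAt_const (0 : ℝ) (F Z)).congr_of_eventuallyEq h3)

/-- Euler's relation for the derivative. -/
theorem fderiv_fderiv_complex_smul (hF : ∀ a : ℂ, a ≠ 0 → ∀ Z, F (a • Z) = F Z)
    {Z : EuclideanSpace ℂ (Fin m)} (hd : DifferentiableAt ℝ (fderiv ℝ F) Z) (α : ℂ)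
    (V : EuclideanSpace ℂ (Fin m)) :
    fderiv ℝ (fderiv ℝ F) Z (α • Z) V = -fderiv ℝ F Z (α • V) := by
  have h1 : HasDerivAt (fun h : ℝ => fderiv ℝ F ((1 + (h : ℂ) * α) • Z))
      (fderiv ℝ (fderiv ℝ F) Z (α • Z)) 0 := by
    have h2 : HasFDerivAt (fderiv ℝ F) (fderiv ℝ (fderiv ℝ F) Z)
        ((1 + ((0 : ℝ) : ℂ) * α) • Z) := by
      simpa using hd.hasFDerivAt
    exact h2.comp_hasDerivAt 0 (hasDerivAt_one_add_smul α Z)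
  have h2 := h1.clm_apply (hasDerivAt_one_add_smul α V)
  have h3 : (fun h : ℝ => fderiv ℝ F ((1 + (h : ℂ) * α) • Z) ((1 + (h : ℂ) * α) • V)) =ᶠ[𝓝 0]
      fun _ => fderiv ℝ F Z V := by
    filter_upwards [eventually_one_add_ne_zero α] with h hh using fderiv_smul_smul hF hh Z V
  have h4 := h2.unique ((hasDerivAt_const (0 : ℝ) (fderiv ℝ F Z V)).congr_of_eventuallyEq h3)
  simp at h4
  linarith

end Homogeneous

theorem insertCoord_sub (i : Fin (n + 1)) (a b : ℂ) (z w : EuclideanSpace ℂ (Fin n)) :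
    insertCoord i a z - insertCoord i b w = insertCoord i (a - b) (z - w) := by
  ext j
  rcases Fin.eq_self_or_eq_succAbove i j with rfl | ⟨k, rfl⟩ <;> simp

theorem insertCoord_complex_smul (i : Fin (n + 1)) (a b : ℂ) (z : EuclideanSpace ℂ (Fin n)) :
    b • insertCoord i a z = insertCoord i (b * a) (b • z) := by
  ext j
  rcases Fin.eq_self_or_eq_succAbove i j with rfl | ⟨k, rfl⟩ <;> simp

/-- The Laplacian on `ℂ^(n+1)` of a function invariant under complex scaling, in affine
coordinates. -/
theorem laplacian_insertCoord {F : EuclideanSpace ℂ (Fin (n + 1)) → ℝ}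
    (hF : ∀ a : ℂ, a ≠ 0 → ∀ Z, F (a • Z) = F Z) (i : Fin (n + 1)) (z : EuclideanSpace ℂ (Fin n))
    (hC : ContDiffAt ℝ 2 F (insertCoord i 1 z)) {ι : Type*} [Fintype ι]
    (b : OrthonormalBasis ι ℝ (EuclideanSpace ℂ (Fin n))) :
    (Δ F) (insertCoord i 1 z) =
      ∑ j, fderiv ℝ (fderiv ℝ F) (insertCoord i 1 z) (insertCoord i 0 (b j))
        (insertCoord i 0 (b j)) +
      fderiv ℝ (fderiv ℝ F) (insertCoord i 1 z) (insertCoord i 0 z) (insertCoord i 0 z) +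
      fderiv ℝ (fderiv ℝ F) (insertCoord i 1 z) (insertCoord i 0 (Complex.I • z))
        (insertCoord i 0 (Complex.I • z)) := by
  set Z := insertCoord i 1 z with hZ
  have hd2 : DifferentiableAt ℝ (fderiv ℝ F) Z :=
    (hC.fderiv_right (m := 1) (by norm_num)).differentiableAt (by simp)
  have hd1 : DifferentiableAt ℝ F Z := hC.differentiableAt (by simp)
  have hsymm : ∀ V W, fderiv ℝ (fderiv ℝ F) Z V W = fderiv ℝ (fderiv ℝ F) Z W V := fun V W =>
    (hC.isSymmSndFDerivAt (by simp)) V W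
  have hα : ∀ α : ℂ, fderiv ℝ (fderiv ℝ F) Z (insertCoord i α 0) (insertCoord i α 0) =
      fderiv ℝ (fderiv ℝ F) Z (insertCoord i 0 (α • z)) (insertCoord i 0 (α • z)) +
        2 * fderiv ℝ F Z (insertCoord i 0 ((α * α) • z)) := by
    intro α
    have h1 : insertCoord i α 0 = α • Z - insertCoord i 0 (α • z) := by
      rw [hZ, insertCoord_complex_smul, insertCoord_sub]
      simp
    have h2 : α • insertCoord i 0 (α • z) = insertCoord i 0 ((α * α) • z) := by
      rw [insertCoord_complex_smul, smul_smul, mul_zero]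
    rw [h1]
    simp only [map_sub, _root_.sub_apply]
    rw [hsymm (insertCoord i 0 (α • z)) (α • Z), fderiv_fderiv_complex_smul hF hd2,
      fderiv_fderiv_complex_smul hF hd2, smul_smul, fderiv_complex_smul hF hd1, h2]
    ring
  rw [laplacian_eq_sum ((Complex.orthonormalBasisOneI.prod b).map (insertCoordEquiv i)),
    Fintype.sum_sum_type, Fin.sum_univ_two]
  have e1 : ((Complex.orthonormalBasisOneI.prod b).map (insertCoordEquiv i)) (Sum.inl 0) =
      insertCoord i 1 0 := by
    simp [insertCoordEquiv_apply]
  have e2 : ((Complex.orthonormalBasisOneI.prod b).map (insertCoordEquiv i)) (Sum.inl 1) =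
      insertCoord i Complex.I 0 := by
    simp [insertCoordEquiv_apply]
  have e3 : ∀ j, ((Complex.orthonormalBasisOneI.prod b).map (insertCoordEquiv i)) (Sum.inr j) =
      insertCoord i 0 (b j) := by
    intro j
    simp [insertCoordEquiv_apply]
  simp only [e1, e2, e3, hα]
  have h5 : insertCoord i 0 ((Complex.I * Complex.I) • z) = -insertCoord i 0 ((1 * 1 : ℂ) • z) := by
    ext j
    rcases Fin.eq_self_or_eq_succAbove i j with rfl | ⟨k, rfl⟩ <;> simp
  rw [h5, map_neg, one_smul]
  ring

/-! ### The Laplace–Beltrami operator -/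

theorem inverseMetric_mul_volumeDensity (i : Fin (n + 1)) (u : EuclideanSpace ℂ (Fin n))
    (j k : Fin (Module.finrank ℝ (EuclideanSpace ℂ (Fin n)))) :
    (RiemannianGeometry.metricMatrix (affineChart i) u)⁻¹ j k *
      RiemannianGeometry.volumeDensity (affineChart i) u =
    ((1 + ‖u‖ ^ 2) ^ n)⁻¹ * ((if j = k then 1 else 0) +
      (⟪stdOrthonormalBasis ℝ _ j, u⟫_ℝ * ⟪stdOrthonormalBasis ℝ _ k, u⟫_ℝ +
        ⟪stdOrthonormalBasis ℝ _ j, Complex.I • u⟫_ℝ *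
          ⟪stdOrthonormalBasis ℝ _ k, Complex.I • u⟫_ℝ)) := by
  have hu : 1 + ‖u‖ ^ 2 ≠ 0 := by positivity
  rw [metricMatrix_inv, volumeDensity_eq]
  simp only [Matrix.smul_apply, Matrix.add_apply, Matrix.one_apply, Matrix.mul_apply,
    Fin.sum_univ_two, Matrix.transpose_apply, coordColumns, Matrix.of_apply, smul_eq_mul,
    Matrix.cons_val_zero, Matrix.cons_val_one]
  rw [pow_succ]
  field_simp
  ring

theorem inv_pow_sq_mul {x : ℝ} (m : ℕ) (hx : x ≠ 0) :
    ((x ^ m) ^ 2)⁻¹ * (m * x ^ (m - 1)) = m * (x ^ (m + 1))⁻¹ := by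
  rcases m with _ | m
  · simp
  · simp only [Nat.add_sub_cancel]
    field_simp
    ring

/-- The divergence `∑_ij ∂_j (g^{ij} √g ∂_i f)` in affine coordinates. All terms of first order
cancel. -/
theorem sum_fderiv_inverseMetric (i : Fin (n + 1)) {f : EuclideanSpace ℂ (Fin n) → ℝ}
    {z : EuclideanSpace ℂ (Fin n)} (hf : ContDiffAt ℝ 2 f z) :
    ∑ j, ∑ k, fderiv ℝ (fun u => (RiemannianGeometry.metricMatrix (affineChart i) u)⁻¹ j k *
      RiemannianGeometry.volumeDensity (affineChart i) u *
        fderiv ℝ f u (stdOrthonormalBasis ℝ _ j)) z (stdOrthonormalBasis ℝ _ k) =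
    ((1 + ‖z‖ ^ 2) ^ n)⁻¹ *
      (∑ k, fderiv ℝ (fderiv ℝ f) z (stdOrthonormalBasis ℝ _ k) (stdOrthonormalBasis ℝ _ k) +
        fderiv ℝ (fderiv ℝ f) z z z +
        fderiv ℝ (fderiv ℝ f) z (Complex.I • z) (Complex.I • z)) := by
  set b := stdOrthonormalBasis ℝ (EuclideanSpace ℂ (Fin n)) with hb
  set J : EuclideanSpace ℂ (Fin n) →L[ℝ] EuclideanSpace ℂ (Fin n) :=
    (smulEquiv (m := n) Complex.I Complex.I_ne_zero :
      EuclideanSpace ℂ (Fin n) →L[ℝ] EuclideanSpace ℂ (Fin n)) with hJ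
  have hJv : ∀ v, Complex.I • v = J v := fun v => rfl
  have hJJ : ∀ v, J (J v) = -v := fun v => by
    rw [← hJv, ← hJv, smul_smul, Complex.I_mul_I, neg_one_smul]
  have hvJ : ∀ v, ⟪v, J v⟫_ℝ = 0 := real_inner_I_smul_self
  have hdf : HasFDerivAt (fderiv ℝ f) (fderiv ℝ (fderiv ℝ f) z) z :=
    ((hf.fderiv_right (m := 1) (by norm_num)).differentiableAt (by simp)).hasFDerivAt
  have hz : (1 + ‖z‖ ^ 2) ≠ 0 := by positivity
  set κ' : EuclideanSpace ℂ (Fin n) →L[ℝ] ℝ :=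
    (-(2 * (n : ℝ) * ((1 + ‖z‖ ^ 2) ^ (n + 1))⁻¹) : ℝ) • innerSL ℝ z with hκ'
  have hκ : HasFDerivAt (fun u : EuclideanSpace ℂ (Fin n) => ((1 + ‖u‖ ^ 2) ^ n)⁻¹) κ' z := by
    have h1 : HasFDerivAt (fun u : EuclideanSpace ℂ (Fin n) => 1 + ‖u‖ ^ 2) (2 • innerSL ℝ z) z :=
      (hasStrictFDerivAt_norm_sq z).hasFDerivAt.const_add 1
    have h2 := (h1.pow n)
    have h3 := (hasDerivAt_inv (pow_ne_zero n hz)).comp_hasFDerivAt z h2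
    refine h3.congr_fderiv ?_
    rw [hκ']
    ext v
    simp only [_root_.smul_apply, smul_eq_mul, nsmul_eq_mul, Nat.cast_ofNat, innerSL_apply_apply]
    linear_combination (-2 * ⟪z, v⟫_ℝ) * inv_pow_sq_mul n hz
  have hin : ∀ v : EuclideanSpace ℂ (Fin n), HasFDerivAt (fun u => ⟪v, u⟫_ℝ) (innerSL ℝ v) z :=
    fun v => (innerSL ℝ v).hasFDerivAt
  have hinJ : ∀ v : EuclideanSpace ℂ (Fin n),
      HasFDerivAt (fun u => ⟪v, J u⟫_ℝ) ((innerSL ℝ v).comp J) z :=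
    fun v => ((innerSL ℝ v).comp J).hasFDerivAt
  have hdfc : ∀ v, HasFDerivAt (fun u => fderiv ℝ f u v)
      ((fderiv ℝ (fderiv ℝ f) z).flip v) z := fun v => by
    refine (hdf.clm_apply (hasFDerivAt_const v z)).congr_fderiv ?_
    ext w
    simp
  have hterm : ∀ j k, DifferentiableAt ℝ
      (fun u => (RiemannianGeometry.metricMatrix (affineChart i) u)⁻¹ j k *
        RiemannianGeometry.volumeDensity (affineChart i) u * fderiv ℝ f u (b j)) z := by
    intro j k
    simp only [inverseMetric_mul_volumeDensity, hJv]
    exact (hκ.differentiableAt.mul ((((hin _).differentiableAt.mul (hin _).differentiableAt).add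
      ((hinJ _).differentiableAt.mul (hinJ _).differentiableAt)).const_add _)).mul
      (hdfc _).differentiableAt
  rw [Finset.sum_comm]
  -- the `k`-th component of the vector field `√g ∇f` is `(1+|u|²)^(-n)` times
  -- `∂_k f + u_k df(u) + (i u)_k df(i u)`
  have hcol : ∀ k, ∑ j, fderiv ℝ (fun u => (RiemannianGeometry.metricMatrix (affineChart i) u)⁻¹ j k
      * RiemannianGeometry.volumeDensity (affineChart i) u * fderiv ℝ f u (b j)) z (b k) =
      κ' (b k) * (fderiv ℝ f z (b k) + (⟪b k, z⟫_ℝ * fderiv ℝ f z z +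
        ⟪b k, J z⟫_ℝ * fderiv ℝ f z (J z))) + ((1 + ‖z‖ ^ 2) ^ n)⁻¹ *
      (fderiv ℝ (fderiv ℝ f) z (b k) (b k) + (fderiv ℝ f z z +
        ⟪b k, z⟫_ℝ * (fderiv ℝ (fderiv ℝ f) z (b k) z + fderiv ℝ f z (b k)) +
        ⟪b k, J z⟫_ℝ * (fderiv ℝ (fderiv ℝ f) z (b k) (J z) + fderiv ℝ f z (J (b k))))) := by
    intro k
    have h1 : ∑ j, fderiv ℝ (fun u => (RiemannianGeometry.metricMatrix (affineChart i) u)⁻¹ j k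
      * RiemannianGeometry.volumeDensity (affineChart i) u * fderiv ℝ f u (b j)) z =
        fderiv ℝ (fun u => ∑ j, (RiemannianGeometry.metricMatrix (affineChart i) u)⁻¹ j k
      * RiemannianGeometry.volumeDensity (affineChart i) u * fderiv ℝ f u (b j)) z :=
      (fderiv_fun_sum fun j _ => hterm j k).symm
    have h2 : (fun u => ∑ j, (RiemannianGeometry.metricMatrix (affineChart i) u)⁻¹ j k
      * RiemannianGeometry.volumeDensity (affineChart i) u * fderiv ℝ f u (b j)) =
        fun u => ((1 + ‖u‖ ^ 2) ^ n)⁻¹ * (fderiv ℝ f u (b k) + (⟪b k, u⟫_ℝ * fderiv ℝ f u u +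
        ⟪b k, J u⟫_ℝ * fderiv ℝ f u (J u))) := by
      funext u
      have h3 : ∀ v, fderiv ℝ f u v = ∑ j, ⟪b j, v⟫_ℝ * fderiv ℝ f u (b j) := by
        intro v
        conv_lhs => rw [← b.sum_repr' v]
        simp
      rw [h3 u, h3 (J u)]
      simp only [inverseMetric_mul_volumeDensity, hJv, mul_assoc, ← Finset.mul_sum, add_mul,
        Finset.sum_add_distrib, ite_mul, one_mul, zero_mul, Finset.sum_ite_eq', Finset.mem_univ,
        if_true]
      congr 3
      · rw [Finset.mul_sum]
        exact Finset.sum_congr rfl fun j _ => by ring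
      · rw [Finset.mul_sum]
        exact Finset.sum_congr rfl fun j _ => by ring
    have h4 := hκ.mul ((hdfc (b k)).add (((hin (b k)).mul (hdf.clm_apply (hasFDerivAt_id z))).add
      ((hinJ (b k)).mul (hdf.clm_apply J.hasFDerivAt))))
    rw [← _root_.sum_apply, h1, h2]
    refine (DFunLike.congr_fun h4.fderiv (b k)).trans ?_
    simp [hvJ]
    ring
  have hsum : ∀ (L : EuclideanSpace ℂ (Fin n) →L[ℝ] ℝ) v, ∑ k, ⟪b k, v⟫_ℝ * L (b k) = L v := by
    intro L v
    conv_rhs => rw [← b.sum_repr' v]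
    simp
  have hs1 : ∀ v w, ∑ k, ⟪b k, v⟫_ℝ * ⟪w, b k⟫_ℝ = ⟪w, v⟫_ℝ := fun v w => hsum (innerSL ℝ w) v
  rw [Finset.sum_congr rfl fun k _ => hcol k]
  have hA : ∑ k, κ' (b k) * (fderiv ℝ f z (b k) + (⟪b k, z⟫_ℝ * fderiv ℝ f z z +
        ⟪b k, J z⟫_ℝ * fderiv ℝ f z (J z))) =
        -(2 * n * ((1 + ‖z‖ ^ 2) ^ n)⁻¹) * fderiv ℝ f z z := by
    have e1 : ∀ k, κ' (b k) * (fderiv ℝ f z (b k) + (⟪b k, z⟫_ℝ * fderiv ℝ f z z +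
        ⟪b k, J z⟫_ℝ * fderiv ℝ f z (J z))) = -(2 * n * ((1 + ‖z‖ ^ 2) ^ (n + 1))⁻¹) *
        (⟪b k, z⟫_ℝ * fderiv ℝ f z (b k) + ⟪b k, z⟫_ℝ * ⟪z, b k⟫_ℝ * fderiv ℝ f z z +
          ⟪b k, J z⟫_ℝ * ⟪z, b k⟫_ℝ * fderiv ℝ f z (J z)) := by
      intro k
      rw [hκ', real_inner_comm z (b k)]
      simp only [_root_.smul_apply, smul_eq_mul, innerSL_apply_apply]
      ring
    rw [Finset.sum_congr rfl fun k _ => e1 k, ← Finset.mul_sum, Finset.sum_add_distrib,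
      Finset.sum_add_distrib, ← Finset.sum_mul, ← Finset.sum_mul, hsum, hs1, hs1, hvJ,
      real_inner_self_eq_norm_sq]
    rw [pow_succ]
    field_simp
    ring
  have hB : ∑ k, (fderiv ℝ (fderiv ℝ f) z (b k) (b k) + (fderiv ℝ f z z +
        ⟪b k, z⟫_ℝ * (fderiv ℝ (fderiv ℝ f) z (b k) z + fderiv ℝ f z (b k)) +
        ⟪b k, J z⟫_ℝ * (fderiv ℝ (fderiv ℝ f) z (b k) (J z) + fderiv ℝ f z (J (b k))))) =
        ∑ k, fderiv ℝ (fderiv ℝ f) z (b k) (b k) + fderiv ℝ (fderiv ℝ f) z z z +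
        fderiv ℝ (fderiv ℝ f) z (J z) (J z) + 2 * n * fderiv ℝ f z z := by
    have e1 := hsum ((fderiv ℝ (fderiv ℝ f) z).flip z) z
    have e2 := hsum ((fderiv ℝ (fderiv ℝ f) z).flip (J z)) (J z)
    have e3 := hsum (fderiv ℝ f z) z
    have e4 := hsum ((fderiv ℝ f z).comp J) (J z)
    simp only [ContinuousLinearMap.flip_apply, ContinuousLinearMap.comp_apply, hJJ, map_neg]
      at e1 e2 e4
    simp only [mul_add, Finset.sum_add_distrib, e1, e2, e3, e4, Finset.sum_const, Finset.card_univ,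
      Fintype.card_fin, nsmul_eq_mul, finrank_real]
    push_cast
    ring
  rw [Finset.sum_add_distrib, hA, ← Finset.mul_sum, hB]
  simp only [hJv]
  ring

/-- The Laplace–Beltrami operator of the Fubini–Study metric is, up to the factor `-|Z|²`, the flat
Laplacian of the lift to `ℂ^(n+1)`. -/
theorem laplaceBeltrami_proj {φ : ComplexProjectiveSpace n → ℝ}
    {Z : EuclideanSpace ℂ (Fin (n + 1))} (hZ : Z ≠ 0)
    (hC : ContDiffAt ℝ 2 (fun Z => φ (proj Z)) Z) :
    RiemannianGeometry.laplaceBeltrami (E := EuclideanSpace ℂ (Fin n)) φ (proj Z) =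
      -‖Z‖ ^ 2 * (Δ fun Z => φ (proj Z)) Z := by
  set F : EuclideanSpace ℂ (Fin (n + 1)) → ℝ := fun Z => φ (proj Z) with hFdef
  have hF : ∀ a : ℂ, a ≠ 0 → ∀ Z, F (a • Z) = F Z := fun a ha Z => by
    rw [hFdef]
    simp only [proj_smul ha]
  set i := chartIndex (proj Z) with hi
  have hZi : Z i ≠ 0 := (proj_mem_affineChart_source_iff hZ).1 (chartIndex_spec (proj Z))
  -- rescale `Z` to the representative with `i`-th coordinate `1`
  set a : ℂ := (Z i)⁻¹ with ha
  have ha0 : a ≠ 0 := inv_ne_zero hZi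
  set z := dehomogenize i Z with hz
  have hZa : insertCoord i 1 z = a • Z := insertCoord_one_dehomogenize hZi
  have hCa : ContDiffAt ℝ 2 F (a • Z) := by
    have h1 : F = F ∘ (smulEquiv a⁻¹ (inv_ne_zero ha0)) := by
      funext Y
      exact (hF _ (inv_ne_zero ha0) Y).symm
    rw [h1]
    refine ContDiffAt.comp (a • Z) ?_ (smulEquiv a⁻¹ (inv_ne_zero ha0)).contDiff.contDiffAt
    rwa [smulEquiv_apply, smul_smul, inv_mul_cancel₀ ha0, one_smul]
  have hlap : (Δ F) Z = ‖a‖ ^ 2 * (Δ F) (insertCoord i 1 z) := by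
    rw [hZa, laplacian_smul_of_homogeneous hF ha0 Z
      ((hCa.fderiv_right (m := 1) (by norm_num)).differentiableAt (by simp))]
  rw [← hZa] at hCa
  -- the chart expression of `φ`
  have hf : (fun w => φ ((affineChart i).symm w)) = fun w => F (insertCoord i 1 w) := by
    funext w
    rw [affineChart_symm_apply]
  have hfC : ContDiffAt ℝ 2 (fun w => F (insertCoord i 1 w)) z :=
    hCa.comp z (contDiff_infty.1 (contDiff_insertCoord i 1) 2).contDiffAt
  have hchart : RiemannianGeometry.laplaceBeltrami (E := EuclideanSpace ℂ (Fin n)) φ (proj Z) =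
      -(1 / RiemannianGeometry.volumeDensity (affineChart i) z) *
      ∑ j, ∑ k, fderiv ℝ (fun u => (RiemannianGeometry.metricMatrix (affineChart i) u)⁻¹ j k *
      RiemannianGeometry.volumeDensity (affineChart i) u *
        fderiv ℝ (fun w => F (insertCoord i 1 w)) u (stdOrthonormalBasis ℝ _ j)) z
        (stdOrthonormalBasis ℝ _ k) := by
    rw [← hf, hz, ← affineChart_proj hZ]
    rfl
  -- derivatives of the chart expression in terms of those of `F`
  have hev : ∀ᶠ w in 𝓝 z, ∀ v, fderiv ℝ (fun w => F (insertCoord i 1 w)) w v =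
      fderiv ℝ F (insertCoord i 1 w) (insertCoord i 0 v) := by
    have h1 : ∀ᶠ Y in 𝓝 (insertCoord i 1 z), DifferentiableAt ℝ F Y := by
      filter_upwards [hCa.eventually (by simp)] with Y hY using hY.differentiableAt (by simp)
    filter_upwards [(contDiff_insertCoord i 1).continuous.continuousAt.eventually h1] with w hw v
    obtain ⟨T, hT, hT'⟩ := hasFDerivAt_insertCoord i 1 w
    rw [← hT' v, (show HasFDerivAt (fun w => F (insertCoord i 1 w)) _ w from
      hw.hasFDerivAt.comp w hT).fderiv]
    rfl
  have hD2 : ∀ v v', fderiv ℝ (fderiv ℝ (fun w => F (insertCoord i 1 w))) z v v' =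
      fderiv ℝ (fderiv ℝ F) (insertCoord i 1 z) (insertCoord i 0 v) (insertCoord i 0 v') := by
    intro v v'
    obtain ⟨T, hT, hT'⟩ := hasFDerivAt_insertCoord i 1 z
    have h1 : HasFDerivAt (fderiv ℝ F) _ (insertCoord i 1 z) :=
      ((hCa.fderiv_right (m := 1) (by norm_num)).differentiableAt (by simp)).hasFDerivAt
    have h2 := (h1.comp z hT).clm_apply (hasFDerivAt_const (insertCoord i 0 v') z)
    have h3 : (fun w => fderiv ℝ (fun w => F (insertCoord i 1 w)) w v') =ᶠ[𝓝 z] fun w =>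
        (fderiv ℝ F ∘ fun w => insertCoord i 1 w) w (insertCoord i 0 v') := by
      filter_upwards [hev] with w hw using hw v'
    have h4 : HasFDerivAt (fderiv ℝ (fun w => F (insertCoord i 1 w))) _ z :=
      ((hfC.fderiv_right (m := 1) (by norm_num)).differentiableAt (by simp)).hasFDerivAt
    have h5 := h4.clm_apply (hasFDerivAt_const v' z)
    have h6 := DFunLike.congr_fun (h5.unique (h2.congr_of_eventuallyEq h3)) v
    simpa [hT'] using h6
  rw [hchart, sum_fderiv_inverseMetric i hfC, volumeDensity_eq, hlap,
    laplacian_insertCoord hF i z hCa (stdOrthonormalBasis ℝ _)]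
  simp only [hD2]
  have hn : ‖a‖ ^ 2 * ‖Z‖ ^ 2 = 1 + ‖z‖ ^ 2 := by
    rw [← mul_pow, ← norm_smul, ← hZa, norm_insertCoord_sq, norm_one, one_pow]
  have h1 : 1 + ‖z‖ ^ 2 ≠ 0 := by positivity
  rw [neg_mul ((‖Z‖) ^ 2), ← mul_assoc (‖Z‖ ^ 2), mul_comm (‖Z‖ ^ 2), hn, pow_succ, ← mul_assoc]
  have h2 : -(1 / ((1 + ‖z‖ ^ 2) ^ n * (1 + ‖z‖ ^ 2))⁻¹) * ((1 + ‖z‖ ^ 2) ^ n)⁻¹ =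
      -(1 + ‖z‖ ^ 2) := by
    field_simp
  rw [h2, neg_mul]

/-! ### Self-adjointness of the Laplace–Beltrami operator -/

/-- The cut-off function `|Z|² w(|Z|²)` on `ℂ^m`, where `w` is `weight`. It is radial, smooth and
supported in an annulus around the origin. -/
def cutoff {m : ℕ} (Z : EuclideanSpace ℂ (Fin m)) : ℝ := ‖Z‖ ^ 2 * weight (‖Z‖ ^ 2)

theorem contDiff_cutoff {m : ℕ} : ContDiff ℝ 2 (cutoff (m := m)) :=
  (contDiff_norm_sq ℝ).mul ((contDiff_infty.1 contDiff_weight 2).comp (contDiff_norm_sq ℝ))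

theorem hasCompactSupport_cutoff {m : ℕ} : HasCompactSupport (cutoff (m := m)) :=
  hasCompactSupport_weight_norm.mul_left

theorem zero_notMem_tsupport_cutoff {m : ℕ} :
    (0 : EuclideanSpace ℂ (Fin m)) ∉ tsupport (cutoff (m := m)) := by
  rw [notMem_tsupport_iff_eventuallyEq]
  filter_upwards [Metric.ball_mem_nhds 0 one_pos] with Z hZ
  have : ‖Z‖ < 1 := by simpa using hZ
  rw [cutoff, weight_eq_zero (Or.inl (by nlinarith [norm_nonneg Z])), mul_zero, Pi.zero_apply]

/-- The gradient of the cut-off function is radial. -/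
theorem exists_fderiv_cutoff {m : ℕ} (Z : EuclideanSpace ℂ (Fin m)) :
    ∃ c : ℝ, ∀ V, fderiv ℝ cutoff Z V = c * ⟪Z, V⟫_ℝ := by
  have h1 : HasFDerivAt (fun u : EuclideanSpace ℂ (Fin m) => ‖u‖ ^ 2) (2 • innerSL ℝ Z) Z :=
    (hasStrictFDerivAt_norm_sq Z).hasFDerivAt
  have h2 : DifferentiableAt ℝ (fun t => t * weight t) (‖Z‖ ^ 2) :=
    (contDiff_id.mul (contDiff_infty.1 contDiff_weight 1)).differentiable (by simp) _
  have h3 : HasFDerivAt (cutoff (m := m))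
      (deriv (fun t => t * weight t) (‖Z‖ ^ 2) • (2 • innerSL ℝ Z)) Z :=
    HasDerivAt.comp_hasFDerivAt (h₂ := fun t => t * weight t) Z h2.hasDerivAt h1
  refine ⟨deriv (fun t => t * weight t) (‖Z‖ ^ 2) * 2, fun V => ?_⟩
  rw [h3.fderiv]
  simp
  ring

/-- As `f` vanishes near the origin, `f` and `g` only have to be continuous away from it. -/
theorem integrable_mul_of_tsupport {m : ℕ} {f g : EuclideanSpace ℂ (Fin m) → ℝ}
    (hf : ContinuousOn f {0}ᶜ) (hg : ContinuousOn g {0}ᶜ) (hc : HasCompactSupport f)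
    (h0 : 0 ∉ tsupport f) : Integrable (fun Z => f Z * g Z) := by
  refine Continuous.integrable_of_hasCompactSupport ?_ hc.mul_right
  exact (hf.mul hg).continuous_of_tsupport_subset isOpen_compl_singleton
    ((tsupport_mul_subset_left (f := f) (g := g)).trans
      (subset_compl_singleton_iff.2 h0))

section Green

variable {m : ℕ} {F Ψ : EuclideanSpace ℂ (Fin m) → ℝ}

theorem continuousOn_fderiv_of_contDiffAt (hF : ∀ Z ≠ 0, ContDiffAt ℝ 2 F Z)
    (v : EuclideanSpace ℂ (Fin m)) : ContinuousOn (fun Z => fderiv ℝ F Z v) {0}ᶜ :=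
  fun Z hZ => (((hF Z hZ).fderiv_right (m := 1) (by norm_num)).continuousAt.clm_apply
    continuousAt_const).continuousWithinAt

theorem continuousOn_fderiv_fderiv_of_contDiffAt (hF : ∀ Z ≠ 0, ContDiffAt ℝ 2 F Z)
    (v w : EuclideanSpace ℂ (Fin m)) :
    ContinuousOn (fun Z => fderiv ℝ (fderiv ℝ F) Z v w) {0}ᶜ :=
  fun Z hZ => (((((hF Z hZ).fderiv_right (m := 1) (by norm_num)).fderiv_right (m := 0)
    (by norm_num)).continuousAt.clm_apply continuousAt_const).clm_apply
    continuousAt_const).continuousWithinAt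

theorem continuousOn_laplacian (hF : ∀ Z ≠ 0, ContDiffAt ℝ 2 F Z) :
    ContinuousOn (Δ F) {0}ᶜ := by
  rw [show Δ F = _ from funext (laplacian_eq_sum (stdOrthonormalBasis ℝ _) F)]
  exact continuousOn_finsetSum _ fun i _ => continuousOn_fderiv_fderiv_of_contDiffAt hF _ _

/-- Green's first identity with the radial cut-off. The derivative of the cut-off does not
contribute, since the gradient of `F` is orthogonal to the radial direction. -/
theorem integral_cutoff_mul_laplacian (hF : ∀ Z ≠ 0, ContDiffAt ℝ 2 F Z)
    (hΨ : ∀ Z ≠ 0, ContDiffAt ℝ 2 Ψ Z) (hE : ∀ Z ≠ 0, fderiv ℝ F Z Z = 0) :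
    ∫ Z, cutoff Z * (Ψ Z * (Δ F) Z) = -∫ Z, cutoff Z *
      ∑ i, fderiv ℝ Ψ Z (stdOrthonormalBasis ℝ (EuclideanSpace ℂ (Fin m)) i) *
        fderiv ℝ F Z (stdOrthonormalBasis ℝ (EuclideanSpace ℂ (Fin m)) i) := by
  set b := stdOrthonormalBasis ℝ (EuclideanSpace ℂ (Fin m))
  have hω : ∀ Z ≠ 0, ContDiffAt ℝ 2 (fun Z => cutoff Z * Ψ Z) Z := fun Z hZ =>
    contDiff_cutoff.contDiffAt.mul (hΨ Z hZ)
  have hωc : ContinuousOn (fun Z => cutoff Z * Ψ Z) {0}ᶜ := fun Z hZ =>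
    (hω Z hZ).continuousAt.continuousWithinAt
  have hωs : HasCompactSupport (fun Z => cutoff Z * Ψ Z) := hasCompactSupport_cutoff.mul_right
  have hω0 : (0 : EuclideanSpace ℂ (Fin m)) ∉ tsupport (fun Z => cutoff Z * Ψ Z) := fun h =>
    zero_notMem_tsupport_cutoff (tsupport_mul_subset_left (f := cutoff) (g := Ψ) h)
  have hωs' : ∀ v, HasCompactSupport (fun Z => fderiv ℝ (fun Z => cutoff Z * Ψ Z) Z v) :=
    fun v => hωs.fderiv_apply (𝕜 := ℝ) v
  have hω0' : ∀ v, (0 : EuclideanSpace ℂ (Fin m)) ∉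
      tsupport (fun Z => fderiv ℝ (fun Z => cutoff Z * Ψ Z) Z v) := fun v h =>
    hω0 (tsupport_fderiv_apply_subset ℝ v h)
  have hFc : ∀ v, ContinuousOn (fun Z => fderiv ℝ F Z v) {0}ᶜ :=
    continuousOn_fderiv_of_contDiffAt hF
  have hD : ∀ v Z, fderiv ℝ (fun Z => fderiv ℝ F Z v) Z v * (cutoff Z * Ψ Z) =
      fderiv ℝ (fderiv ℝ F) Z v v * (cutoff Z * Ψ Z) := by
    intro v Z
    by_cases hZ : Z = 0
    · have : cutoff Z = 0 := by
        rw [hZ]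
        exact image_eq_zero_of_notMem_tsupport zero_notMem_tsupport_cutoff
      simp [this]
    · have h1 : HasFDerivAt (fderiv ℝ F) _ Z :=
        (((hF Z hZ).fderiv_right (m := 1) (by norm_num)).differentiableAt (by simp)).hasFDerivAt
      rw [(h1.clm_apply (hasFDerivAt_const v Z)).fderiv]
      simp
  have hparts : ∀ v, ∫ Z, (cutoff Z * Ψ Z) * fderiv ℝ (fderiv ℝ F) Z v v =
      -∫ Z, fderiv ℝ (fun Z => cutoff Z * Ψ Z) Z v * fderiv ℝ F Z v := by
    intro v
    have h2 : Integrable fun Z => (cutoff Z * Ψ Z) * fderiv ℝ (fderiv ℝ F) Z v v :=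
      integrable_mul_of_tsupport hωc (continuousOn_fderiv_fderiv_of_contDiffAt hF v v) hωs hω0
    have h := integral_mul_fderiv_eq_neg_fderiv_mul_of_integrable (𝕜 := ℝ) (v := v)
      (f := fun Z => cutoff Z * Ψ Z) (g := fun Z => fderiv ℝ F Z v) (μ := volume)
      (integrable_mul_of_tsupport (continuousOn_fderiv_of_contDiffAt hω v) (hFc v) (hωs' v)
        (hω0' v))
      ?_ (integrable_mul_of_tsupport hωc (hFc v) hωs hω0) ?_ ?_
    · rw [← h]
      refine integral_congr_ae (ae_of_all _ fun Z => ?_)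
      simpa only [mul_comm] using (hD v Z).symm
    · refine h2.congr (ae_of_all _ fun Z => ?_)
      simpa only [mul_comm] using (hD v Z).symm
    · intro Z _
      by_cases hZ : Z = 0
      · rw [hZ]
        exact (differentiableAt_const (0 : ℝ)).congr_of_eventuallyEq
          (notMem_tsupport_iff_eventuallyEq.1 hω0)
      · exact (hω Z hZ).differentiableAt (by simp)
    · intro Z hZ
      have hZ0 : Z ≠ 0 := fun h => hω0 (h ▸ hZ)
      exact ((((hF Z hZ0).fderiv_right (m := 1) (by norm_num)).differentiableAt
        (by simp)).clm_apply (differentiableAt_const v))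
  calc ∫ Z, cutoff Z * (Ψ Z * (Δ F) Z)
      = ∫ Z, ∑ i, (cutoff Z * Ψ Z) * fderiv ℝ (fderiv ℝ F) Z (b i) (b i) := by
        refine integral_congr_ae (ae_of_all _ fun Z => ?_)
        simp only [laplacian_eq_sum b, ← Finset.mul_sum, mul_assoc]
    _ = ∑ i, ∫ Z, (cutoff Z * Ψ Z) * fderiv ℝ (fderiv ℝ F) Z (b i) (b i) :=
        integral_finsetSum _ fun i _ => integrable_mul_of_tsupport hωc
          (continuousOn_fderiv_fderiv_of_contDiffAt hF _ _) hωs hω0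
    _ = -∑ i, ∫ Z, fderiv ℝ (fun Z => cutoff Z * Ψ Z) Z (b i) * fderiv ℝ F Z (b i) := by
        simp only [hparts, Finset.sum_neg_distrib]
    _ = -∫ Z, ∑ i, fderiv ℝ (fun Z => cutoff Z * Ψ Z) Z (b i) * fderiv ℝ F Z (b i) := by
        rw [integral_finsetSum _ fun i _ => integrable_mul_of_tsupport
          (continuousOn_fderiv_of_contDiffAt hω _) (hFc _) (hωs' _) (hω0' _)]
    _ = _ := by
        congr 1
        refine integral_congr_ae (ae_of_all _ fun Z => ?_)
        dsimp only
        by_cases hZ : Z = 0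
        · have h1 : ∀ v, fderiv ℝ (fun Z => cutoff Z * Ψ Z) Z v = 0 := fun v => by
            rw [hZ]
            exact image_eq_zero_of_notMem_tsupport
              (f := fun Z => fderiv ℝ (fun Z => cutoff Z * Ψ Z) Z v) (hω0' v)
          have h2 : cutoff Z = 0 := by
            rw [hZ]
            exact image_eq_zero_of_notMem_tsupport zero_notMem_tsupport_cutoff
          simp only [h1, h2, zero_mul, Finset.sum_const_zero]
        · obtain ⟨c, hc⟩ := exists_fderiv_cutoff Z
          have h1 : HasFDerivAt (fun Z => cutoff Z * Ψ Z) _ Z :=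
            (contDiff_cutoff.differentiable (by simp) Z).hasFDerivAt.mul
              ((hΨ Z hZ).differentiableAt (by simp)).hasFDerivAt
          have h2 : ∑ i, ⟪Z, b i⟫_ℝ * fderiv ℝ F Z (b i) = 0 := by
            rw [← hE Z hZ]
            conv_rhs => enter [2]; rw [← b.sum_repr' Z]
            rw [map_sum]
            simp only [map_smul, smul_eq_mul, real_inner_comm]
          rw [h1.fderiv]
          simp only [_root_.add_apply, _root_.smul_apply, smul_eq_mul, hc, add_mul,
            Finset.sum_add_distrib, Finset.mul_sum]
          have h3 : ∑ i, Ψ Z * (c * ⟪Z, b i⟫_ℝ) * fderiv ℝ F Z (b i) = 0 := by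
            rw [← mul_zero (Ψ Z * c), ← h2, Finset.mul_sum]
            exact Finset.sum_congr rfl fun i _ => by ring
          rw [h3, add_zero]
          exact Finset.sum_congr rfl fun i _ => by ring

end Green

/-- Integration over `ℂP^n` as an integral over `ℂ^(n+1)`. -/
theorem integral_riemannianVolume {f : ComplexProjectiveSpace n → ℝ} (hf : Measurable f) :
    ∫ q, f q ∂(RiemannianGeometry.riemannianVolume (EuclideanSpace ℂ (Fin n))
      (ComplexProjectiveSpace n)) =
    (weightConst n (fun t => ENNReal.ofReal (weight t)))⁻¹.toReal *
      ∫ Z, weight (‖Z‖ ^ 2) * f (proj Z) := by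
  rw [riemannianVolume_eq, integral_smul_measure, smul_eq_mul,
    integral_map measurable_proj.aemeasurable hf.aestronglyMeasurable, weightedVolume,
    integral_withDensity_eq_integral_toReal_smul (by
      exact (measurable_weight.comp (by fun_prop : Measurable fun Z : EuclideanSpace ℂ (Fin (n + 1))
        => ‖Z‖ ^ 2))) (ae_of_all _ fun _ => ENNReal.ofReal_lt_top)]
  simp only [ENNReal.toReal_ofReal (weight_nonneg _), smul_eq_mul]

instance : IsFiniteMeasure (RiemannianGeometry.riemannianVolume (EuclideanSpace ℂ (Fin n))
    (ComplexProjectiveSpace n)) := by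
  have h : IsFiniteMeasure (weightedVolume n) := by
    refine isFiniteMeasure_withDensity_ofReal ?_
    exact (continuous_weight_norm.integrable_of_hasCompactSupport
      hasCompactSupport_weight_norm).hasFiniteIntegral
  rw [riemannianVolume_eq]
  exact Measure.smul_finite _ (ENNReal.inv_ne_top.2 weightConst_ne_zero)

theorem continuous_laplaceBeltrami {φ : ComplexProjectiveSpace n → ℝ}
    (hφ : ∀ Z ≠ 0, ContDiffAt ℝ 2 (fun Z => φ (proj Z)) Z) :
    Continuous (RiemannianGeometry.laplaceBeltrami (E := EuclideanSpace ℂ (Fin n)) φ) := by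
  refine continuous_of_comp_proj ?_
  have h : ContinuousOn (fun Z => -‖Z‖ ^ 2 * (Δ fun Z => φ (proj Z)) Z)
      ({0}ᶜ : Set (EuclideanSpace ℂ (Fin (n + 1)))) :=
    ContinuousOn.mul (by fun_prop) (continuousOn_laplacian hφ)
  exact h.congr fun Z hZ => laplaceBeltrami_proj hZ (hφ Z hZ)

theorem continuous_of_contDiffAt_proj {φ : ComplexProjectiveSpace n → ℝ}
    (hφ : ∀ Z ≠ 0, ContDiffAt ℝ 2 (fun Z => φ (proj Z)) Z) : Continuous φ :=
  continuous_of_comp_proj fun Z hZ => (hφ Z hZ).continuousAt.continuousWithinAt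

/-- The Dirichlet form of the Laplace–Beltrami operator, as an integral over `ℂ^(n+1)`. -/
theorem integral_mul_laplaceBeltrami {φ ψ : ComplexProjectiveSpace n → ℝ}
    (hφ : ∀ Z ≠ 0, ContDiffAt ℝ 2 (fun Z => φ (proj Z)) Z)
    (hψ : ∀ Z ≠ 0, ContDiffAt ℝ 2 (fun Z => ψ (proj Z)) Z) :
    ∫ q, ψ q * RiemannianGeometry.laplaceBeltrami (E := EuclideanSpace ℂ (Fin n)) φ q
      ∂(RiemannianGeometry.riemannianVolume (EuclideanSpace ℂ (Fin n))
      (ComplexProjectiveSpace n)) =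
    (weightConst n (fun t => ENNReal.ofReal (weight t)))⁻¹.toReal * ∫ Z, cutoff Z *
      ∑ i, fderiv ℝ (fun Z => ψ (proj Z)) Z
          (stdOrthonormalBasis ℝ (EuclideanSpace ℂ (Fin (n + 1))) i) *
        fderiv ℝ (fun Z => φ (proj Z)) Z
          (stdOrthonormalBasis ℝ (EuclideanSpace ℂ (Fin (n + 1))) i) := by
  rw [integral_riemannianVolume (f := fun q => ψ q *
    RiemannianGeometry.laplaceBeltrami (E := EuclideanSpace ℂ (Fin n)) φ q)
    ((continuous_of_contDiffAt_proj hψ).mul (continuous_laplaceBeltrami hφ)).measurable]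
  congr 1
  rw [← neg_neg (∫ Z, cutoff Z * _), ← integral_cutoff_mul_laplacian hφ hψ, ← integral_neg]
  · refine integral_congr_ae (ae_of_all _ fun Z => ?_)
    dsimp only
    by_cases hZ : Z = 0
    · rw [weight_eq_zero (Or.inl (by simp [hZ])), cutoff,
        weight_eq_zero (Or.inl (by simp [hZ]))]
      ring
    · rw [laplaceBeltrami_proj hZ (hφ Z hZ), cutoff]
      ring
  · intro Z hZ
    have h := fderiv_complex_smul (F := fun Z => φ (proj Z))
      (fun a ha Z => by rw [proj_smul ha]) ((hφ Z hZ).differentiableAt (by simp)) 1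
    rwa [one_smul] at h

/-- The Laplace–Beltrami operator is symmetric. -/
theorem integral_mul_laplaceBeltrami_comm {φ ψ : ComplexProjectiveSpace n → ℝ}
    (hφ : ∀ Z ≠ 0, ContDiffAt ℝ 2 (fun Z => φ (proj Z)) Z)
    (hψ : ∀ Z ≠ 0, ContDiffAt ℝ 2 (fun Z => ψ (proj Z)) Z) :
    ∫ q, ψ q * RiemannianGeometry.laplaceBeltrami (E := EuclideanSpace ℂ (Fin n)) φ q
      ∂(RiemannianGeometry.riemannianVolume (EuclideanSpace ℂ (Fin n))
      (ComplexProjectiveSpace n)) =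
    ∫ q, φ q * RiemannianGeometry.laplaceBeltrami (E := EuclideanSpace ℂ (Fin n)) ψ q
      ∂(RiemannianGeometry.riemannianVolume (EuclideanSpace ℂ (Fin n))
      (ComplexProjectiveSpace n)) := by
  rw [integral_mul_laplaceBeltrami hφ hψ, integral_mul_laplaceBeltrami hψ hφ]
  simp only [mul_comm (fderiv ℝ (fun Z => φ (proj Z)) _ _)]

theorem contDiffAt_proj_of_contMDiff {φ : ComplexProjectiveSpace n → ℝ}
    (hφ : ContMDiff 𝓘(ℝ, EuclideanSpace ℂ (Fin n)) 𝓘(ℝ, ℝ) 2 φ) :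
    ∀ Z ≠ 0, ContDiffAt ℝ 2 (fun Z => φ (proj Z)) Z := fun Z hZ =>
  (hφ.contMDiffAt.comp Z ((contMDiffAt_proj hZ).of_le 
    (mod_cast le_top : ((2 : ℕ∞) : WithTop ℕ∞) ≤ ∞))).contDiffAt

/-! ### The Laplacian of radial functions -/

section Radial

variable {m : ℕ} {P Z : EuclideanSpace ℂ (Fin m)}

theorem norm_inner_sq (P Z : EuclideanSpace ℂ (Fin m)) :
    ‖⟪P, Z⟫_ℂ‖ ^ 2 = ⟪P, Z⟫_ℝ ^ 2 + ⟪Complex.I • P, Z⟫_ℝ ^ 2 := by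
  rw [← Complex.normSq_eq_norm_sq, Complex.normSq_apply, real_inner_eq_re, real_inner_eq_re,
    inner_smul_left]
  simp
  ring

/-- The derivative of `cosSq P` at `Z`, up to the factor `2 / (|P|² |Z|²)`. -/
def cosSqForm (P Z : EuclideanSpace ℂ (Fin m)) : EuclideanSpace ℂ (Fin m) →L[ℝ] ℝ :=
  ⟪P, Z⟫_ℝ • innerSL ℝ P + ⟪Complex.I • P, Z⟫_ℝ • innerSL ℝ (Complex.I • P) -
    (‖P‖ ^ 2 * cosSq P Z) • innerSL ℝ Z

theorem cosSqForm_apply (P Z V : EuclideanSpace ℂ (Fin m)) :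
    cosSqForm P Z V = ⟪P, Z⟫_ℝ * ⟪P, V⟫_ℝ + ⟪Complex.I • P, Z⟫_ℝ * ⟪Complex.I • P, V⟫_ℝ -
      ‖P‖ ^ 2 * cosSq P Z * ⟪Z, V⟫_ℝ := by
  simp [cosSqForm]

theorem norm_sq_mul_cosSq (hP : P ≠ 0) (hZ : Z ≠ 0) :
    ‖P‖ ^ 2 * cosSq P Z * ‖Z‖ ^ 2 = ⟪P, Z⟫_ℝ ^ 2 + ⟪Complex.I • P, Z⟫_ℝ ^ 2 := by
  have hP' : ‖P‖ ≠ 0 := norm_ne_zero_iff.2 hP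
  have hZ' : ‖Z‖ ≠ 0 := norm_ne_zero_iff.2 hZ
  rw [← norm_inner_sq, cosSq]
  field_simp

theorem cosSqForm_self (hP : P ≠ 0) (hZ : Z ≠ 0) : cosSqForm P Z Z = 0 := by
  rw [cosSqForm_apply, real_inner_self_eq_norm_sq, norm_sq_mul_cosSq hP hZ]
  ring

theorem hasFDerivAt_norm_sq_inv (hZ : Z ≠ 0) :
    HasFDerivAt (fun Z : EuclideanSpace ℂ (Fin m) => (‖Z‖ ^ 2)⁻¹)
      ((-2 * ((‖Z‖ ^ 2)⁻¹) ^ 2) • innerSL ℝ Z) Z := by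
  have hZ' : ‖Z‖ ≠ 0 := norm_ne_zero_iff.2 hZ
  refine ((hasDerivAt_inv (pow_ne_zero 2 hZ')).comp_hasFDerivAt Z
    (hasStrictFDerivAt_norm_sq Z).hasFDerivAt).congr_fderiv ?_
  ext V
  simp
  ring

theorem hasFDerivAt_cosSq (hP : P ≠ 0) (hZ : Z ≠ 0) :
    HasFDerivAt (cosSq P) ((2 / ‖P‖ ^ 2 * (‖Z‖ ^ 2)⁻¹) • cosSqForm P Z) Z := by
  have hP' : ‖P‖ ≠ 0 := norm_ne_zero_iff.2 hP
  have hZ' : ‖Z‖ ≠ 0 := norm_ne_zero_iff.2 hZ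
  have h1 : cosSq P = fun Z => (‖P‖ ^ 2)⁻¹ * ((⟪P, Z⟫_ℝ ^ 2 + ⟪Complex.I • P, Z⟫_ℝ ^ 2) *
      (‖Z‖ ^ 2)⁻¹) := by
    funext Z
    rw [← norm_inner_sq, cosSq]
    field_simp
  have h2 : ∀ v : EuclideanSpace ℂ (Fin m), HasFDerivAt (fun u => ⟪v, u⟫_ℝ) (innerSL ℝ v) Z :=
    fun v => (innerSL ℝ v).hasFDerivAt
  have h3 := ((((h2 P).pow 2).add ((h2 (Complex.I • P)).pow 2)).mul
    (hasFDerivAt_norm_sq_inv hZ)).const_mul (‖P‖ ^ 2)⁻¹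
  rw [h1]
  refine h3.congr_fderiv ?_
  ext V
  have h4 := norm_sq_mul_cosSq hP hZ
  simp only [_root_.smul_apply, _root_.add_apply, innerSL_apply_apply, smul_eq_mul, nsmul_eq_mul,
    cosSqForm_apply, Pi.add_apply]
  field_simp
  push_cast
  linear_combination 2 * ⟪Z, V⟫_ℝ * h4

theorem contDiffAt_cosSq_right (hP : P ≠ 0) (hZ : Z ≠ 0) : ContDiffAt ℝ ∞ (cosSq P) Z :=
  (contDiffAt_cosSq hP hZ).comp (f := fun Z => (P, Z)) Z (by fun_prop)

/-- The second derivative of `cosSq P` on the diagonal. -/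
theorem fderiv_fderiv_cosSq (hP : P ≠ 0) (hZ : Z ≠ 0) (V : EuclideanSpace ℂ (Fin m)) :
    fderiv ℝ (fderiv ℝ (cosSq P)) Z V V =
      2 / ‖P‖ ^ 2 * (-2 * ((‖Z‖ ^ 2)⁻¹) ^ 2 * ⟪Z, V⟫_ℝ * cosSqForm P Z V + (‖Z‖ ^ 2)⁻¹ *
        (⟪P, V⟫_ℝ ^ 2 + ⟪Complex.I • P, V⟫_ℝ ^ 2 -
          ‖P‖ ^ 2 * (fderiv ℝ (cosSq P) Z V * ⟪Z, V⟫_ℝ + cosSq P Z * ‖V‖ ^ 2))) := by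
  have h1 : (fun Z => fderiv ℝ (cosSq P) Z V) =ᶠ[𝓝 Z] fun Z =>
      2 / ‖P‖ ^ 2 * ((‖Z‖ ^ 2)⁻¹ * (⟪P, Z⟫_ℝ * ⟪P, V⟫_ℝ +
        ⟪Complex.I • P, Z⟫_ℝ * ⟪Complex.I • P, V⟫_ℝ - ‖P‖ ^ 2 * (cosSq P Z * ⟪V, Z⟫_ℝ))) := by
    filter_upwards [isOpen_ne.mem_nhds hZ] with Y hY
    rw [(hasFDerivAt_cosSq hP hY).fderiv, _root_.smul_apply, cosSqForm_apply,
      real_inner_comm V Y, smul_eq_mul]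
    ring
  have h2 : ∀ v : EuclideanSpace ℂ (Fin m), HasFDerivAt (fun u => ⟪v, u⟫_ℝ) (innerSL ℝ v) Z :=
    fun v => (innerSL ℝ v).hasFDerivAt
  have hc : HasFDerivAt (cosSq P) (fderiv ℝ (cosSq P) Z) Z :=
    ((contDiffAt_cosSq_right hP hZ).differentiableAt (by simp)).hasFDerivAt
  have h3 := ((hasFDerivAt_norm_sq_inv hZ).mul ((((h2 P).mul_const ⟪P, V⟫_ℝ).add
    ((h2 (Complex.I • P)).mul_const ⟪Complex.I • P, V⟫_ℝ)).sub
    ((hc.mul (h2 V)).const_mul (‖P‖ ^ 2)))).const_mul (2 / ‖P‖ ^ 2)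
  have h4 : HasFDerivAt (fderiv ℝ (cosSq P)) (fderiv ℝ (fderiv ℝ (cosSq P)) Z) Z :=
    ((((contDiffAt_cosSq_right hP hZ).fderiv_right (m := 1)
      (mod_cast le_top : ((2 : ℕ∞) : WithTop ℕ∞) ≤ ∞)).differentiableAt (by simp))).hasFDerivAt
  have h5 := DFunLike.congr_fun ((h4.clm_apply (hasFDerivAt_const V Z)).unique
    (h3.congr_of_eventuallyEq h1)) V
  simp only [ContinuousLinearMap.comp_zero, zero_add, ContinuousLinearMap.flip_apply,
    _root_.smul_apply, _root_.add_apply, _root_.sub_apply, Pi.sub_apply, Pi.add_apply,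
    Pi.mul_apply, innerSL_apply_apply, smul_eq_mul, real_inner_self_eq_norm_sq] at h5
  rw [h5, cosSqForm_apply, real_inner_comm V Z]
  ring

variable (b : OrthonormalBasis (Fin (Module.finrank ℝ (EuclideanSpace ℂ (Fin m)))) ℝ
  (EuclideanSpace ℂ (Fin m)))

theorem sum_inner_mul_apply (L : EuclideanSpace ℂ (Fin m) →L[ℝ] ℝ) (v : EuclideanSpace ℂ (Fin m)) :
    ∑ k, ⟪v, b k⟫_ℝ * L (b k) = L v := by
  conv_rhs => rw [← b.sum_repr' v]
  simp [real_inner_comm]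

theorem sum_inner_mul_inner (v w : EuclideanSpace ℂ (Fin m)) :
    ∑ k, ⟪v, b k⟫_ℝ * ⟪w, b k⟫_ℝ = ⟪w, v⟫_ℝ := sum_inner_mul_apply b (innerSL ℝ w) v

theorem sum_cosSqForm_sq (hP : P ≠ 0) (hZ : Z ≠ 0) :
    ∑ k, cosSqForm P Z (b k) ^ 2 = ‖P‖ ^ 4 * ‖Z‖ ^ 2 * (cosSq P Z * (1 - cosSq P Z)) := by
  have h1 : ∀ k, cosSqForm P Z (b k) ^ 2 = ⟪P, Z⟫_ℝ * (⟪P, b k⟫_ℝ * cosSqForm P Z (b k)) +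
      ⟪Complex.I • P, Z⟫_ℝ * (⟪Complex.I • P, b k⟫_ℝ * cosSqForm P Z (b k)) -
      ‖P‖ ^ 2 * cosSq P Z * (⟪Z, b k⟫_ℝ * cosSqForm P Z (b k)) := by
    intro k
    rw [sq]
    nth_rw 1 [cosSqForm_apply]
    ring
  simp only [h1, Finset.sum_add_distrib, Finset.sum_sub_distrib, ← Finset.mul_sum,
    sum_inner_mul_apply, cosSqForm_self hP hZ]
  rw [cosSqForm_apply, cosSqForm_apply, real_inner_comm (Complex.I • P) P,
    real_inner_comm P (Complex.I • P), real_inner_I_smul_self, real_inner_self_eq_norm_sq,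
    real_inner_self_eq_norm_sq, norm_I_smul]
  rw [real_inner_comm P Z, real_inner_comm (Complex.I • P) Z]
  linear_combination (-‖P‖ ^ 2 + ‖P‖ ^ 2 * cosSq P Z) * norm_sq_mul_cosSq hP hZ

theorem sum_fderiv_cosSq_sq (hP : P ≠ 0) (hZ : Z ≠ 0) :
    ∑ k, fderiv ℝ (cosSq P) Z (b k) ^ 2 =
      4 * (‖Z‖ ^ 2)⁻¹ * (cosSq P Z * (1 - cosSq P Z)) := by
  have hP' : ‖P‖ ≠ 0 := norm_ne_zero_iff.2 hP
  have hZ' : ‖Z‖ ≠ 0 := norm_ne_zero_iff.2 hZ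
  simp only [(hasFDerivAt_cosSq hP hZ).fderiv, _root_.smul_apply, smul_eq_mul, mul_pow,
    ← Finset.mul_sum, sum_cosSqForm_sq b hP hZ]
  field_simp
  ring

theorem laplacian_cosSq {P Z : EuclideanSpace ℂ (Fin (n + 1))} (hP : P ≠ 0) (hZ : Z ≠ 0) :
    (Δ (cosSq P)) Z = 4 * (‖Z‖ ^ 2)⁻¹ * (1 - (n + 1) * cosSq P Z) := by
  have hP' : ‖P‖ ≠ 0 := norm_ne_zero_iff.2 hP
  have hZ' : ‖Z‖ ≠ 0 := norm_ne_zero_iff.2 hZ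
  set b := stdOrthonormalBasis ℝ (EuclideanSpace ℂ (Fin (n + 1)))
  have h1 : ∑ k, ⟪Z, b k⟫_ℝ * fderiv ℝ (cosSq P) Z (b k) = 0 := by
    rw [sum_inner_mul_apply, (hasFDerivAt_cosSq hP hZ).fderiv, _root_.smul_apply,
      cosSqForm_self hP hZ, smul_zero]
  have h2 : ∀ v : EuclideanSpace ℂ (Fin (n + 1)), ∑ k, ⟪v, b k⟫_ℝ ^ 2 = ‖v‖ ^ 2 := fun v => by
    simp only [sq, sum_inner_mul_inner, real_inner_self_eq_norm_mul_norm]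
  have h3 : ∀ k, fderiv ℝ (fderiv ℝ (cosSq P)) Z (b k) (b k) =
      2 / ‖P‖ ^ 2 * (-2 * ((‖Z‖ ^ 2)⁻¹) ^ 2) * (⟪Z, b k⟫_ℝ * cosSqForm P Z (b k)) +
      2 / ‖P‖ ^ 2 * (‖Z‖ ^ 2)⁻¹ * (⟪P, b k⟫_ℝ ^ 2) +
      2 / ‖P‖ ^ 2 * (‖Z‖ ^ 2)⁻¹ * (⟪Complex.I • P, b k⟫_ℝ ^ 2) -
      2 / ‖P‖ ^ 2 * (‖Z‖ ^ 2)⁻¹ * ‖P‖ ^ 2 * (⟪Z, b k⟫_ℝ * fderiv ℝ (cosSq P) Z (b k)) -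
      2 / ‖P‖ ^ 2 * (‖Z‖ ^ 2)⁻¹ * ‖P‖ ^ 2 * cosSq P Z := by
    intro k
    rw [fderiv_fderiv_cosSq hP hZ, b.orthonormal.1 k]
    ring
  rw [laplacian_eq_sum b]
  simp only [h3, Finset.sum_add_distrib, Finset.sum_sub_distrib, ← Finset.mul_sum, h1, h2,
    sum_inner_mul_apply, cosSqForm_self hP hZ, norm_I_smul, Finset.sum_const, Finset.card_univ,
    Fintype.card_fin, finrank_real, nsmul_eq_mul]
  field_simp
  push_cast
  ring

/-- The chain rule `Δ(f ∘ u) = f''(u) |∇u|² + f'(u) Δu`. -/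
theorem laplacian_comp {f f' : ℝ → ℝ} {f'' : ℝ} {u : EuclideanSpace ℂ (Fin m) → ℝ}
    (hu : ContDiffAt ℝ 2 u Z) (hf : ∀ᶠ t in 𝓝 (u Z), HasDerivAt f (f' t) t)
    (hf' : HasDerivAt f' f'' (u Z)) :
    (Δ fun Z => f (u Z)) Z = f'' * ∑ k, fderiv ℝ u Z (b k) ^ 2 + f' (u Z) * (Δ u) Z := by
  rw [laplacian_eq_sum b, laplacian_eq_sum b, Finset.mul_sum, Finset.mul_sum,
    ← Finset.sum_add_distrib]
  refine Finset.sum_congr rfl fun k _ => ?_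
  have h1 : fderiv ℝ (fun Z => f (u Z)) =ᶠ[𝓝 Z] fun Z => f' (u Z) • fderiv ℝ u Z := by
    filter_upwards [hu.continuousAt.eventually hf, hu.eventually (by simp)] with Y hY hY'
    exact (hY.comp_hasFDerivAt Y (hY'.differentiableAt (by simp)).hasFDerivAt).fderiv
  have h2 : HasFDerivAt (fderiv ℝ u) (fderiv ℝ (fderiv ℝ u) Z) Z :=
    ((hu.fderiv_right (m := 1) (by norm_num)).differentiableAt (by simp)).hasFDerivAt
  have h3 := (hf'.comp_hasFDerivAt Z (hu.differentiableAt (by simp)).hasFDerivAt).smul h2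
  rw [(h3.congr_of_eventuallyEq h1).fderiv]
  simp
  ring

end Radial

/-- The function `sin² r(p, ·)` on `ℂP^n`, where `r` is the geodesic distance. -/
def sinSq (p q : ComplexProjectiveSpace n) : ℝ := 1 - cosSq p.rep q.rep

theorem sinSq_proj (p : ComplexProjectiveSpace n) {Z : EuclideanSpace ℂ (Fin (n + 1))}
    (hZ : Z ≠ 0) : sinSq p (proj Z) = 1 - cosSq p.rep Z := by
  have := cosSq_rep p.rep Z p.rep_nonzero hZ
  rw [proj_rep] at this
  rw [sinSq, this]

theorem sinSq_nonneg (p q : ComplexProjectiveSpace n) : 0 ≤ sinSq p q :=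
  sub_nonneg.2 (cosSq_le_one _ _)

theorem sinSq_le_one (p q : ComplexProjectiveSpace n) : sinSq p q ≤ 1 :=
  sub_le_self _ (cosSq_nonneg _ _)

theorem sinSq_comm (p q : ComplexProjectiveSpace n) : sinSq p q = sinSq q p := by
  rw [sinSq, sinSq, cosSq_comm]

theorem sinSq_eq_zero_iff {p q : ComplexProjectiveSpace n} : sinSq p q = 0 ↔ p = q := by
  have := cosSq_eq_one_iff p.rep_nonzero q.rep_nonzero
  rw [proj_rep, proj_rep] at this
  rw [← this, sinSq, sub_eq_zero, eq_comm]

theorem continuous_sinSq (p : ComplexProjectiveSpace n) : Continuous (sinSq p) :=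
  continuous_const.sub (continuous_cosSq p)

theorem sinSq_proj_eventuallyEq (p : ComplexProjectiveSpace n) (f : ℝ → ℝ)
    {Z : EuclideanSpace ℂ (Fin (n + 1))} (hZ : Z ≠ 0) :
    (fun Z => f (sinSq p (proj Z))) =ᶠ[𝓝 Z] fun Z => f (1 - cosSq p.rep Z) := by
  filter_upwards [isOpen_ne.mem_nhds hZ] with Y hY
  rw [sinSq_proj p hY]

theorem contDiffAt_comp_sinSq_proj (p : ComplexProjectiveSpace n) {f : ℝ → ℝ}
    (hf : ∀ t ∈ Icc (0 : ℝ) 1, ContDiffAt ℝ 2 f t) {Z : EuclideanSpace ℂ (Fin (n + 1))}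
    (hZ : Z ≠ 0) : ContDiffAt ℝ 2 (fun Z => f (sinSq p (proj Z))) Z := by
  have h1 : ContDiffAt ℝ 2 (fun Z => 1 - cosSq p.rep Z) Z :=
    contDiffAt_const.sub (contDiffAt_infty.1 (contDiffAt_cosSq_right p.rep_nonzero hZ) 2)
  refine ContDiffAt.congr_of_eventuallyEq ?_ (sinSq_proj_eventuallyEq p f hZ)
  exact (hf _ ⟨sub_nonneg.2 (cosSq_le_one _ _), sub_le_self _ (cosSq_nonneg _ _)⟩).comp Z h1

/-- The Laplace–Beltrami operator on functions of `s = sin² r(p, ·)`. -/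
theorem laplaceBeltrami_comp_sinSq (p q : ComplexProjectiveSpace n) {f f' : ℝ → ℝ} {f'' : ℝ}
    (hC : ∀ t ∈ Icc (0 : ℝ) 1, ContDiffAt ℝ 2 f t)
    (hf : ∀ᶠ t in 𝓝 (sinSq p q), HasDerivAt f (f' t) t)
    (hf' : HasDerivAt f' f'' (sinSq p q)) :
    RiemannianGeometry.laplaceBeltrami (E := EuclideanSpace ℂ (Fin n)) (fun q => f (sinSq p q)) q =
      -4 * (sinSq p q * (1 - sinSq p q) * f'' + (n - (n + 1) * sinSq p q) * f' (sinSq p q)) := by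
  have hq := q.rep_nonzero
  have hq' : ‖q.rep‖ ≠ 0 := norm_ne_zero_iff.2 hq
  have h0 : Filter.Tendsto (fun c : ℝ => 1 - c) (𝓝 (cosSq p.rep q.rep)) (𝓝 (sinSq p q)) := by
    exact (continuous_const.sub continuous_id).continuousAt
  have h1 : ∀ᶠ c in 𝓝 (cosSq p.rep q.rep), HasDerivAt (fun c => f (1 - c)) (-f' (1 - c)) c := by
    filter_upwards [h0.eventually hf] with c hc
    exact HasDerivAt.comp_const_sub 1 c hc
  have h2 : HasDerivAt (fun c => -f' (1 - c)) f'' (cosSq p.rep q.rep) := by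
    simpa using (HasDerivAt.comp_const_sub 1 (cosSq p.rep q.rep) hf').fun_neg
  have h3 := laplaceBeltrami_proj (φ := fun q => f (sinSq p q)) hq
    (contDiffAt_comp_sinSq_proj p hC hq)
  rw [proj_rep] at h3
  rw [h3, (InnerProductSpace.laplacian_congr_nhds (sinSq_proj_eventuallyEq p f hq)).eq_of_nhds]
  have h4 := laplacian_comp (stdOrthonormalBasis ℝ (EuclideanSpace ℂ (Fin (n + 1))))
    (contDiffAt_infty.1 (contDiffAt_cosSq_right p.rep_nonzero hq) 2) h1 h2
  rw [h4, sum_fderiv_cosSq_sq _ p.rep_nonzero hq, laplacian_cosSq p.rep_nonzero hq, sinSq]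
  field_simp
  ring

end Laplacian

end Geometry

/-! ### The radial profile and its regularizations -/

section Profile

variable {n : ℕ} {ε s : ℝ}

/-- The profile `γ` of the Green's function: `-(2 n vol) G = γ(sin² r)`. As a function of
`s = sin² r`, the term `log (sin r)` is `log s / 2`. -/
def profile (n : ℕ) (s : ℝ) : ℝ :=
  Real.log s / 2 - ∑ j ∈ Finset.Icc 1 (n - 1), 1 / (2 * j * s ^ j)

/-- The derivative of the regularized profile, obtained from `γ' = (∑_{i<n} s^i) / (2 s^n)` by
adding `ε` to `s^n` in the denominator. -/
def regDeriv (n : ℕ) (ε s : ℝ) : ℝ := (∑ i ∈ Finset.range n, s ^ i) / (2 * (s ^ n + ε))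

/-- The regularized profile `γ_ε`: it is smooth near `[0, 1]` and agrees with `γ` at `1`. -/
def regProfile (n : ℕ) (ε s : ℝ) : ℝ := profile n 1 + ∫ t in (1 : ℝ)..s, regDeriv n ε t

/-- The approximate identity `δ_ε`, as a function of `s = sin² r`. -/
def regDelta (n : ℕ) (ε s : ℝ) : ℝ := ε * (1 + ε) / (s ^ n + ε) ^ 2

theorem hasDerivAt_profile (hn : 1 ≤ n) (hs : 0 < s) :
    HasDerivAt (profile n) ((∑ i ∈ Finset.range n, s ^ i) / (2 * s ^ n)) s := by
  have h1 : ∀ j ∈ Finset.Icc 1 (n - 1), HasDerivAt (fun s : ℝ => 1 / (2 * j * s ^ j))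
      (-(1 / (2 * s ^ (j + 1)))) s := by
    intro j hj
    have hj0 : (j : ℝ) ≠ 0 := by
      have := (Finset.mem_Icc.1 hj).1
      positivity
    have h2 := (((hasDerivAt_id s).pow j).const_mul (2 * (j : ℝ))).inv
      (by simp only [Pi.pow_apply, id]; positivity)
    simp only [one_div]
    refine h2.congr_deriv ?_
    obtain ⟨i, rfl⟩ : ∃ i, j = i + 1 := ⟨j - 1, by have := (Finset.mem_Icc.1 hj).1; omega⟩
    simp only [Pi.pow_apply, id, Nat.add_sub_cancel]
    push_cast at hj0 ⊢
    field_simp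
    ring
  have h3 := ((Real.hasDerivAt_log hs.ne').div_const 2).sub (HasDerivAt.fun_sum h1)
  refine h3.congr_deriv ?_
  rw [Finset.sum_neg_distrib, sub_neg_eq_add]
  obtain ⟨m, rfl⟩ : ∃ m, n = m + 1 := ⟨n - 1, by omega⟩
  have h4 : ∑ j ∈ Finset.Icc 1 (m + 1 - 1), 1 / (2 * s ^ (j + 1)) =
      ∑ j ∈ Finset.range m, 1 / (2 * s ^ (j + 1 + 1)) := by
    rw [Finset.range_eq_Ico]
    exact (Finset.sum_Ico_add' (fun j => 1 / (2 * s ^ (j + 1))) 0 m 1).symm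
  have h5 : ∑ i ∈ Finset.range (m + 1), s ^ i =
      ∑ j ∈ Finset.range m, s ^ (m - (j + 1)) + s ^ m :=
    (Finset.sum_range_reflect (fun i => s ^ i) (m + 1)).symm.trans (Finset.sum_range_succ' _ m)
  rw [h4, h5, add_div, Finset.sum_div, add_comm]
  congr 1
  · refine Finset.sum_congr rfl fun j hj => ?_
    have hj := Finset.mem_range.1 hj
    have h6 : s ^ (m + 1) = s ^ (m - (j + 1)) * s ^ (j + 1 + 1) := by
      rw [← pow_add]
      congr 1
      omega
    have h7 := pow_pos hs (m - (j + 1))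
    have h8 := pow_pos hs (j + 1 + 1)
    rw [h6]
    field_simp
  · rw [pow_succ]
    field_simp

/-- The denominator of `regDeriv` is positive on a neighbourhood of `[0, 1]`. -/
theorem pow_add_pos (hn : 1 ≤ n) (hε : 0 < ε) (hs : -min 1 ε < s) : 0 < s ^ n + ε := by
  rcases le_or_gt 0 s with h | h
  · positivity
  · have h1 : |s| < min 1 ε := by rw [abs_of_neg h]; linarith
    have h2 : |s| ^ n ≤ |s| := pow_le_of_le_one (abs_nonneg s) (h1.trans_le (min_le_left _ _)).le
      (by omega)
    have h3 := neg_abs_le (s ^ n)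
    rw [abs_pow] at h3
    linarith [min_le_right 1 ε]

theorem contDiffOn_regDeriv (hn : 1 ≤ n) (hε : 0 < ε) :
    ContDiffOn ℝ 1 (regDeriv n ε) (Ioi (-min 1 ε)) := by
  refine ContDiffOn.div (by fun_prop) (by fun_prop) fun s hs => ?_
  have := pow_add_pos hn hε hs
  positivity

theorem Icc_subset_Ioi_neg (hε : 0 < ε) : Icc (0 : ℝ) 1 ⊆ Ioi (-min 1 ε) := fun s hs => by
  have : 0 < min 1 ε := lt_min one_pos hε
  exact lt_of_lt_of_le (by linarith) hs.1

theorem hasDerivAt_regProfile (hn : 1 ≤ n) (hε : 0 < ε) (hs : s ∈ Ioi (-min 1 ε)) :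
    HasDerivAt (regProfile n ε) (regDeriv n ε s) s := by
  have hc := (contDiffOn_regDeriv hn hε).continuousOn
  have h1 : uIcc 1 s ⊆ Ioi (-min 1 ε) :=
    ordConnected_Ioi.uIcc_subset (Icc_subset_Ioi_neg hε ⟨zero_le_one, le_rfl⟩) hs
  exact (intervalIntegral.integral_hasDerivAt_right (hc.mono h1).intervalIntegrable
    (hc.stronglyMeasurableAtFilter isOpen_Ioi s hs)
    (hc.continuousAt (isOpen_Ioi.mem_nhds hs))).const_add _

theorem contDiffAt_regProfile (hn : 1 ≤ n) (hε : 0 < ε) (hs : s ∈ Ioi (-min 1 ε)) :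
    ContDiffAt ℝ 2 (regProfile n ε) s := by
  have h : ContDiffOn ℝ (1 + 1) (regProfile n ε) (Ioi (-min 1 ε)) := by
    rw [contDiffOn_succ_iff_deriv_of_isOpen isOpen_Ioi]
    refine ⟨fun t ht => (hasDerivAt_regProfile hn hε ht).differentiableAt.differentiableWithinAt,
      by simp, (contDiffOn_regDeriv hn hε).congr fun t ht => (hasDerivAt_regProfile hn hε ht).deriv⟩
  rw [one_add_one_eq_two] at h
  exact h.contDiffAt (isOpen_Ioi.mem_nhds hs)

/-- The radial Laplacian of the regularized profile. -/
theorem exists_hasDerivAt_regDeriv (hn : 1 ≤ n) (hε : 0 < ε) (hs : s ∈ Icc (0 : ℝ) 1) :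
    ∃ g', HasDerivAt (regDeriv n ε) g' s ∧
      s * (1 - s) * g' + (n - (n + 1) * s) * regDeriv n ε s = n / 2 * (regDelta n ε s - 1) := by
  have hD : 0 < s ^ n + ε := pow_add_pos hn hε (Icc_subset_Ioi_neg hε hs)
  set N : ℝ → ℝ := fun s => ∑ i ∈ Finset.range n, s ^ i with hNdef
  have hNd : DifferentiableAt ℝ N s := by
    rw [hNdef]
    fun_prop
  have hN : HasDerivAt N (deriv N s) s := hNd.hasDerivAt
  have hgeom : ∀ t, (1 - t) * N t = 1 - t ^ n := fun t => mul_neg_geom_sum t n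
  have hpow : HasDerivAt (fun t : ℝ => t ^ n) (n * s ^ (n - 1)) s := hasDerivAt_pow n s
  -- differentiate the geometric sum identity
  have h1 : -N s + (1 - s) * deriv N s = -(n * s ^ (n - 1)) := by
    have h2 := ((hasDerivAt_id s).const_sub 1).mul hN
    have h3 : ((fun t => 1 - id t) * N) = fun t => 1 - t ^ n := funext hgeom
    rw [h3] at h2
    have h4 := h2.unique (hpow.const_sub 1)
    simp only [id] at h4
    linarith
  have h5 : HasDerivAt (regDeriv n ε) _ s :=
    hN.div ((hpow.add_const ε).const_mul 2) (by positivity : 2 * (s ^ n + ε) ≠ 0)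
  refine ⟨_, h5, ?_⟩
  have h6 : s * s ^ (n - 1) = s ^ n := by
    rw [← pow_succ', Nat.sub_add_cancel hn]
  have h7 := hgeom s
  have h8 : regDeriv n ε s = N s / (2 * (s ^ n + ε)) := rfl
  rw [h8, regDelta]
  set x := s ^ n
  set y := s ^ (n - 1)
  set d := deriv N s
  set M := N s
  have e1 : s * (1 - s) * d = s * M - n * x := by
    rw [← h6]
    linear_combination s * h1
  have e2 : s * (1 - s) * M * y = (1 - x) * x := by
    linear_combination s * y * h7 + (1 - x) * h6
  have e3 : (n - (n + 1) * s) * M = n * (1 - x) - s * M := by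
    linear_combination (n : ℝ) * h7
  have e4 : s * (1 - s) * ((d * (2 * (x + ε)) - M * (2 * (n * y))) / (2 * (x + ε)) ^ 2) +
      (n - (n + 1) * s) * (M / (2 * (x + ε))) =
      (s * (1 - s) * d + (n - (n + 1) * s) * M) / (2 * (x + ε)) -
        n * (s * (1 - s) * M * y) / (2 * (x + ε) ^ 2) := by
    field_simp
    ring
  rw [e4, e1, e2, e3]
  field_simp
  ring

theorem geom_sum_nonneg (hs : 0 ≤ s) : 0 ≤ ∑ i ∈ Finset.range n, s ^ i :=
  Finset.sum_nonneg fun i _ => pow_nonneg hs i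

theorem geom_sum_le (hs : s ∈ Icc (0 : ℝ) 1) : ∑ i ∈ Finset.range n, s ^ i ≤ n := by
  refine (Finset.sum_le_card_nsmul _ _ 1 fun i _ => pow_le_one₀ hs.1 hs.2).trans ?_
  simp

theorem regProfile_one : regProfile n ε 1 = profile n 1 := by
  simp [regProfile]

theorem regProfile_le (hn : 1 ≤ n) (hε : 0 < ε) (hs : s ∈ Icc (0 : ℝ) 1) :
    regProfile n ε s ≤ profile n 1 := by
  rcases hs.2.eq_or_lt with rfl | h
  · exact regProfile_one.le
  have hsub : Icc s 1 ⊆ Icc (0 : ℝ) 1 := Icc_subset_Icc_left hs.1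
  have hd : ∀ t ∈ Icc s 1, HasDerivAt (regProfile n ε) (regDeriv n ε t) t := fun t ht =>
    hasDerivAt_regProfile hn hε (Icc_subset_Ioi_neg hε (hsub ht))
  obtain ⟨c, hc, hc'⟩ := exists_hasDerivAt_eq_slope (regProfile n ε) (regDeriv n ε) h
    (fun t ht => (hd t ht).continuousAt.continuousWithinAt)
    (fun t ht => hd t (Ioo_subset_Icc_self ht))
  have hc0 : 0 ≤ c := hs.1.trans hc.1.le
  have h1 : 0 ≤ regDeriv n ε c := div_nonneg (geom_sum_nonneg hc0) (by positivity)
  rw [hc', regProfile_one] at h1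
  by_contra hlt
  exact absurd (div_neg_of_neg_of_pos (sub_neg.2 (not_le.1 hlt)) (sub_pos.2 h)) h1.not_gt

/-- A lower bound for the regularized profile that does not depend on `ε`. -/
theorem le_regProfile (hn : 1 ≤ n) (hε : 0 < ε) (hs : s ∈ Ioc (0 : ℝ) 1) :
    profile n 1 - n / (2 * s ^ n) ≤ regProfile n ε s := by
  have hs0 := hs.1
  rcases hs.2.eq_or_lt with rfl | h
  · rw [regProfile_one]
    have : (0 : ℝ) ≤ n / (2 * 1 ^ n) := by positivity
    linarith
  have hsub : Icc s 1 ⊆ Icc (0 : ℝ) 1 := Icc_subset_Icc_left hs.1.le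
  have hd : ∀ t ∈ Icc s 1, HasDerivAt (regProfile n ε) (regDeriv n ε t) t := fun t ht =>
    hasDerivAt_regProfile hn hε (Icc_subset_Ioi_neg hε (hsub ht))
  obtain ⟨c, hc, hc'⟩ := exists_hasDerivAt_eq_slope (regProfile n ε) (regDeriv n ε) h
    (fun t ht => (hd t ht).continuousAt.continuousWithinAt)
    (fun t ht => hd t (Ioo_subset_Icc_self ht))
  have hc0 : 0 < c := hs.1.trans hc.1
  have h1 : regDeriv n ε c ≤ n / (2 * s ^ n) := by
    refine div_le_div₀ (by positivity) (geom_sum_le ⟨hc0.le, hc.2.le⟩) (by positivity) ?_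
    have := pow_le_pow_left₀ hs0.le hc.1.le n
    linarith
  have h0 : 0 ≤ regDeriv n ε c := div_nonneg (geom_sum_nonneg hc0.le) (by positivity)
  have h2 : regProfile n ε 1 - regProfile n ε s = regDeriv n ε c * (1 - s) := by
    rw [hc', div_mul_cancel₀ _ (sub_pos.2 h).ne']
  rw [regProfile_one] at h2
  nlinarith

/-- The regularized profile is squeezed between `γ` and `γ + O(ε)`, for fixed `s > 0`. -/
theorem regProfile_sub_profile (hn : 1 ≤ n) (hε : 0 < ε) (hs : s ∈ Ioc (0 : ℝ) 1) :
    regProfile n ε s - profile n s ∈ Icc 0 (n / (2 * s ^ n * s ^ n) * ε) := by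
  have hs0 := hs.1
  rcases hs.2.eq_or_lt with rfl | h
  · rw [regProfile_one, sub_self]
    exact ⟨le_rfl, by positivity⟩
  have hsub : Icc s 1 ⊆ Icc (0 : ℝ) 1 := Icc_subset_Icc_left hs.1.le
  have hd : ∀ t ∈ Icc s 1, HasDerivAt (fun t => regProfile n ε t - profile n t)
      (regDeriv n ε t - (∑ i ∈ Finset.range n, t ^ i) / (2 * t ^ n)) t := fun t ht =>
    (hasDerivAt_regProfile hn hε (Icc_subset_Ioi_neg hε (hsub ht))).sub
      (hasDerivAt_profile hn (hs0.trans_le ht.1))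
  obtain ⟨c, hc, hc'⟩ := exists_hasDerivAt_eq_slope _ _ h
    (fun t ht => (hd t ht).continuousAt.continuousWithinAt)
    (fun t ht => hd t (Ioo_subset_Icc_self ht))
  have hc0 : 0 < c := hs.1.trans hc.1
  have hcp : 0 < c ^ n := by positivity
  have h1 : regDeriv n ε c - (∑ i ∈ Finset.range n, c ^ i) / (2 * c ^ n) =
      -((∑ i ∈ Finset.range n, c ^ i) / (2 * c ^ n * (c ^ n + ε)) * ε) := by
    have : 0 < c ^ n + ε := by positivity
    rw [regDeriv]
    field_simp
    ring
  have h2 : regProfile n ε s - profile n s =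
      (∑ i ∈ Finset.range n, c ^ i) / (2 * c ^ n * (c ^ n + ε)) * ε * (1 - s) := by
    rw [h1, regProfile_one, sub_self, zero_sub, neg_div, neg_inj,
      eq_div_iff (sub_pos.2 h).ne'] at hc'
    exact hc'.symm
  have h3 := geom_sum_nonneg (n := n) hc0.le
  have h4 : (∑ i ∈ Finset.range n, c ^ i) / (2 * c ^ n * (c ^ n + ε)) ≤
      n / (2 * s ^ n * s ^ n) := by
    have h5 := pow_le_pow_left₀ hs0.le hc.1.le n
    refine div_le_div₀ (by positivity) (geom_sum_le ⟨hc0.le, hc.2.le⟩) (by positivity) ?_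
    gcongr
    linarith
  rw [h2]
  have h6 : 0 < 1 - s := sub_pos.2 h
  refine ⟨by positivity, ?_⟩
  calc _ ≤ (n / (2 * s ^ n * s ^ n) * ε) * 1 := by
        gcongr
        linarith
    _ = _ := mul_one _

theorem tendsto_regProfile (hn : 1 ≤ n) (hs : s ∈ Ioc (0 : ℝ) 1) :
    Filter.Tendsto (fun ε => regProfile n ε s) (𝓝[>] 0) (𝓝 (profile n s)) := by
  have h1 : Filter.Tendsto (fun ε : ℝ => n / (2 * s ^ n * s ^ n) * ε) (𝓝[>] 0) (𝓝 0) := by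
    have : Filter.Tendsto (fun ε : ℝ => n / (2 * s ^ n * s ^ n) * ε) (𝓝 0)
        (𝓝 (n / (2 * s ^ n * s ^ n) * 0)) := (continuous_const.mul continuous_id).tendsto 0
    rw [mul_zero] at this
    exact this.mono_left nhdsWithin_le_nhds
  have h2 : Filter.Tendsto (fun ε => regProfile n ε s - profile n s) (𝓝[>] 0) (𝓝 0) := by
    refine tendsto_of_tendsto_of_tendsto_of_le_of_le' tendsto_const_nhds h1 ?_ ?_
    · filter_upwards [self_mem_nhdsWithin] with ε hε using (regProfile_sub_profile hn hε hs).1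
    · filter_upwards [self_mem_nhdsWithin] with ε hε using (regProfile_sub_profile hn hε hs).2
  simpa using h2.add_const (profile n s)

theorem regDelta_nonneg (hε : 0 < ε) : 0 ≤ regDelta n ε s := by
  unfold regDelta
  positivity

theorem pow_mul_regDelta_le (hε : 0 < ε) (hs : 0 ≤ s) :
    (s ^ n) ^ 2 * regDelta n ε s ≤ ε * (1 + ε) := by
  have h1 : 0 < s ^ n + ε := by positivity
  rw [regDelta, mul_div_assoc', div_le_iff₀ (by positivity)]
  have h2 : (s ^ n) ^ 2 ≤ (s ^ n + ε) ^ 2 := pow_le_pow_left₀ (by positivity) (by linarith) 2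
  nlinarith [mul_pos hε (by linarith : 0 < 1 + ε)]

end Profile

/-! ### The representation formula -/

section Representation

variable {n : ℕ}

/-- The Riemannian volume of the Fubini–Study metric. -/
abbrev fubiniStudyVolume (n : ℕ) : Measure (ComplexProjectiveSpace n) :=
  RiemannianGeometry.riemannianVolume (EuclideanSpace ℂ (Fin n)) (ComplexProjectiveSpace n)

/-- The Laplace–Beltrami operator of the Fubini–Study metric. -/
abbrev fubiniStudyLaplacian (φ : ComplexProjectiveSpace n → ℝ) (q : ComplexProjectiveSpace n) : ℝ :=
  RiemannianGeometry.laplaceBeltrami (E := EuclideanSpace ℂ (Fin n)) φ q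

theorem integrable_of_continuous {f : ComplexProjectiveSpace n → ℝ} (hf : Continuous f) :
    Integrable f (fubiniStudyVolume n) :=
  hf.integrable_of_hasCompactSupport (HasCompactSupport.of_compactSpace f)

theorem totalVolume_pos :
    0 < RiemannianGeometry.totalVolume (EuclideanSpace ℂ (Fin n)) (ComplexProjectiveSpace n) := by
  have h1 := integral_riemannianVolume (n := n) (f := fun _ => 1) measurable_const
  have h2 : 0 < ∫ Z : EuclideanSpace ℂ (Fin (n + 1)), weight (‖Z‖ ^ 2) := by
    refine continuous_weight_norm.integral_pos_of_hasCompactSupport_nonneg_nonzero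
      hasCompactSupport_weight_norm (fun Z => weight_nonneg _)
      (x := EuclideanSpace.single 0 ((√2 : ℝ) : ℂ)) ?_
    have h3 : ‖(EuclideanSpace.single 0 ((√2 : ℝ) : ℂ) : EuclideanSpace ℂ (Fin (n + 1)))‖ = √2 := by
      rw [PiLp.norm_single, Complex.norm_real, Real.norm_of_nonneg (Real.sqrt_nonneg 2)]
    rw [h3, Real.sq_sqrt zero_le_two, weight_two]
    exact one_ne_zero
  have h3 : 0 < (weightConst n (fun t => ENNReal.ofReal (weight t)))⁻¹.toReal :=
    ENNReal.toReal_pos (ENNReal.inv_ne_zero.2 weightConst_ne_top)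
      (ENNReal.inv_ne_top.2 weightConst_ne_zero)
  simp only [mul_one, integral_const, smul_eq_mul] at h1
  rw [RiemannianGeometry.totalVolume, h1]
  exact mul_pos h3 h2

variable {ε : ℝ}

theorem sinSq_mem_Icc (p q : ComplexProjectiveSpace n) : sinSq p q ∈ Icc (0 : ℝ) 1 :=
  ⟨sinSq_nonneg p q, sinSq_le_one p q⟩

theorem contDiffAt_regProfile_sinSq_proj (hn : 1 ≤ n) (hε : 0 < ε) (p : ComplexProjectiveSpace n) :
    ∀ Z ≠ 0, ContDiffAt ℝ 2 (fun Z => regProfile n ε (sinSq p (proj Z))) Z := fun _ hZ =>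
  contDiffAt_comp_sinSq_proj p (fun _ ht => contDiffAt_regProfile hn hε (Icc_subset_Ioi_neg hε ht))
    hZ

theorem continuous_regProfile_sinSq (hn : 1 ≤ n) (hε : 0 < ε) (p : ComplexProjectiveSpace n) :
    Continuous fun q => regProfile n ε (sinSq p q) :=
  continuous_of_contDiffAt_proj (contDiffAt_regProfile_sinSq_proj hn hε p)

theorem continuous_regDelta_sinSq (hε : 0 < ε) (p : ComplexProjectiveSpace n) :
    Continuous fun q => regDelta n ε (sinSq p q) := by
  have h := continuous_sinSq p
  refine continuous_const.div (((h.pow n).add continuous_const).pow 2) fun q => ?_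
  have := sinSq_nonneg p q
  positivity

/-- The Laplacian of the regularized profile is `2n (1 - δ_ε)`. -/
theorem laplaceBeltrami_regProfile (hn : 1 ≤ n) (hε : 0 < ε) (p q : ComplexProjectiveSpace n) :
    fubiniStudyLaplacian (fun q => regProfile n ε (sinSq p q)) q =
      2 * n * (1 - regDelta n ε (sinSq p q)) := by
  obtain ⟨g', h1, h2⟩ := exists_hasDerivAt_regDeriv hn hε (sinSq_mem_Icc p q)
  have h3 := laplaceBeltrami_comp_sinSq p q
    (fun t ht => contDiffAt_regProfile hn hε (Icc_subset_Ioi_neg hε ht))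
    (Filter.eventually_of_mem (isOpen_Ioi.mem_nhds (Icc_subset_Ioi_neg hε (sinSq_mem_Icc p q)))
      fun t ht => hasDerivAt_regProfile hn hε ht) h1
  rw [fubiniStudyLaplacian, h3, h2]
  ring

theorem integral_regProfile_mul_laplaceBeltrami (hn : 1 ≤ n) (hε : 0 < ε)
    (p : ComplexProjectiveSpace n) {φ : ComplexProjectiveSpace n → ℝ}
    (hφ : ∀ Z ≠ 0, ContDiffAt ℝ 2 (fun Z => φ (proj Z)) Z) :
    ∫ q, regProfile n ε (sinSq p q) * fubiniStudyLaplacian φ q ∂(fubiniStudyVolume n) =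
      2 * n * (∫ q, φ q ∂(fubiniStudyVolume n) -
        ∫ q, φ q * regDelta n ε (sinSq p q) ∂(fubiniStudyVolume n)) := by
  have hc := continuous_of_contDiffAt_proj hφ
  rw [integral_mul_laplaceBeltrami_comm (ψ := fun q => regProfile n ε (sinSq p q)) hφ
    (contDiffAt_regProfile_sinSq_proj hn hε p), ← integral_sub (integrable_of_continuous hc)
    (integrable_of_continuous (hc.fun_mul (continuous_regDelta_sinSq hε p))), ← integral_const_mul]
  refine integral_congr_ae (ae_of_all _ fun q => ?_)
  have h := laplaceBeltrami_regProfile hn hε p q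
  dsimp only [fubiniStudyLaplacian] at h ⊢
  rw [h]
  ring

theorem laplaceBeltrami_one (q : ComplexProjectiveSpace n) :
    fubiniStudyLaplacian (fun _ => 1) q = 0 := by
  have := laplaceBeltrami_comp_sinSq q q (f := fun _ => 1) (f' := fun _ => 0) (f'' := 0)
    (fun t _ => contDiffAt_const) (.of_forall fun t => hasDerivAt_const t 1) (hasDerivAt_const _ 0)
  rw [fubiniStudyLaplacian, this]
  ring

theorem integral_regDelta (hn : 1 ≤ n) (hε : 0 < ε) (p : ComplexProjectiveSpace n) :
    ∫ q, regDelta n ε (sinSq p q) ∂(fubiniStudyVolume n) =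
      RiemannianGeometry.totalVolume (EuclideanSpace ℂ (Fin n)) (ComplexProjectiveSpace n) := by
  have h1 := integral_regProfile_mul_laplaceBeltrami hn hε p (φ := fun _ => 1)
    (fun Z _ => contDiffAt_const)
  have hn' : (n : ℝ) ≠ 0 := by positivity
  simp only [laplaceBeltrami_one, mul_zero, integral_zero, one_mul, integral_const, smul_eq_mul,
    mul_one] at h1
  rw [RiemannianGeometry.totalVolume]
  have h3 := (mul_eq_zero.1 h1.symm).resolve_left (by positivity)
  linarith

/-- Points are null sets, since the approximate identity blows up at its centre. -/
theorem measure_singleton (hn : 1 ≤ n) (p : ComplexProjectiveSpace n) :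
    fubiniStudyVolume n {p} = 0 := by
  have h1 : ∀ ε : ℝ, 0 < ε → (fubiniStudyVolume n).real {p} ≤ ε *
      RiemannianGeometry.totalVolume (EuclideanSpace ℂ (Fin n)) (ComplexProjectiveSpace n) := by
    intro ε hε
    have h2 := mul_meas_ge_le_integral_of_nonneg (μ := fubiniStudyVolume n)
      (f := fun q => regDelta n ε (sinSq p q)) (ae_of_all _ fun q => regDelta_nonneg hε)
      (integrable_of_continuous (continuous_regDelta_sinSq hε p)) (1 / ε)
    rw [integral_regDelta hn hε] at h2
    have h3 : (fubiniStudyVolume n).real {p} ≤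
        (fubiniStudyVolume n).real {q | 1 / ε ≤ regDelta n ε (sinSq p q)} := by
      refine measureReal_mono (singleton_subset_iff.2 ?_)
      rw [mem_ofPred_eq, sinSq_eq_zero_iff.2 rfl, regDelta, zero_pow (by omega), zero_add]
      rw [div_le_div_iff₀ hε (by positivity)]
      nlinarith [sq_nonneg ε, mul_pos hε (sq_pos_of_pos hε)]
    rw [div_mul_eq_mul_div, one_mul, div_le_iff₀ hε] at h2
    linarith
  have h2 : (fubiniStudyVolume n).real {p} = 0 := by
    refine le_antisymm (le_of_forall_pos_le_add fun η hη => ?_) measureReal_nonneg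
    have hv := totalVolume_pos (n := n)
    have h3 := h1 _ (div_pos hη hv)
    rwa [div_mul_cancel₀ _ hv.ne', ← zero_add η] at h3
  rwa [measureReal_eq_zero_iff] at h2

theorem ae_sinSq_mem_Ioc (hn : 1 ≤ n) (p : ComplexProjectiveSpace n) :
    ∀ᵐ q ∂(fubiniStudyVolume n), sinSq p q ∈ Ioc (0 : ℝ) 1 := by
  filter_upwards [compl_mem_ae_iff.2 (measure_singleton hn p)] with q hq
  exact ⟨(sinSq_nonneg p q).lt_of_ne fun h => hq (sinSq_eq_zero_iff.1 h.symm).symm,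
    sinSq_le_one p q⟩

/-- A continuous function differs little from its value at `p`, up to a multiple of a function
that vanishes only at `p`. -/
theorem exists_abs_sub_le {φ : ComplexProjectiveSpace n → ℝ} (hφ : Continuous φ)
    (p : ComplexProjectiveSpace n) {η : ℝ} (hη : 0 < η) :
    ∃ C, 0 ≤ C ∧ ∀ q, |φ q - φ p| ≤ η + C * (sinSq p q ^ n) ^ 2 := by
  have hs : Continuous fun q => (sinSq p q ^ n) ^ 2 := ((continuous_sinSq p).pow n).pow 2
  have hd : Continuous fun q => |φ q - φ p| := (hφ.sub continuous_const).abs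
  have hK : IsCompact {q | η ≤ |φ q - φ p|} := (isClosed_le continuous_const hd).isCompact
  have hpos : ∀ q ∈ {q | η ≤ |φ q - φ p|}, (sinSq p q ^ n) ^ 2 ≠ 0 := by
    intro q hq h
    have h1 : sinSq p q = 0 := eq_zero_of_pow_eq_zero (eq_zero_of_pow_eq_zero h)
    rw [sinSq_eq_zero_iff] at h1
    rw [mem_ofPred_eq, h1, sub_self, abs_zero] at hq
    exact hq.not_gt hη
  obtain ⟨C, hC⟩ := hK.bddAbove_image (f := fun q => |φ q - φ p| / (sinSq p q ^ n) ^ 2)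
    (hd.continuousOn.div hs.continuousOn hpos)
  refine ⟨max C 0, le_max_right _ _, fun q => ?_⟩
  have h0 : 0 ≤ (sinSq p q ^ n) ^ 2 := sq_nonneg _
  by_cases hq : η ≤ |φ q - φ p|
  · have h1 := hC (mem_image_of_mem _ hq)
    have h2 : 0 < (sinSq p q ^ n) ^ 2 := h0.lt_of_ne' (hpos q hq)
    rw [div_le_iff₀ h2] at h1
    nlinarith [le_max_left C 0]
  · have := mul_nonneg (le_max_right C 0) h0
    linarith [not_le.1 hq]

theorem tendsto_integral_mul_regDelta (hn : 1 ≤ n) (p : ComplexProjectiveSpace n)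
    {φ : ComplexProjectiveSpace n → ℝ} (hφ : Continuous φ) :
    Filter.Tendsto (fun ε => ∫ q, φ q * regDelta n ε (sinSq p q) ∂(fubiniStudyVolume n)) (𝓝[>] 0)
      (𝓝 (φ p * RiemannianGeometry.totalVolume (EuclideanSpace ℂ (Fin n))
        (ComplexProjectiveSpace n))) := by
  set v := RiemannianGeometry.totalVolume (EuclideanSpace ℂ (Fin n)) (ComplexProjectiveSpace n)
    with hv
  have hv0 : 0 < v := totalVolume_pos
  rw [Metric.tendsto_nhds]
  intro e he
  obtain ⟨C, hC0, hC⟩ := exists_abs_sub_le hφ p (div_pos (half_pos he) hv0)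
  have hlim : ∀ᶠ ε : ℝ in 𝓝[>] 0, C * (ε * (1 + ε)) * v < e / 2 := by
    have h1 : Continuous fun ε : ℝ => C * (ε * (1 + ε)) * v := by fun_prop
    have h2 := h1.tendsto 0
    simp only [zero_mul, mul_zero] at h2
    exact (h2.mono_left nhdsWithin_le_nhds).eventually_lt_const (half_pos he)
  filter_upwards [hlim, self_mem_nhdsWithin] with ε hε1 hε
  have hδ := continuous_regDelta_sinSq hε p
  have hI : ∫ q, φ q * regDelta n ε (sinSq p q) ∂(fubiniStudyVolume n) - φ p * v =
      ∫ q, (φ q - φ p) * regDelta n ε (sinSq p q) ∂(fubiniStudyVolume n) := by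
    simp only [sub_mul]
    rw [integral_sub (integrable_of_continuous (hφ.fun_mul hδ))
      (integrable_of_continuous (continuous_const.fun_mul hδ)), integral_const_mul,
      integral_regDelta hn hε]
  rw [Real.dist_eq, hI]
  have hb : ∫ q, |(φ q - φ p) * regDelta n ε (sinSq p q)| ∂(fubiniStudyVolume n) ≤
      ∫ q, (e / 2 / v * regDelta n ε (sinSq p q) + C * (ε * (1 + ε))) ∂(fubiniStudyVolume n) := by
    refine integral_mono
      (integrable_of_continuous (((hφ.sub continuous_const).mul hδ).abs))
      (integrable_of_continuous ((continuous_const.mul hδ).add continuous_const)) fun q => ?_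
    have h1 := regDelta_nonneg (n := n) (s := sinSq p q) hε
    have h2 := pow_mul_regDelta_le (n := n) hε (sinSq_nonneg p q)
    dsimp only
    rw [abs_mul, abs_of_nonneg h1]
    nlinarith [mul_le_mul_of_nonneg_right (hC q) h1, mul_le_mul_of_nonneg_left h2 hC0]
  rw [integral_add (integrable_of_continuous (continuous_const.fun_mul hδ))
    (integrable_of_continuous continuous_const), integral_const_mul, integral_regDelta hn hε,
    ← hv, div_mul_cancel₀ _ hv0.ne', integral_const, smul_eq_mul, mul_comm _ (C * _)] at hb
  have h3 := abs_integral_le_integral_abs (μ := fubiniStudyVolume n)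
    (f := fun q => (φ q - φ p) * regDelta n ε (sinSq p q))
  calc _ ≤ _ := h3
    _ ≤ _ := hb
    _ < e := by
      have : C * (ε * (1 + ε)) * (fubiniStudyVolume n).real univ < e / 2 := hε1
      linarith

/-- A bound for the integral of the regularized profile that does not depend on `ε`. Since
`Δ s = -4 (n - (n + 1) s)` for `s = sin² r`, the symmetry of the Laplacian bounds the integral of
the profile against `n - (n + 1) s`, which is positive near the pole. -/
theorem integral_sub_regProfile_le (hn : 1 ≤ n) (p : ComplexProjectiveSpace n) :
    ∃ B, ∀ ε, 0 < ε →
      ∫ q, (profile n 1 - regProfile n ε (sinSq p q)) ∂(fubiniStudyVolume n) ≤ B := by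
  set v := RiemannianGeometry.totalVolume (EuclideanSpace ℂ (Fin n)) (ComplexProjectiveSpace n)
    with hv
  have hn0 : (0 : ℝ) < n := by positivity
  -- for `s ≤ s₀` the weight `4 (n - (n + 1) s)` is at least `2 n`; for `s ≥ s₀` the integrand is at
  -- most `C`
  set s₀ : ℝ := n / (2 * (n + 1)) with hs₀
  have hs₀pos : 0 < s₀ := by positivity
  set C : ℝ := n / (2 * s₀ ^ n) with hC
  have hCpos : 0 < C := by positivity
  refine ⟨(2 * n * v + C * (2 * n + 4) * v) / (2 * n), fun ε hε => ?_⟩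
  rw [le_div_iff₀ (by positivity)]
  have hδ := continuous_regDelta_sinSq hε p
  have hs := continuous_sinSq p
  have hγ := continuous_regProfile_sinSq hn hε p
  have hΔs : ∀ q, fubiniStudyLaplacian (sinSq p) q = -4 * (n - (n + 1) * sinSq p q) := fun q => by
    have := laplaceBeltrami_comp_sinSq p q (f := fun t => t) (f' := fun _ => 1) (f'' := 0)
      (fun t _ => contDiffAt_id) (.of_forall fun t => hasDerivAt_id t) (hasDerivAt_const _ 1)
    rw [fubiniStudyLaplacian, this]
    ring
  have h1 := integral_regProfile_mul_laplaceBeltrami hn hε p (φ := sinSq p)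
    (fun Z hZ => contDiffAt_comp_sinSq_proj p (f := fun t => t) (fun t _ => contDiffAt_id) hZ)
  have h2 : ∫ q, fubiniStudyLaplacian (sinSq p) q ∂(fubiniStudyVolume n) = 0 := by
    have h3 := integral_mul_laplaceBeltrami_comm (n := n) (ψ := fun _ => 1) (φ := sinSq p)
      (fun Z hZ => contDiffAt_comp_sinSq_proj p (f := fun t => t) (fun t _ => contDiffAt_id) hZ)
      (fun Z _ => contDiffAt_const)
    simpa only [one_mul, laplaceBeltrami_one, mul_zero, integral_zero] using h3
  simp only [hΔs] at h1 h2
  have h4 : ∫ q, (profile n 1 - regProfile n ε (sinSq p q)) * (4 * (n - (n + 1) * sinSq p q))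
      ∂(fubiniStudyVolume n) ≤ 2 * n * v := by
    have e1 : ∫ q, sinSq p q ∂(fubiniStudyVolume n) ≤ v := by
      have := integral_mono (integrable_of_continuous hs)
        (integrable_of_continuous (continuous_const (y := (1 : ℝ)))) (fun q => sinSq_le_one p q)
      rwa [integral_const, smul_eq_mul, mul_one] at this
    have e2 : 0 ≤ ∫ q, sinSq p q * regDelta n ε (sinSq p q) ∂(fubiniStudyVolume n) :=
      integral_nonneg fun q => mul_nonneg (sinSq_nonneg p q) (regDelta_nonneg hε)
    have e3 : ∀ q, (profile n 1 - regProfile n ε (sinSq p q)) * (4 * (n - (n + 1) * sinSq p q)) =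
        regProfile n ε (sinSq p q) * (-4 * (n - (n + 1) * sinSq p q)) -
          profile n 1 * (-4 * (n - (n + 1) * sinSq p q)) := fun q => by ring
    simp only [e3]
    rw [integral_sub (integrable_of_continuous (by fun_prop))
      (integrable_of_continuous (by fun_prop)), integral_const_mul, h1, h2]
    have : 0 < 2 * (n : ℝ) := by positivity
    nlinarith
  have h5 : ∫ q, (profile n 1 - regProfile n ε (sinSq p q)) * (2 * n) ∂(fubiniStudyVolume n) ≤
      ∫ q, ((profile n 1 - regProfile n ε (sinSq p q)) * (4 * (n - (n + 1) * sinSq p q)) +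
        C * (2 * n + 4)) ∂(fubiniStudyVolume n) := by
    refine integral_mono (integrable_of_continuous (by fun_prop))
      (integrable_of_continuous (by fun_prop)) fun q => ?_
    dsimp only
    have hq := sinSq_mem_Icc p q
    have h6 := regProfile_le hn hε hq
    by_cases hqs : sinSq p q ≤ s₀
    · rw [hs₀, le_div_iff₀ (by positivity)] at hqs
      have h7 : (2 * n : ℝ) ≤ 4 * (n - (n + 1) * sinSq p q) := by linarith
      have h8 := mul_le_mul_of_nonneg_left h7 (sub_nonneg.2 h6)
      have : 0 < C * (2 * n + 4) := by positivity
      linarith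
    · have h7 := not_le.1 hqs
      have h8 := le_regProfile hn hε ⟨hs₀pos.trans h7, hq.2⟩
      have h9 : n / (2 * sinSq p q ^ n) ≤ C := by
        rw [hC]
        have := pow_le_pow_left₀ hs₀pos.le h7.le n
        gcongr
      set h := profile n 1 - regProfile n ε (sinSq p q) with hh
      have h10 : 0 ≤ h := sub_nonneg.2 h6
      have h11 : h ≤ C := by linarith
      nlinarith [mul_le_mul_of_nonneg_right h11 (by positivity : (0 : ℝ) ≤ 2 * n + 4),
        mul_nonneg h10 (mul_nonneg (by positivity : (0 : ℝ) ≤ n + 1) (sub_nonneg.2 hq.2))]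
  rw [integral_mul_const, integral_add (integrable_of_continuous (by fun_prop))
    (integrable_of_continuous continuous_const), integral_const, smul_eq_mul,
    mul_comm _ (C * _)] at h5
  have h6 : (fubiniStudyVolume n).real univ = v := rfl
  rw [h6] at h5
  linarith

theorem measurable_profile_sinSq (p : ComplexProjectiveSpace n) :
    Measurable fun q => profile n (sinSq p q) := by
  have h1 := (continuous_sinSq p).measurable
  unfold profile
  fun_prop

/-- The profile is integrable, by Fatou's lemma for the regularized profiles. -/
theorem integrable_profile_sinSq (hn : 1 ≤ n) (p : ComplexProjectiveSpace n) :
    Integrable (fun q => profile n (sinSq p q)) (fubiniStudyVolume n) := by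
  obtain ⟨B, hB⟩ := integral_sub_regProfile_le hn p
  have hε : ∀ k : ℕ, (0 : ℝ) < 1 / (k + 1) := fun k => by positivity
  have h1 : ∀ᵐ q ∂(fubiniStudyVolume n), Filter.Tendsto
      (fun k : ℕ => ‖profile n 1 - regProfile n (1 / (k + 1)) (sinSq p q)‖ₑ) Filter.atTop
      (𝓝 ‖profile n 1 - profile n (sinSq p q)‖ₑ) := by
    filter_upwards [ae_sinSq_mem_Ioc hn p] with q hq
    refine (tendsto_const_nhds.sub ((tendsto_regProfile hn hq).comp ?_)).enorm
    exact tendsto_nhdsWithin_iff.2 ⟨tendsto_one_div_add_atTop_nhds_zero_nat, .of_forall hε⟩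
  have h2 : ∫⁻ q, ‖profile n 1 - profile n (sinSq p q)‖ₑ ∂(fubiniStudyVolume n) ≤
      ENNReal.ofReal B := by
    calc _ = ∫⁻ q, Filter.liminf (fun k : ℕ =>
          ‖profile n 1 - regProfile n (1 / (k + 1)) (sinSq p q)‖ₑ) Filter.atTop
          ∂(fubiniStudyVolume n) := lintegral_congr_ae (by
            filter_upwards [h1] with q hq using hq.liminf_eq.symm)
      _ ≤ Filter.liminf (fun k : ℕ => ∫⁻ q,
          ‖profile n 1 - regProfile n (1 / (k + 1)) (sinSq p q)‖ₑ ∂(fubiniStudyVolume n))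
          Filter.atTop := lintegral_liminf_le fun k =>
            (continuous_const.sub (continuous_regProfile_sinSq hn (hε k) p)).enorm.measurable
      _ ≤ Filter.liminf (fun k : ℕ => ENNReal.ofReal B) Filter.atTop := by
          refine Filter.liminf_le_liminf (.of_forall fun k => ?_)
          rw [← ofReal_integral_norm_eq_lintegral_enorm (integrable_of_continuous
            (continuous_const.fun_sub (continuous_regProfile_sinSq hn (hε k) p)))]
          refine ENNReal.ofReal_le_ofReal (le_trans (le_of_eq ?_) (hB _ (hε k)))
          refine integral_congr_ae (ae_of_all _ fun q => ?_)
          exact Real.norm_of_nonneg (sub_nonneg.2 (regProfile_le hn (hε k) (sinSq_mem_Icc p q)))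
      _ = _ := Filter.liminf_const _
  have h3 : Integrable (fun q => profile n 1 - profile n (sinSq p q)) (fubiniStudyVolume n) :=
    ⟨(measurable_const.sub (measurable_profile_sinSq p)).aestronglyMeasurable,
      h2.trans_lt ENNReal.ofReal_lt_top⟩
  refine ((integrable_const (profile n 1)).sub h3).congr (ae_of_all _ fun q => ?_)
  simp

/-- The representation formula for the unnormalized Green's function `γ(sin² r)`. -/
theorem integral_profile_mul_laplaceBeltrami (hn : 1 ≤ n) (p : ComplexProjectiveSpace n)
    {φ : ComplexProjectiveSpace n → ℝ} (hφ : ∀ Z ≠ 0, ContDiffAt ℝ 2 (fun Z => φ (proj Z)) Z) :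
    Integrable (fun q => profile n (sinSq p q) * fubiniStudyLaplacian φ q) (fubiniStudyVolume n) ∧
    ∫ q, profile n (sinSq p q) * fubiniStudyLaplacian φ q ∂(fubiniStudyVolume n) =
      2 * n * (∫ q, φ q ∂(fubiniStudyVolume n) - φ p *
        RiemannianGeometry.totalVolume (EuclideanSpace ℂ (Fin n)) (ComplexProjectiveSpace n)) := by
  have hΔ : Continuous (fubiniStudyLaplacian φ) := continuous_laplaceBeltrami hφ
  have hγ := integrable_profile_sinSq hn p
  obtain ⟨M, hM⟩ := isCompact_univ.exists_bound_of_continuousOn hΔ.continuousOn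
  have hM' : ∀ q, ‖fubiniStudyLaplacian φ q‖ ≤ M := fun q => hM q (mem_univ q)
  refine ⟨hγ.mul_bdd hΔ.measurable.aestronglyMeasurable (ae_of_all _ hM'), ?_⟩
  have h1 : Filter.Tendsto (fun ε => ∫ q, regProfile n ε (sinSq p q) * fubiniStudyLaplacian φ q
      ∂(fubiniStudyVolume n)) (𝓝[>] 0)
      (𝓝 (∫ q, profile n (sinSq p q) * fubiniStudyLaplacian φ q ∂(fubiniStudyVolume n))) := by
    refine tendsto_integral_filter_of_dominated_convergence
      (fun q => (‖profile n 1‖ + ‖profile n (sinSq p q)‖) * M) ?_ ?_ ?_ ?_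
    · filter_upwards [self_mem_nhdsWithin] with ε hε
      exact ((continuous_regProfile_sinSq hn hε p).mul hΔ).measurable.aestronglyMeasurable
    · filter_upwards [self_mem_nhdsWithin] with ε hε
      filter_upwards [ae_sinSq_mem_Ioc hn p] with q hq
      rw [norm_mul]
      refine mul_le_mul ?_ (hM' q) (norm_nonneg _) (by positivity)
      have h2 := regProfile_le hn hε (Ioc_subset_Icc_self hq)
      have h3 := (regProfile_sub_profile hn hε hq).1
      simp only [Real.norm_eq_abs]
      rw [abs_le]
      constructor
      · linarith [neg_abs_le (profile n (sinSq p q)), abs_nonneg (profile n 1)]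
      · linarith [le_abs_self (profile n 1), abs_nonneg (profile n (sinSq p q))]
    · exact ((integrable_const _).add hγ.norm).mul_const M
    · filter_upwards [ae_sinSq_mem_Ioc hn p] with q hq
      exact (tendsto_regProfile hn hq).mul_const _
  refine tendsto_nhds_unique h1 ?_
  refine ((tendsto_const_nhds.sub (tendsto_integral_mul_regDelta hn p
    (continuous_of_contDiffAt_proj hφ))).const_mul (2 * (n : ℝ))).congr' ?_
  filter_upwards [self_mem_nhdsWithin] with ε hε
  exact (integral_regProfile_mul_laplaceBeltrami hn hε p hφ).symm

/-! ### Unitary invariance, smoothness, and the Green's function -/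

/-- The unitary group acts transitively on `ℂP^n`. -/
theorem exists_linearIsometryEquiv (p q : ComplexProjectiveSpace n) :
    ∃ U : EuclideanSpace ℂ (Fin (n + 1)) ≃ₗᵢ[ℂ] EuclideanSpace ℂ (Fin (n + 1)),
      proj (U p.rep) = q := by
  have h : ∀ x : ComplexProjectiveSpace n, ∃ b : OrthonormalBasis (Fin (n + 1)) ℂ
      (EuclideanSpace ℂ (Fin (n + 1))), b 0 = ((‖x.rep‖ : ℂ)⁻¹) • x.rep := by
    intro x
    have hx : ‖x.rep‖ ≠ 0 := norm_ne_zero_iff.2 x.rep_nonzero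
    obtain ⟨b, hb⟩ := Orthonormal.exists_orthonormalBasis_extension_of_card_eq (𝕜 := ℂ)
      (ι := Fin (n + 1)) (E := EuclideanSpace ℂ (Fin (n + 1))) (by simp)
      (v := fun _ => ((‖x.rep‖ : ℂ)⁻¹) • x.rep) (s := {0}) (by
        rw [orthonormal_subsingleton_iff]
        intro i
        simp [norm_smul, hx])
    exact ⟨b, hb 0 rfl⟩
  obtain ⟨a, ha⟩ := h p
  obtain ⟨b, hb⟩ := h q
  have hp : (‖p.rep‖ : ℂ) ≠ 0 := by exact_mod_cast norm_ne_zero_iff.2 p.rep_nonzero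
  have hq : (‖q.rep‖ : ℂ) ≠ 0 := by exact_mod_cast norm_ne_zero_iff.2 q.rep_nonzero
  refine ⟨a.equiv b (Equiv.refl _), ?_⟩
  have h1 : p.rep = (‖p.rep‖ : ℂ) • a 0 := by
    rw [ha, smul_smul, mul_inv_cancel₀ hp, one_smul]
  rw [h1, map_smul, a.equiv_apply_basis, Equiv.refl_apply, hb, proj_smul hp,
    proj_smul (inv_ne_zero hq), proj_rep]

/-- Integrals of functions of `sin² r(p, ·)` do not depend on `p`. -/
theorem integral_comp_sinSq_eq {f : ℝ → ℝ} (hf : Measurable f) (p q : ComplexProjectiveSpace n) :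
    ∫ x, f (sinSq p x) ∂(fubiniStudyVolume n) = ∫ x, f (sinSq q x) ∂(fubiniStudyVolume n) := by
  obtain ⟨U, hU⟩ := exists_linearIsometryEquiv p q
  have hm : ∀ p : ComplexProjectiveSpace n, Measurable fun x => f (sinSq p x) := fun p =>
    hf.comp (continuous_sinSq p).measurable
  rw [integral_riemannianVolume (hm p), integral_riemannianVolume (hm q)]
  congr 1
  set W : EuclideanSpace ℂ (Fin (n + 1)) ≃ₗᵢ[ℝ] EuclideanSpace ℂ (Fin (n + 1)) :=
    { U.toLinearEquiv.restrictScalars ℝ with norm_map' := U.norm_map }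
  have hW : ∀ Z, W Z = U Z := fun Z => rfl
  rw [← W.measurePreserving.integral_comp W.toHomeomorph.measurableEmbedding
    (fun Z => weight (‖Z‖ ^ 2) * f (sinSq q (proj Z)))]
  refine integral_congr_ae (ae_of_all _ fun Z => ?_)
  dsimp only
  rw [W.norm_map]
  by_cases hZ : Z = 0
  · rw [weight_eq_zero (Or.inl (by simp [hZ])), zero_mul, zero_mul]
  · have hUZ : U Z ≠ 0 := by simpa using hZ
    have hUp : U p.rep ≠ 0 := by simpa using p.rep_nonzero
    congr 2
    rw [hW, sinSq_proj p hZ, ← hU, sinSq, cosSq_rep _ _ hUp hUZ]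
    simp only [cosSq, U.inner_map_map, U.norm_map]

theorem measurable_profile : Measurable (profile n) := by
  unfold profile
  fun_prop

theorem contDiffAt_profile {s : ℝ} (hs : 0 < s) : ContDiffAt ℝ ∞ (profile n) s := by
  unfold profile
  refine ((contDiffAt_id.log hs.ne').div_const 2).sub (ContDiffAt.sum fun j hj => ?_)
  have hj0 : (j : ℝ) ≠ 0 := by
    have := (Finset.mem_Icc.1 hj).1
    positivity
  exact contDiffAt_const.div (contDiffAt_const.mul (contDiffAt_id.pow j))
    (by positivity)

/-- The closed formula of the Green's function in terms of `s = sin² r`. -/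
theorem log_sin_geodesicDist_sub (p q : ComplexProjectiveSpace n) :
    Real.log (Real.sin (RiemannianGeometry.geodesicDist (EuclideanSpace ℂ (Fin n)) p q)) -
      ∑ j ∈ Finset.Icc 1 (n - 1), 1 / (2 * j *
        Real.sin (RiemannianGeometry.geodesicDist (EuclideanSpace ℂ (Fin n)) p q) ^ (2 * j)) =
      profile n (sinSq p q) := by
  rw [sin_geodesicDist, profile, ← sinSq, Real.log_sqrt (sinSq_nonneg p q)]
  simp only [pow_mul, Real.sq_sqrt (sinSq_nonneg p q)]

theorem restrict_compl_singleton (hn : 1 ≤ n) (p : ComplexProjectiveSpace n) :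
    (fubiniStudyVolume n).restrict {p}ᶜ = fubiniStudyVolume n :=
  Measure.restrict_eq_self_of_ae_mem (compl_mem_ae_iff.2 (measure_singleton hn p))

theorem isGreenFunction (hn : 1 ≤ n) :
    RiemannianGeometry.IsGreenFunction (EuclideanSpace ℂ (Fin n))
      (fun p q : ComplexProjectiveSpace n =>
        -(1 / (2 * n * RiemannianGeometry.totalVolume (EuclideanSpace ℂ (Fin n))
          (ComplexProjectiveSpace n))) * profile n (sinSq p q)) where
  representation φ hφ p := by
    have hv := (totalVolume_pos (n := n)).ne'
    have hn0 : (n : ℝ) ≠ 0 := by positivity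
    obtain ⟨h1, h2⟩ := integral_profile_mul_laplaceBeltrami hn p (contDiffAt_proj_of_contMDiff hφ)
    simp only [IntegrableOn, restrict_compl_singleton hn, mul_assoc]
    refine ⟨h1.const_mul _, ?_⟩
    rw [integral_const_mul, h2]
    field_simp
    ring
  smooth := by
    rintro ⟨p, q⟩ hpq
    have h1 : 0 < sinSq p q := (sinSq_nonneg p q).lt_of_ne fun h => hpq (sinSq_eq_zero_iff.1 h.symm)
    have h2 : ContMDiffAt (𝓘(ℝ, EuclideanSpace ℂ (Fin n)).prod 𝓘(ℝ, EuclideanSpace ℂ (Fin n)))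
        𝓘(ℝ, ℝ) ∞ (fun x : ComplexProjectiveSpace n × ComplexProjectiveSpace n =>
          cosSq x.1.rep x.2.rep) (p, q) := contMDiff_cosSq (p, q)
    have h3 : ContDiffAt ℝ ∞ (fun c : ℝ => -(1 / (2 * n * RiemannianGeometry.totalVolume
        (EuclideanSpace ℂ (Fin n)) (ComplexProjectiveSpace n))) * profile n (1 - c))
        (cosSq p.rep q.rep) :=
      contDiffAt_const.mul (ContDiffAt.comp (g := profile n) (cosSq p.rep q.rep)
        (contDiffAt_profile h1) (contDiffAt_const.sub contDiffAt_id))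
    exact (h3.contMDiffAt.comp (p, q) h2).contMDiffWithinAt
  symm p q _ := by rw [sinSq_comm]
  integrable p := by
    simp only [IntegrableOn, restrict_compl_singleton hn]
    exact (integrable_profile_sinSq hn p).const_mul _
  integral_const := by
    refine ⟨∫ q, -(1 / (2 * n * RiemannianGeometry.totalVolume (EuclideanSpace ℂ (Fin n))
      (ComplexProjectiveSpace n))) * profile n (sinSq (proj (insertCoord 0 1 0)) q)
      ∂(fubiniStudyVolume n), fun p => ?_⟩
    rw [restrict_compl_singleton hn, integral_const_mul, integral_const_mul,
      integral_comp_sinSq_eq measurable_profile]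

end Representation

end ComplexProjectiveSpace

end

theorem theorem1p2 (n : ℕ) (hn : 1 ≤ n) :
    (∀ (v w : EuclideanSpace ℂ (Fin (n + 1))) (hv : v ≠ 0) (hw : w ≠ 0),
      Manifold.riemannianEDist 𝓘(ℝ, EuclideanSpace ℂ (Fin n))
          (Projectivization.mk ℂ v hv : ComplexProjectiveSpace n) (Projectivization.mk ℂ w hw) =
        ENNReal.ofReal (Real.arccos √(‖⟪v, w⟫_ℂ‖ ^ 2 / (‖v‖ ^ 2 * ‖w‖ ^ 2)))) ∧
    RiemannianGeometry.IsGreenFunction (EuclideanSpace ℂ (Fin n))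
      (fun ξ η : ComplexProjectiveSpace n =>
        -(1 / (2 * n * RiemannianGeometry.totalVolume (EuclideanSpace ℂ (Fin n))
              (ComplexProjectiveSpace n))) *
          (Real.log (Real.sin (RiemannianGeometry.geodesicDist (EuclideanSpace ℂ (Fin n)) ξ η)) -
            ∑ j ∈ Finset.Icc 1 (n - 1),
              1 / (2 * j *
                Real.sin (RiemannianGeometry.geodesicDist (EuclideanSpace ℂ (Fin n)) ξ η)
                  ^ (2 * j)))) := by
  constructor
  · intro v w hv hw
    rw [← ComplexProjectiveSpace.proj_of_ne_zero hv, ← ComplexProjectiveSpace.proj_of_ne_zero hw]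
    exact ComplexProjectiveSpace.riemannianEDist_proj hv hw
  · simp only [ComplexProjectiveSpace.log_sin_geodesicDist_sub]
    exact ComplexProjectiveSpace.isGreenFunction hn
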